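/- Let $k$ be a field and let $A$ be a finite dimensional Frobenius $k$-algebra: there is a nondegenerate bilinear form $\langle\,,\rangle$ on $A$ with $\langle ab,c\rangle=\langle a,bc\rangle$; let $\nu$ be its Nakayama automorphism, the algebra automorphism with $\langle a,b\rangle=\langle b,\nu(a)\rangle$. Bimodules are left modules over $A^{\mathrm e}=A\otimes_k A^{\mathrm{op}}$. For a bimodule $M$ and an automorphism $\beta$ of $A$, ${}_1M_\beta$ is $M$ with the right action twisted, $a\cdot m\cdot b=a\,m\,\beta(b)$; we identify $M\otimes_A{}_1N_\beta={}_1(M\otimes_AN)_\beta$ and $M\otimes_A{}_1A_\beta={}_1M_\beta$ (via $m\otimes a\mapsto ma$). Let $\mathbf P\xrightarrow{\varepsilon}A$ be a projective resolution of $A$ by finitely generated projective $A^{\mathrm e}$-modules, and let $\mathbf T$ be a complete resolution of $A$: an exact $\mathbb Z$-graded complex of finitely generated projective $A^{\mathrm e}$-modules whose $A^{\mathrm e}$-dual is exact, together with $\varepsilon:T_0\to A$ which makes $\mathbf T_{\ge0}$ a projective resolution of $A$. Let $\vartheta:\mathbf T\to\mathbf P$ be an augmentation-preserving chain map. Put $$\mathrm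 H^n(A,M)=H^n(\mathrm{Hom}_{A^{\mathrm e}}(\mathbf P,M)),\qquad \widehat{\mathrm H}^n(A,M)=H^n(\mathrm{Hom}_{A^{\mathrm e}}(\mathbf T,M)),$$ $$\mathrm H_n(A,M)=H_n(\mathbf P\otimes_{A^{\mathrm e}}M),\qquad \widehat{\mathrm H}_n(A,M)=H_n(\mathbf T\otimes_{A^{\mathrm e}}M).$$ Let $\Delta:\mathbf P\to\mathbf P\otimes_A\mathbf P$ and $\widehat\Delta:\mathbf T\to\mathbf T\,\widehat\otimes_A\mathbf T$ be diagonal approximations, that is, augmentation-preserving chain maps, where $(\mathbf T\,\widehat\otimes_A\mathbf T)_n=\prod_{p+q=n}T_p\otimes_AT_q$. The cup product $\widehat\smile$ on $\widehat{\mathrm H}^\bullet$ is induced by $u\,\widehat\smile\,v=(u\,\widehat\otimes\,v)\widehat\Delta$, where $(u\,\widehat\otimes\,v)(x\otimes y)=(-1)^{|v||x|}u(x)\otimes v(y)$. The cap products $\frown:\mathrm H^r(A,M)\otimes\mathrm H_s(A,N)\to\mathrm H_{s-r}(A,M\otimes_AN)$ and $\widehat\frown:\widehat{\mathrm H}^r(A,M)\otimes\widehat{\mathrm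 H}_s(A,N)\to\widehat{\mathrm H}_{s-r}(A,M\otimes_AN)$ are induced by applying $\Delta$, respectively $\widehat\Delta$, to the first factor of $x\otimes n$, followed by $(x'\otimes x'')\otimes n\mapsto(-1)^{|u||x'|}x'\otimes(u(x'')\otimes n)$. A fundamental class is an $\omega\in\widehat{\mathrm H}_{-1}(A,{}_1A_{\nu^{-1}})$ represented by a cycle $w\in T_{-1}\otimes_{A^{\mathrm e}}{}_1A_{\nu^{-1}}$ such that, for all $f\in\mathrm{Hom}_{A^{\mathrm e}}(T_{-1},A^{\mathrm e})$ and all $x\in T_0$, $$f(d_0x)=\sum_i\varepsilon(x)\,u_i\,\nu(c_f)\otimes v_i,\qquad c_f:=(f\otimes\mathrm{id})(w)\in{}_1A_{\nu^{-1}},$$ where $(f\otimes\mathrm{id})(x\otimes c)=\sum_j b_j\cdot c\cdot a_j$ for $f(x)=\sum_ja_j\otimes b_j$ (bimodules are right $A^{\mathrm e}$-modules through $x(a\otimes b)=bxa$), and where $(u_i)$ and $(v_i)$ are bases of $A$ with $\langle v_i,u_j\rangle=\delta_{ij}$. (It corresponds to $1\in\widehat{\mathrm H}^0(A,A)$ under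 the duality $\widehat{\mathrm H}^0(A,A)\cong\widehat{\mathrm H}_{-1}(A,{}_1A_{\nu^{-1}})$.) Let $M,N$ be bimodules and let $r\ge0$, $s\ge1$ be integers with $r-s\le-1$. Then: 1. There is exactly one fundamental class $\omega$, and the maps $-\,\widehat\frown\,\omega:\widehat{\mathrm H}^{-s}(A,N)\to\widehat{\mathrm H}_{s-1}(A,{}_1N_{\nu^{-1}})$ and $-\,\widehat\frown\,\omega:\widehat{\mathrm H}^{r-s}(A,M\otimes_AN)\to\widehat{\mathrm H}_{s-r-1}(A,{}_1(M\otimes_AN)_{\nu^{-1}})$ are isomorphisms. 2. The maps $\vartheta_*:\widehat{\mathrm H}_{s-1}(A,{}_1N_{\nu^{-1}})\to\mathrm H_{s-1}(A,{}_1N_{\nu^{-1}})$ and $\vartheta_*:\widehat{\mathrm H}_{s-r-1}(A,{}_1(M\otimes_AN)_{\nu^{-1}})\to\mathrm H_{s-r-1}(A,{}_1(M\otimes_AN)_{\nu^{-1}})$ are injective, and the ordinary cap product restricts along them to a map $$\frown:\ \mathrm H^r(A,M)\otimes\widehat{\mathrm H}_{s-1}(A,{}_1N_{\nu^{-1}})\to\widehat{\mathrm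 H}_{s-r-1}(A,{}_1(M\otimes_AN)_{\nu^{-1}}),\qquad \vartheta_*(u\frown z)=u\frown\vartheta_*(z).$$ 3. The diagram $$\begin{array}{ccc}\mathrm H^r(A,M)\otimes\widehat{\mathrm H}_{s-1}(A,{}_1N_{\nu^{-1}})&\xrightarrow{\ \frown\ }&\widehat{\mathrm H}_{s-r-1}(A,{}_1(M\otimes_AN)_{\nu^{-1}})\\ \big\downarrow{\scriptstyle\vartheta^*\otimes(-\widehat\frown\omega)^{-1}}&&\big\downarrow{\scriptstyle(-\widehat\frown\omega)^{-1}}\\ \widehat{\mathrm H}^r(A,M)\otimes\widehat{\mathrm H}^{-s}(A,N)&\xrightarrow{\ \widehat\smile\ }&\widehat{\mathrm H}^{r-s}(A,M\otimes_AN)\end{array}$$ commutes. Its right vertical map is an isomorphism; its left vertical map is an epimorphism, and an isomorphism if $r\neq0$. -/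

import Mathlib

open scoped TensorProduct
open MulOpposite
open scoped ModuleCat.Algebra

universe u v w w' w₁ w₂ w₃ w₄

noncomputable section

set_option linter.unusedSectionVars false

namespace TateHochschild

/-! ## Bimodules as left modules over the enveloping algebra -/

/-- The enveloping algebra `Aᵉ = A ⊗ Aᵒᵖ`. An `A`-bimodule (on which `k` acts centrally) is a left
`Aᵉ`-module, with `(a ⊗ bᵒ) • m = a m b`. -/
abbrev Env (k : Type u) (A : Type v) [Field k] [Ring A] [Algebra k A] : Type v :=
  A ⊗[k] Aᵐᵒᵖ

section Shortcuts

variable (k : Type u) (A : Type v) [Field k] [Ring A] [Algebra k A]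

instance : Ring (Env k A) := Algebra.TensorProduct.instRing
instance : Semiring (Env k A) := Algebra.TensorProduct.instSemiring
instance : Algebra k (Env k A) := Algebra.TensorProduct.instAlgebra

variable (M : Type w₁) [AddCommGroup M] [Module k M] [Module (Env k A) M]
  [IsScalarTower k (Env k A) M]
variable (N : Type w₂) [AddCommGroup N] [Module k N] [Module (Env k A) N]
  [IsScalarTower k (Env k A) N]

instance : SMulCommClass (Env k A) k M := IsScalarTower.to_smulCommClass'
instance : AddCommGroup (M →ₗ[Env k A] N) := LinearMap.addCommGroup
instance : Module k (M →ₗ[Env k A] N) := LinearMap.module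

end Shortcuts

section Bimodules

variable (k : Type u) {A : Type v} [Field k] [Ring A] [Algebra k A]

variable {k} in
@[elab_as_elim]
theorem env_induction {p : Env k A → Prop} (e : Env k A) (ht : ∀ (a : A) (b : Aᵐᵒᵖ), p (a ⊗ₜ[k] b))
    (ha : ∀ x y, p x → p y → p (x + y)) : p e := by
  induction e using TensorProduct.induction_on with
  | zero => simpa using ht 0 0
  | tmul a b => exact ht a b
  | add x y hx hy => exact ha x y hx hy

/-- The element of `Aᵉ` acting as left multiplication by `a`. -/
def lop (a : A) : Env k A := a ⊗ₜ[k] 1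

/-- The element of `Aᵉ` acting as right multiplication by `a`. -/
def rop (a : A) : Env k A := 1 ⊗ₜ[k] op a

variable (A) in
/-- `A` as a bimodule over itself: `(a ⊗ bᵒ) • x = a x b`. -/
instance regularModule : Module (Env k A) A := TensorProduct.Algebra.module

theorem regular_smul (a x : A) (b : Aᵐᵒᵖ) :
    ((a ⊗ₜ[k] b : Env k A) • x) = a * (x * unop b) := rfl

variable (A) in
instance regularTower : IsScalarTower k (Env k A) A where
  smul_assoc c e x := by
    induction e using env_induction with
    | ht a b =>
      rw [TensorProduct.smul_tmul', regular_smul, regular_smul, smul_mul_assoc]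
    | ha e f he hf => rw [smul_add, add_smul, he, hf, add_smul, smul_add]

variable (A) in
/-- The `k`-linear flip `a ⊗ bᵒ ↦ b ⊗ aᵒ` of `Aᵉ`, an anti-automorphism. It turns left
`Aᵉ`-modules into right ones: `x (a ⊗ bᵒ) = b x a`. -/
def flip : Env k A →ₗ[k] Env k A :=
  TensorProduct.map (opLinearEquiv k (M := A)).symm.toLinearMap
      (opLinearEquiv k (M := A)).toLinearMap ∘ₗ
    (TensorProduct.comm k A Aᵐᵒᵖ).toLinearMap

@[simp] theorem flip_tmul (a : A) (b : Aᵐᵒᵖ) :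
    flip k A (a ⊗ₜ[k] b) = unop b ⊗ₜ[k] op a := rfl

theorem flip_mul (x y : Env k A) : flip k A (x * y) = flip k A y * flip k A x := by
  induction x using TensorProduct.induction_on with
  | zero => simp
  | add x x' hx hx' => rw [add_mul, map_add, hx, hx', map_add, mul_add]
  | tmul a b =>
    induction y using TensorProduct.induction_on with
    | zero => simp
    | add y y' hy hy' => rw [mul_add, map_add, hy, hy', map_add, add_mul]
    | tmul c d => simp

theorem lop_regular (a x : A) : lop k a • x = a * x := by
  rw [lop, regular_smul, unop_one, mul_one]

theorem rop_regular (a x : A) : rop k a • x = x * a := by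
  rw [rop, regular_smul, unop_op, one_mul]

theorem rop_rop {M : Type w} [AddCommGroup M] [Module (Env k A) M] (a b : A) (m : M) :
    rop k a • rop k b • m = rop k (b * a) • m := by
  rw [← mul_smul, rop, rop, rop, Algebra.TensorProduct.tmul_mul_tmul, one_mul, op_mul]

variable {k} in
theorem smul_of_tmul {M : Type w} [AddCommGroup M] [Module (Env k A) M] (a : A) (b : Aᵐᵒᵖ) (m : M) :
    ((a ⊗ₜ[k] b : Env k A) • m) = lop k a • rop k (unop b) • m := by
  rw [← mul_smul, lop, rop, Algebra.TensorProduct.tmul_mul_tmul]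
  simp

theorem lop_rop_comm {M : Type w} [AddCommGroup M] [Module (Env k A) M] (a b : A) (m : M) :
    lop k a • rop k b • m = rop k b • lop k a • m := by
  rw [← mul_smul, ← mul_smul, lop, rop, Algebra.TensorProduct.tmul_mul_tmul,
    Algebra.TensorProduct.tmul_mul_tmul]
  simp

/-! ## The tensor product `M ⊗_A N` of bimodules -/

section BTensor

variable (A)
variable (M : Type w₁) (N : Type w₂) [AddCommGroup M] [Module k M] [Module (Env k A) M]
  [AddCommGroup N] [Module k N] [Module (Env k A) N]

/-- The relations `m a ⊗ n - m ⊗ a n`. -/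
def bRel : Submodule k (M ⊗[k] N) :=
  Submodule.span k {t | ∃ (a : A) (m : M) (n : N),
    t = (rop k a • m) ⊗ₜ[k] n - m ⊗ₜ[k] (lop k a • n)}

/-- `M ⊗_A N`. -/
def BTensor : Type (max w₁ w₂) := (M ⊗[k] N) ⧸ bRel k A M N

instance : AddCommGroup (BTensor k A M N) :=
  inferInstanceAs (AddCommGroup ((M ⊗[k] N) ⧸ bRel k A M N))

instance : Module k (BTensor k A M N) :=
  inferInstanceAs (Module k ((M ⊗[k] N) ⧸ bRel k A M N))

namespace BTensor

variable {M N}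

variable (M N) in
/-- The canonical projection `M ⊗ N → M ⊗_A N`. -/
def proj : M ⊗[k] N →ₗ[k] BTensor k A M N := (bRel k A M N).mkQ

/-- The pure tensor `m ⊗_A n`. -/
def tmul (m : M) (n : N) : BTensor k A M N := proj k A M N (m ⊗ₜ[k] n)

theorem balanced (a : A) (m : M) (n : N) :
    tmul k A (rop k a • m) n = tmul k A m (lop k a • n) := by
  refine (Submodule.Quotient.eq _).2 (Submodule.subset_span ⟨a, m, n, rfl⟩)

variable {k A}

/-- The universal property of `M ⊗_A N`. -/
def lift {Q : Type w₃} [AddCommGroup Q] [Module k Q] (φ : M →ₗ[k] N →ₗ[k] Q)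
    (h : ∀ (a : A) m n, φ (rop k a • m) n = φ m (lop k a • n)) : BTensor k A M N →ₗ[k] Q :=
  (bRel k A M N).liftQ (TensorProduct.lift φ) (by
    rw [bRel, Submodule.span_le]
    rintro _ ⟨a, m, n, rfl⟩
    simp [h])

@[simp] theorem lift_tmul {Q : Type w₃} [AddCommGroup Q] [Module k Q] (φ : M →ₗ[k] N →ₗ[k] Q)
    (h : ∀ (a : A) m n, φ (rop k a • m) n = φ m (lop k a • n)) (m : M) (n : N) :
    lift φ h (tmul k A m n) = φ m n := rfl

theorem ext {Q : Type w₃} [AddCommGroup Q] [Module k Q] {f g : BTensor k A M N →ₗ[k] Q}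
    (h : ∀ m n, f (tmul k A m n) = g (tmul k A m n)) : f = g := by
  refine Submodule.linearMap_qext _ (TensorProduct.ext' ?_)
  exact h

@[elab_as_elim]
theorem induction {p : BTensor k A M N → Prop} (h0 : p 0) (ht : ∀ m n, p (tmul k A m n))
    (ha : ∀ x y, p x → p y → p (x + y)) (t : BTensor k A M N) : p t := by
  obtain ⟨t, rfl⟩ : ∃ t', proj k A M N t' = t := Submodule.mkQ_surjective _ t
  induction t using TensorProduct.induction_on with
  | zero => rw [map_zero]; exact h0
  | tmul m n => exact ht m n
  | add x y hx hy => rw [map_add]; exact ha _ _ hx hy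

theorem tmul_add (m : M) (n n' : N) :
    tmul k A m (n + n') = tmul k A m n + tmul k A m n' := by
  rw [tmul, TensorProduct.tmul_add, map_add]; rfl

theorem add_tmul (m m' : M) (n : N) :
    tmul k A (m + m') n = tmul k A m n + tmul k A m' n := by
  rw [tmul, TensorProduct.add_tmul, map_add]; rfl

theorem tmul_smul (c : k) (m : M) (n : N) : tmul k A m (c • n) = c • tmul k A m n := by
  rw [tmul, TensorProduct.tmul_smul, map_smul]; rfl

theorem smul_tmul (c : k) (m : M) (n : N) : tmul k A (c • m) n = c • tmul k A m n := by
  rw [tmul, ← TensorProduct.smul_tmul', map_smul]; rfl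

/-- `(m, n) ↦ m ⊗_A n` as a bilinear map. -/
def mk : M →ₗ[k] N →ₗ[k] BTensor k A M N :=
  LinearMap.mk₂ k (tmul k A) add_tmul smul_tmul tmul_add tmul_smul

@[simp] theorem mk_apply (m : M) (n : N) : (mk m n : BTensor k A M N) = tmul k A m n := rfl

variable [IsScalarTower k (Env k A) M] [IsScalarTower k (Env k A) N]

/-- The action of `e ∈ Aᵉ` on a bimodule, as a `k`-linear map. -/
def act {M : Type w₁} [AddCommGroup M] [Module k M] [Module (Env k A) M]
    [IsScalarTower k (Env k A) M] : Env k A →ₐ[k] Module.End k M := Algebra.lsmul k k M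

@[simp] theorem act_apply (e : Env k A) (m : M) : act e m = e • m := rfl

/-- The left action on `M ⊗_A N`. -/
def lact (a : A) : BTensor k A M N →ₗ[k] BTensor k A M N :=
  lift (mk ∘ₗ act (lop k a)) (by
    intro b m n
    simp [lop_rop_comm, balanced])

@[simp] theorem lact_tmul (a : A) (m : M) (n : N) :
    lact a (tmul k A m n) = tmul k A (lop k a • m) n := rfl

/-- The right action on `M ⊗_A N`. -/
def ract (a : A) : BTensor k A M N →ₗ[k] BTensor k A M N :=
  lift (mk.compl₂ (act (rop k a))) (by
    intro b m n
    simp [← lop_rop_comm, balanced])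

@[simp] theorem ract_tmul (a : A) (m : M) (n : N) :
    ract a (tmul k A m n) = tmul k A m (rop k a • n) := rfl

/-- The left action of `A` on `M ⊗_A N` as an algebra map. -/
def rhoL : A →ₐ[k] Module.End k (BTensor k A M N) :=
  AlgHom.ofLinearMap
    { toFun := lact
      map_add' := fun a b => ext fun m n => by
        simp [lop, TensorProduct.add_tmul, add_smul, add_tmul]
      map_smul' := fun c a => ext fun m n => by
        simp [lop, ← TensorProduct.smul_tmul', smul_tmul] }
    (ext fun m n => by
      simp [lop, ← Algebra.TensorProduct.one_def])
    (fun a b => ext fun m n => by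
      simp [lop, ← mul_smul, Algebra.TensorProduct.tmul_mul_tmul])

/-- The right action of `A` on `M ⊗_A N` as an algebra map from `Aᵒᵖ`. -/
def rhoR : Aᵐᵒᵖ →ₐ[k] Module.End k (BTensor k A M N) :=
  AlgHom.ofLinearMap
    { toFun := fun b => ract (unop b)
      map_add' := fun a b => ext fun m n => by
        simp [rop, TensorProduct.tmul_add, add_smul, tmul_add]
      map_smul' := fun c a => ext fun m n => by
        simp [rop, tmul_smul] }
    (ext fun m n => by
      simp [rop, ← Algebra.TensorProduct.one_def])
    (fun a b => ext fun m n => by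
      simp [rop, ← mul_smul, Algebra.TensorProduct.tmul_mul_tmul])

/-- `Aᵉ` acts on `M ⊗_A N` by `(a ⊗ bᵒ) • (m ⊗ n) = a m ⊗ n b`. -/
def rho : Env k A →ₐ[k] Module.End k (BTensor k A M N) :=
  Algebra.TensorProduct.lift rhoL rhoR (fun _ _ => ext fun _ _ => rfl)

theorem rho_tmul (a : A) (b : Aᵐᵒᵖ) :
    rho (a ⊗ₜ[k] b) = (rhoL a * rhoR b : Module.End k (BTensor k A M N)) :=
  Algebra.TensorProduct.lift_tmul _ _ _ _ _

instance : Module (Env k A) (BTensor k A M N) :=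
  Module.compHom _ (rho (k := k) (A := A) (M := M) (N := N)).toRingHom

theorem env_smul_def (e : Env k A) (t : BTensor k A M N) : e • t = rho e t := rfl

@[simp] theorem env_smul_tmul (a : A) (b : Aᵐᵒᵖ) (m : M) (n : N) :
    ((a ⊗ₜ[k] b : Env k A) • tmul k A m n) =
      tmul k A (lop k a • m) (rop k (unop b) • n) := by
  rw [env_smul_def, rho_tmul]
  rfl

@[simp] theorem lop_smul_tmul (a : A) (m : M) (n : N) :
    lop k a • tmul k A m n = tmul k A (lop k a • m) n := by
  rw [lop, env_smul_tmul]
  simp [lop, rop, ← Algebra.TensorProduct.one_def]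

@[simp] theorem rop_smul_tmul (a : A) (m : M) (n : N) :
    rop k a • tmul k A m n = tmul k A m (rop k a • n) := by
  rw [rop, env_smul_tmul]
  simp [lop, rop, ← Algebra.TensorProduct.one_def]

instance : IsScalarTower k (Env k A) (BTensor k A M N) where
  smul_assoc c e t := by simp [env_smul_def]

/-- A `k`-linear map that commutes with the left and the right action is `Aᵉ`-linear. -/
def ofBimod {M : Type w₁} {N : Type w₂} [AddCommGroup M] [Module k M] [Module (Env k A) M]
    [AddCommGroup N] [Module k N] [Module (Env k A) N]
    (f : M →ₗ[k] N) (hl : ∀ (a : A) m, f (lop k a • m) = lop k a • f m)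
    (hr : ∀ (a : A) m, f (rop k a • m) = rop k a • f m) : M →ₗ[Env k A] N where
  toFun := f
  map_add' := f.map_add
  map_smul' e m := by
    induction e using env_induction with
    | ht a b => simp [smul_of_tmul, hl, hr]
    | ha e e' h h' => rw [add_smul, map_add, h, h', RingHom.id_apply, RingHom.id_apply,
        RingHom.id_apply, add_smul]

/-- `u ⊗_A v` for bimodule homomorphisms `u`, `v` (no sign). -/
def map {M' : Type w₃} {N' : Type w₄} [AddCommGroup M'] [Module k M'] [Module (Env k A) M']
    [AddCommGroup N'] [Module k N'] [Module (Env k A) N']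
    [IsScalarTower k (Env k A) M'] [IsScalarTower k (Env k A) N']
    (f : M →ₗ[Env k A] M') (g : N →ₗ[Env k A] N') :
    BTensor k A M N →ₗ[Env k A] BTensor k A M' N' :=
  ofBimod (lift ((mk.compl₂ (g.restrictScalars k)) ∘ₗ f.restrictScalars k)
      (by intro a m n; simp [balanced]))
    (fun a t => by
      induction t using induction with
      | h0 => simp
      | ht m n => simp
      | ha x y hx hy => rw [smul_add, map_add, hx, hy, map_add, smul_add])
    (fun a t => by
      induction t using induction with
      | h0 => simp
      | ht m n => simp
      | ha x y hx hy => rw [smul_add, map_add, hx, hy, map_add, smul_add])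

@[simp] theorem map_tmul {M' : Type w₃} {N' : Type w₄} [AddCommGroup M'] [Module k M']
    [Module (Env k A) M'] [AddCommGroup N'] [Module k N'] [Module (Env k A) N']
    [IsScalarTower k (Env k A) M'] [IsScalarTower k (Env k A) N']
    (f : M →ₗ[Env k A] M') (g : N →ₗ[Env k A] N') (m : M) (n : N) :
    map f g (tmul k A m n) = tmul k A (f m) (g n) := rfl

variable (k) in
/-- The multiplication `A ⊗_A A → A`, an isomorphism. -/
def mulA : BTensor k A A A →ₗ[k] A :=
  lift (LinearMap.mul k A) (by
    intro a m n
    simp [lop, rop, regular_smul, mul_assoc])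

end BTensor

end BTensor

/-! ## The tensor product `X ⊗_{Aᵉ} N` -/

section EnvTensor

variable (A)
variable (X : Type w₁) (N : Type w₂) [AddCommGroup X] [Module k X] [Module (Env k A) X]
  [AddCommGroup N] [Module k N] [Module (Env k A) N]

/-- The relations `x e ⊗ n - x ⊗ e n` for `e ∈ Aᵉ`, where the bimodule `X` is a right `Aᵉ`-module
through `x (a ⊗ bᵒ) = b x a`. -/
def envRel : Submodule k (X ⊗[k] N) :=
  Submodule.span k {t | ∃ (e : Env k A) (x : X) (n : N),
    t = (flip k A e • x) ⊗ₜ[k] n - x ⊗ₜ[k] (e • n)}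

/-- `X ⊗_{Aᵉ} N`. -/
def EnvTensor : Type (max w₁ w₂) := (X ⊗[k] N) ⧸ envRel k A X N

instance : AddCommGroup (EnvTensor k A X N) :=
  inferInstanceAs (AddCommGroup ((X ⊗[k] N) ⧸ envRel k A X N))

instance : Module k (EnvTensor k A X N) :=
  inferInstanceAs (Module k ((X ⊗[k] N) ⧸ envRel k A X N))

namespace EnvTensor

/-- The canonical projection `X ⊗ N → X ⊗_{Aᵉ} N`. -/
def proj : X ⊗[k] N →ₗ[k] EnvTensor k A X N := (envRel k A X N).mkQ

variable {X N}

/-- The pure tensor `x ⊗_{Aᵉ} n`. -/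
def tmul (x : X) (n : N) : EnvTensor k A X N := proj k A X N (x ⊗ₜ[k] n)

theorem balanced (e : Env k A) (x : X) (n : N) :
    tmul k A (flip k A e • x) n = tmul k A x (e • n) := by
  refine (Submodule.Quotient.eq _).2 (Submodule.subset_span ⟨e, x, n, rfl⟩)

variable {k A}

/-- The universal property of `X ⊗_{Aᵉ} N`. -/
def lift {Q : Type w₃} [AddCommGroup Q] [Module k Q] (φ : X →ₗ[k] N →ₗ[k] Q)
    (h : ∀ (e : Env k A) x n, φ (flip k A e • x) n = φ x (e • n)) : EnvTensor k A X N →ₗ[k] Q :=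
  (envRel k A X N).liftQ (TensorProduct.lift φ) (by
    rw [envRel, Submodule.span_le]
    rintro _ ⟨a, m, n, rfl⟩
    simp [h])

@[simp] theorem lift_tmul {Q : Type w₃} [AddCommGroup Q] [Module k Q] (φ : X →ₗ[k] N →ₗ[k] Q)
    (h : ∀ (e : Env k A) x n, φ (flip k A e • x) n = φ x (e • n)) (x : X) (n : N) :
    lift φ h (tmul k A x n) = φ x n := rfl

theorem ext {Q : Type w₃} [AddCommGroup Q] [Module k Q] {f g : EnvTensor k A X N →ₗ[k] Q}
    (h : ∀ x n, f (tmul k A x n) = g (tmul k A x n)) : f = g := by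
  refine Submodule.linearMap_qext _ (TensorProduct.ext' ?_)
  exact h

/-- `(x, n) ↦ x ⊗_{Aᵉ} n` as a bilinear map. -/
def mk : X →ₗ[k] N →ₗ[k] EnvTensor k A X N :=
  (TensorProduct.mk k X N).compr₂ (proj k A X N)

@[simp] theorem mk_apply (x : X) (n : N) : (mk x n : EnvTensor k A X N) = tmul k A x n := rfl

variable [IsScalarTower k (Env k A) X] [IsScalarTower k (Env k A) N]

/-- `f ⊗_{Aᵉ} g` for bimodule homomorphisms `f`, `g`. -/
def map {X' : Type w₃} {N' : Type w₄} [AddCommGroup X'] [Module k X'] [Module (Env k A) X']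
    [AddCommGroup N'] [Module k N'] [Module (Env k A) N']
    [IsScalarTower k (Env k A) X'] [IsScalarTower k (Env k A) N']
    (f : X →ₗ[Env k A] X') (g : N →ₗ[Env k A] N') :
    EnvTensor k A X N →ₗ[k] EnvTensor k A X' N' :=
  lift ((mk.compl₂ (g.restrictScalars k)) ∘ₗ f.restrictScalars k)
      (by intro e x n; simp [balanced])

@[simp] theorem map_tmul {X' : Type w₃} {N' : Type w₄} [AddCommGroup X'] [Module k X']
    [Module (Env k A) X'] [AddCommGroup N'] [Module k N'] [Module (Env k A) N']
    [IsScalarTower k (Env k A) X'] [IsScalarTower k (Env k A) N']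
    (f : X →ₗ[Env k A] X') (g : N →ₗ[Env k A] N') (x : X) (n : N) :
    map f g (tmul k A x n) = tmul k A (f x) (g n) := rfl

variable {Y : Type w₃} {M : Type w₄} [AddCommGroup Y] [Module k Y] [Module (Env k A) Y]
  [AddCommGroup M] [Module k M] [Module (Env k A) M]
  [IsScalarTower k (Env k A) Y] [IsScalarTower k (Env k A) M]

theorem balanced_lop (a : A) (x : X) (n : N) :
    tmul k A (lop k a • x) n = tmul k A x (rop k a • n) :=
  balanced k A (rop k a) x n

theorem balanced_rop (a : A) (x : X) (n : N) :
    tmul k A (rop k a • x) n = tmul k A x (lop k a • n) :=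
  balanced k A (lop k a) x n

/-- Auxiliary bilinear map `(x ⊗ y, n) ↦ x ⊗ (u(y) ⊗ n)`. -/
def contractAux (u : Y →ₗ[Env k A] M) :
    BTensor k A X Y →ₗ[k] N →ₗ[k] EnvTensor k A X (BTensor k A M N) :=
  BTensor.lift
    (((LinearMap.llcomp k N (BTensor k A M N) (EnvTensor k A X (BTensor k A M N))) ∘ₗ mk).compl₂
      (BTensor.mk ∘ₗ u.restrictScalars k))
    (by
      intro a x y
      ext n
      simp [balanced_rop])

theorem contractAux_tmul (u : Y →ₗ[Env k A] M) (x : X) (y : Y) (n : N) :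
    contractAux u (BTensor.tmul k A x y) n = tmul k A x (BTensor.tmul k A (u y) n) := rfl

theorem contractAux_balanced (u : Y →ₗ[Env k A] M) (e : Env k A) (t : BTensor k A X Y) (n : N) :
    contractAux u (flip k A e • t) n = contractAux u t (e • n) := by
  induction t using BTensor.induction with
  | h0 => rw [smul_zero, map_zero, LinearMap.zero_apply, LinearMap.zero_apply]
  | ha x y hx hy => rw [smul_add, map_add, map_add, LinearMap.add_apply, LinearMap.add_apply,
      hx, hy]
  | ht x y =>
    induction e using env_induction with
    | ha e e' h h' => rw [map_add, add_smul, add_smul, map_add, map_add, LinearMap.add_apply,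
        h, h']
    | ht a b =>
      rw [flip_tmul, BTensor.env_smul_tmul, contractAux_tmul, contractAux_tmul, unop_op,
        map_smul, balanced_lop, BTensor.rop_smul_tmul, BTensor.balanced, smul_of_tmul]

/-- For `u : Y → M`, the map
`(X ⊗_A Y) ⊗_{Aᵉ} N → X ⊗_{Aᵉ} (M ⊗_A N)`, `(x ⊗ y) ⊗ n ↦ x ⊗ (u(y) ⊗ n)` (no sign). -/
def contract (u : Y →ₗ[Env k A] M) :
    EnvTensor k A (BTensor k A X Y) N →ₗ[k] EnvTensor k A X (BTensor k A M N) :=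
  lift (contractAux u) (contractAux_balanced u)

@[simp] theorem contract_tmul (u : Y →ₗ[Env k A] M) (x : X) (y : Y) (n : N) :
    contract u (tmul k A (BTensor.tmul k A x y) n) = tmul k A x (BTensor.tmul k A (u y) n) := rfl

/-- For `f ∈ Hom_{Aᵉ}(X, Aᵉ)`, the evaluation map `f ⊗ id : X ⊗_{Aᵉ} N → Aᵉ ⊗_{Aᵉ} N = N`. If
`f(x) = ∑ pⱼ ⊗ qⱼᵒ`, then `x ⊗ n ↦ ∑ qⱼ n pⱼ`, since the right `Aᵉ`-module structures of `X` and
`Aᵉ` that belong to their bimodule structures are the ones obtained through the flip. -/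
def eval (f : X →ₗ[Env k A] Env k A) : EnvTensor k A X N →ₗ[k] N :=
  lift ((Algebra.lsmul k k N).toLinearMap ∘ₗ flip k A ∘ₗ f.restrictScalars k)
    (by
      intro e x n
      simp only [LinearMap.coe_comp, Function.comp_apply, LinearMap.coe_restrictScalars, map_smul,
        smul_eq_mul, flip_mul, AlgHom.toLinearMap_apply, Algebra.lsmul_coe, mul_smul]
      congr 2
      induction e using env_induction with
      | ht a b => simp
      | ha e e' h h' => simp [h, h'])

@[simp] theorem eval_tmul (f : X →ₗ[Env k A] Env k A) (x : X) (n : N) :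
    eval f (tmul k A x n) = flip k A (f x) • n := rfl

end EnvTensor

end EnvTensor

/-! ## Twisted bimodules -/

section Twist

variable {k}

/-- The bimodule `₁M_β`: the `k`-module `M` with the action `a * m * b = a m β(b)`. -/
def RightTwist (_β : A ≃ₐ[k] A) (M : Type w) : Type w := M

variable (β : A ≃ₐ[k] A) (M : Type w) [AddCommGroup M] [Module k M] [Module (Env k A) M]

instance : AddCommGroup (RightTwist β M) := inferInstanceAs (AddCommGroup M)

instance : Module k (RightTwist β M) := inferInstanceAs (Module k M)

/-- The algebra map `a ⊗ bᵒ ↦ a ⊗ β(b)ᵒ` of `Aᵉ`. -/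
def twistEnv : Env k A →ₐ[k] Env k A :=
  Algebra.TensorProduct.map (AlgHom.id k A) (AlgHom.op (β : A →ₐ[k] A))

instance : Module (Env k A) (RightTwist β M) :=
  Module.compHom M (twistEnv β).toRingHom

/-- The identity map `M → ₁M_β`. -/
def toTwist : M ≃ₗ[k] RightTwist β M := LinearEquiv.refl k M

variable {M}

theorem toTwist_smul (e : Env k A) (m : M) :
    e • toTwist β M m = toTwist β M (twistEnv β e • m) := rfl

@[simp] theorem lop_toTwist (a : A) (m : M) :
    lop k a • toTwist β M m = toTwist β M (lop k a • m) := by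
  rw [toTwist_smul]
  simp [twistEnv, lop]

@[simp] theorem rop_toTwist (a : A) (m : M) :
    rop k a • toTwist β M m = toTwist β M (rop k (β a) • m) := by
  rw [toTwist_smul]
  simp [twistEnv, rop]

variable [IsScalarTower k (Env k A) M]

instance : IsScalarTower k (Env k A) (RightTwist β M) where
  smul_assoc c e m := by
    obtain ⟨m, rfl⟩ := (toTwist β M).surjective m
    rw [toTwist_smul, toTwist_smul, map_smul (twistEnv β), smul_assoc, map_smul (toTwist β M)]

variable {N : Type w'} [AddCommGroup N] [Module k N] [Module (Env k A) N]
  [IsScalarTower k (Env k A) N]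

/-- Auxiliary bilinear map `(m, a) ↦ m a`. -/
def twistMul : M →ₗ[k] RightTwist β A →ₗ[k] RightTwist β M :=
  LinearMap.mk₂ k (fun (m : M) (a : RightTwist β A) =>
      toTwist β M (rop k ((toTwist β A).symm a) • m))
    (fun m m' a => by rw [smul_add, map_add])
    (fun c m a => by rw [smul_comm, map_smul])
    (fun m a a' => by
      rw [map_add, ← map_add (toTwist β M), ← add_smul, rop, op_add, TensorProduct.tmul_add]; rfl)
    (fun c m a => by
      rw [map_smul (toTwist β A).symm, rop, op_smul, TensorProduct.tmul_smul, smul_assoc,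
        map_smul (toTwist β M)]
      rfl)

theorem twistMul_apply (m : M) (a : A) :
    twistMul β m (toTwist β A a) = toTwist β M (rop k a • m) := rfl

theorem twistMul_balanced (a : A) (m : M) (b : RightTwist β A) :
    twistMul β (rop k a • m) b = twistMul β m (lop k a • b) := by
  obtain ⟨b, rfl⟩ := (toTwist β A).surjective b
  rw [lop_toTwist, twistMul_apply, twistMul_apply, lop_regular, rop_rop]

variable (M) in
/-- The isomorphism `M ⊗_A ₁A_β → ₁M_β`, `m ⊗ a ↦ m a`. -/
def twistUnit : BTensor k A M (RightTwist β A) →ₗ[Env k A] RightTwist β M :=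
  BTensor.ofBimod (BTensor.lift (twistMul β) (twistMul_balanced β))
    (by
      intro a t
      induction t using BTensor.induction with
      | h0 => rw [smul_zero, map_zero, smul_zero]
      | ha x y hx hy => rw [smul_add, map_add, hx, hy, map_add, smul_add]
      | ht m b =>
        obtain ⟨b, rfl⟩ := (toTwist β A).surjective b
        rw [BTensor.lop_smul_tmul, BTensor.lift_tmul, BTensor.lift_tmul, twistMul_apply,
          twistMul_apply, lop_toTwist, lop_rop_comm])
    (by
      intro a t
      induction t using BTensor.induction with
      | h0 => rw [smul_zero, map_zero, smul_zero]
      | ha x y hx hy => rw [smul_add, map_add, hx, hy, map_add, smul_add]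
      | ht m b =>
        obtain ⟨b, rfl⟩ := (toTwist β A).surjective b
        rw [BTensor.rop_smul_tmul, BTensor.lift_tmul, BTensor.lift_tmul, rop_toTwist,
          twistMul_apply, twistMul_apply, rop_toTwist, rop_regular, rop_rop])

@[simp] theorem twistUnit_tmul (m : M) (a : A) :
    twistUnit β M (BTensor.tmul k A m (toTwist β A a)) = toTwist β M (rop k a • m) := rfl

variable (M N) in
/-- The isomorphism `M ⊗_A ₁N_β → ₁(M ⊗_A N)_β`, `m ⊗ n ↦ m ⊗ n`. -/
def twistAssoc : BTensor k A M (RightTwist β N) →ₗ[Env k A] RightTwist β (BTensor k A M N) :=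
  BTensor.ofBimod
    (BTensor.lift
      ((LinearMap.compr₂ (BTensor.mk (k := k) (A := A) (M := M) (N := N))
        (toTwist β (BTensor k A M N)).toLinearMap).compl₂ (toTwist β N).symm.toLinearMap)
      (by
        intro a m n
        obtain ⟨n, rfl⟩ := (toTwist β N).surjective n
        simp [BTensor.balanced]))
    (by
      intro a t
      induction t using BTensor.induction with
      | h0 => simp
      | ha x y hx hy => rw [smul_add, map_add, hx, hy, map_add, smul_add]
      | ht m n => simp)
    (by
      intro a t
      induction t using BTensor.induction with
      | h0 => simp
      | ha x y hx hy => rw [smul_add, map_add, hx, hy, map_add, smul_add]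
      | ht m n =>
        obtain ⟨n, rfl⟩ := (toTwist β N).surjective n
        simp)

@[simp] theorem twistAssoc_tmul (m : M) (n : N) :
    twistAssoc β M N (BTensor.tmul k A m (toTwist β N n)) =
      toTwist β (BTensor k A M N) (BTensor.tmul k A m n) := rfl

end Twist

end Bimodules

/-! ## Homology of a pair of composable linear maps -/

section Homology

variable {k : Type u} [Field k] {V W U V' W' U' V'' W'' U'' : Type*}
  [AddCommGroup V] [Module k V] [AddCommGroup W] [Module k W] [AddCommGroup U] [Module k U]
  [AddCommGroup V'] [Module k V'] [AddCommGroup W'] [Module k W'] [AddCommGroup U'] [Module k U']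
  [AddCommGroup V''] [Module k V''] [AddCommGroup W''] [Module k W''] [AddCommGroup U'']
  [Module k U'']

/-- `Ker g / Im f` for `V --f--> W --g--> U`. -/
def Homol (f : V →ₗ[k] W) (g : W →ₗ[k] U) :=
  LinearMap.ker g ⧸ (LinearMap.range f).submoduleOf (LinearMap.ker g)

instance (f : V →ₗ[k] W) (g : W →ₗ[k] U) : AddCommGroup (Homol f g) :=
  inferInstanceAs (AddCommGroup (_ ⧸ (LinearMap.range f).submoduleOf (LinearMap.ker g)))

instance (f : V →ₗ[k] W) (g : W →ₗ[k] U) : Module k (Homol f g) :=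
  inferInstanceAs (Module k (_ ⧸ (LinearMap.range f).submoduleOf (LinearMap.ker g)))

namespace Homol

variable {f : V →ₗ[k] W} {g : W →ₗ[k] U} {f' : V' →ₗ[k] W'} {g' : W' →ₗ[k] U'}
  {f'' : V'' →ₗ[k] W''} {g'' : W'' →ₗ[k] U''}

variable (f g) in
/-- The class of a cycle. -/
def cls : LinearMap.ker g →ₗ[k] Homol f g :=
  Submodule.mkQ ((LinearMap.range f).submoduleOf (LinearMap.ker g))

variable (f g) in
theorem cls_surjective : Function.Surjective (cls f g) := Submodule.mkQ_surjective _

theorem cls_eq_zero {z : LinearMap.ker g} : cls f g z = 0 ↔ ∃ x, f x = z :=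
  Submodule.Quotient.mk_eq_zero _

/-- The map on homology induced by `φ : W → W'`. -/
def map (φ : W →ₗ[k] W') (hZ : ∀ z, g z = 0 → g' (φ z) = 0)
    (hB : ∀ x, ∃ y, f' y = φ (f x)) : Homol f g →ₗ[k] Homol f' g' :=
  Submodule.mapQ _ _ (φ.restrict (p := LinearMap.ker g) (q := LinearMap.ker g') hZ) (by
    rintro ⟨z, hz⟩ ⟨x, hx⟩
    obtain ⟨y, hy⟩ := hB x
    exact ⟨y, by rw [hy, hx]; rfl⟩)

@[simp] theorem map_cls (φ : W →ₗ[k] W') (hZ : ∀ z, g z = 0 → g' (φ z) = 0)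
    (hB : ∀ x, ∃ y, f' y = φ (f x)) (z : LinearMap.ker g) :
    map φ hZ hB (cls f g z) = cls f' g' ⟨φ z, hZ z z.2⟩ := rfl

/-- The bilinear map on homology induced by a bilinear map `φ` for which the product of two cycles
is a cycle, and the product of a boundary and a cycle, in either order, is a boundary. -/
def map₂ (φ : W →ₗ[k] W' →ₗ[k] W'') (hZ : ∀ z z', g z = 0 → g' z' = 0 → g'' (φ z z') = 0)
    (hl : ∀ x z', g' z' = 0 → ∃ y, f'' y = φ (f x) z')
    (hr : ∀ z x', g z = 0 → ∃ y, f'' y = φ z (f' x')) :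
    Homol f g →ₗ[k] Homol f' g' →ₗ[k] Homol f'' g'' :=
  Submodule.liftQ ((LinearMap.range f).submoduleOf (LinearMap.ker g))
    (LinearMap.mk₂ k
      (fun (z : LinearMap.ker g) (c : Homol f' g') =>
        map (φ z) (fun z' hz' => hZ z z' z.2 hz') (fun x' => hr z x' z.2) c)
      (fun z₁ z₂ c => by
        obtain ⟨c, rfl⟩ := cls_surjective _ _ c
        exact congrArg (cls f'' g'') (Subtype.ext (LinearMap.map_add₂ φ _ _ _)))
      (fun a z c => by
        obtain ⟨c, rfl⟩ := cls_surjective _ _ c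
        exact congrArg (cls f'' g'') (Subtype.ext (LinearMap.map_smul₂ φ _ _ _)))
      (fun z c c' => map_add _ c c')
      (fun a z c => map_smul _ a c))
    (by
      rintro ⟨z, hz⟩ ⟨x, hx⟩
      refine LinearMap.ext fun c => ?_
      obtain ⟨c, rfl⟩ := cls_surjective _ _ c
      refine cls_eq_zero.2 ?_
      obtain ⟨y, hy⟩ := hl x c c.2
      refine ⟨y, ?_⟩
      rw [hy, hx]
      rfl)

@[simp] theorem map₂_cls (φ : W →ₗ[k] W' →ₗ[k] W'')
    (hZ : ∀ z z', g z = 0 → g' z' = 0 → g'' (φ z z') = 0)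
    (hl : ∀ x z', g' z' = 0 → ∃ y, f'' y = φ (f x) z')
    (hr : ∀ z x', g z = 0 → ∃ y, f'' y = φ z (f' x'))
    (z : LinearMap.ker g) (z' : LinearMap.ker g') :
    map₂ φ hZ hl hr (cls f g z) (cls f' g' z') = cls f'' g'' ⟨φ z z', hZ z z' z.2 z'.2⟩ := rfl

end Homol

end Homology

/-! ## Complexes of bimodules, resolutions, Hochschild and Tate-Hochschild groups -/

section Complexes

open CategoryTheory

variable (k : Type u) (A : Type v) [Field k] [Ring A] [Algebra k A]

/-- A `ℤ`-graded chain complex of finitely generated projective `A`-bimodules with an augmentation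
`ε : X₀ → A`, which is a chain map to `A` concentrated in degree `0`. -/
structure AugComplex where
  /-- The complex. -/
  cx : ChainComplex (ModuleCat.{w} (Env k A)) ℤ
  finite : ∀ i, Module.Finite (Env k A) (cx.X i)
  projective : ∀ i, Module.Projective (Env k A) (cx.X i)
  /-- The augmentation. -/
  ε : cx.X 0 →ₗ[Env k A] A
  ε_d : ∀ x, ε ((cx.d 1 0).hom x) = 0

variable {k A}

/-- The complex is a projective resolution of `A` over `Aᵉ`: it lives in non-negative degrees and
`⋯ → X₁ → X₀ → A → 0` is exact. -/
structure AugComplex.IsProjectiveResolution (C : AugComplex.{u, v, w} k A) : Prop where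
  zero_of_neg : ∀ i < 0, Subsingleton (C.cx.X i)
  exact : ∀ i, 1 ≤ i → Function.Exact (C.cx.d (i + 1) i).hom (C.cx.d i (i - 1)).hom
  exact_zero : Function.Exact (C.cx.d 1 0).hom C.ε
  surjective : Function.Surjective C.ε

/-- The complex is a complete resolution of `A` over `Aᵉ`: it is exact, its `Aᵉ`-dual is exact, and
its non-negative part is, with the augmentation `ε`, a projective resolution of `A`. -/
structure AugComplex.IsCompleteResolution (C : AugComplex.{u, v, w} k A) : Prop where
  exact : ∀ i, Function.Exact (C.cx.d (i + 1) i).hom (C.cx.d i (i - 1)).hom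
  dual_exact : ∀ (i : ℤ) (f : C.cx.X i →ₗ[Env k A] Env k A),
    f ∘ₗ (C.cx.d (i + 1) i).hom = 0 →
      ∃ g : C.cx.X (i - 1) →ₗ[Env k A] Env k A, f = g ∘ₗ (C.cx.d i (i - 1)).hom
  exact_zero : Function.Exact (C.cx.d 1 0).hom C.ε
  surjective : Function.Surjective C.ε

/-- An augmentation-preserving chain map. -/
structure AugComplex.Hom (C : AugComplex.{u, v, w} k A) (C' : AugComplex.{u, v, w'} k A) where
  toFun : ∀ i, C.cx.X i →ₗ[Env k A] C'.cx.X i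
  comm : ∀ i j x, toFun j ((C.cx.d i j).hom x) = (C'.cx.d i j).hom (toFun i x)
  aug : ∀ x, C'.ε (toFun 0 x) = C.ε x

theorem d_d (C : AugComplex.{u, v, w} k A) (i j l : ℤ) (x : C.cx.X i) :
    (C.cx.d j l).hom ((C.cx.d i j).hom x) = 0 := by
  rw [← LinearMap.comp_apply, ← ModuleCat.hom_comp, C.cx.d_comp_d]
  rfl

section Groups

variable (C : AugComplex.{u, v, w} k A) (C' : AugComplex.{u, v, w'} k A)
variable (M : Type w₁) [AddCommGroup M] [Module k M] [Module (Env k A) M]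
  [IsScalarTower k (Env k A) M]
variable (N : Type w₂) [AddCommGroup N] [Module k N] [Module (Env k A) N]
  [IsScalarTower k (Env k A) N]

/-- Composition with the differential, `Hom_{Aᵉ}(X_i, M) → Hom_{Aᵉ}(X_j, M)`, `u ↦ u ∘ d`. (The
sign by which the differential of the Hom complex differs from this map depends on the degree only,
so it changes neither cocycles nor coboundaries.) -/
def cobd (i j : ℤ) : (C.cx.X i →ₗ[Env k A] M) →ₗ[k] (C.cx.X j →ₗ[Env k A] M) where
  toFun u := u ∘ₗ (C.cx.d j i).hom
  map_add' _ _ := rfl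
  map_smul' _ _ := rfl

/-- The differential `d ⊗ id` of `X ⊗_{Aᵉ} N`. -/
def bd (i j : ℤ) : EnvTensor k A (C.cx.X i) N →ₗ[k] EnvTensor k A (C.cx.X j) N :=
  EnvTensor.map (C.cx.d i j).hom LinearMap.id

/-- `Hⁿ(Hom_{Aᵉ}(X, M))`: the Hochschild cohomology `Hⁿ(A, M)` if `X` is a projective resolution of
`A`, and the Tate-Hochschild cohomology `Ĥⁿ(A, M)` if `X` is a complete resolution of `A`. -/
abbrev Cohomology (n : ℤ) := Homol (cobd C M (n - 1) n) (cobd C M n (n + 1))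

/-- `H_n(X ⊗_{Aᵉ} N)`: the Hochschild homology `H_n(A, N)` if `X` is a projective resolution of `A`,
and the Tate-Hochschild homology `Ĥ_n(A, N)` if `X` is a complete resolution of `A`. -/
abbrev Homology (n : ℤ) := Homol (bd C N (n + 1) n) (bd C N n (n - 1))

variable {C C' M N}

theorem bd_map (ϑ : C.Hom C') {N' : Type w₃} [AddCommGroup N'] [Module k N'] [Module (Env k A) N']
    [IsScalarTower k (Env k A) N'] (g : N →ₗ[Env k A] N') (i j : ℤ)
    (z : EnvTensor k A (C.cx.X i) N) :
    bd C' N' i j (EnvTensor.map (ϑ.toFun i) g z) =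
      EnvTensor.map (ϑ.toFun j) g (bd C N i j z) := by
  rw [← LinearMap.comp_apply, ← LinearMap.comp_apply]
  congr 1
  refine EnvTensor.ext fun x n => ?_
  simp only [LinearMap.comp_apply, bd, EnvTensor.map_tmul, LinearMap.id_apply, ϑ.comm]

variable (M) in
/-- The map `Hⁿ(Hom(X', M)) → Hⁿ(Hom(X, M))` induced by a chain map `ϑ : X → X'`. -/
def comparisonCohomology (ϑ : C.Hom C') (n : ℤ) : Cohomology C' M n →ₗ[k] Cohomology C M n :=
  Homol.map
    { toFun := fun u => u ∘ₗ ϑ.toFun n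
      map_add' := fun _ _ => rfl
      map_smul' := fun _ _ => rfl }
    (fun u hu => LinearMap.ext fun x => by
      have := LinearMap.congr_fun hu (ϑ.toFun (n + 1) x)
      simpa [cobd, ϑ.comm] using this)
    (fun u => ⟨u ∘ₗ ϑ.toFun (n - 1), LinearMap.ext fun x => by simp [cobd, ϑ.comm]⟩)

variable (N) in
/-- The map `H_n(X ⊗ N) → H_n(X' ⊗ N)` induced by a chain map `ϑ : X → X'`. -/
def comparisonHomology (ϑ : C.Hom C') (n : ℤ) : Homology C N n →ₗ[k] Homology C' N n :=
  Homol.map (EnvTensor.map (ϑ.toFun n) LinearMap.id)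
    (fun z hz => by rw [bd_map, hz, map_zero])
    (fun z => ⟨EnvTensor.map (ϑ.toFun (n + 1)) LinearMap.id z, bd_map _ _ _ _ _⟩)

variable (C) in
/-- The identity chain map. -/
def AugComplex.Hom.id : C.Hom C := ⟨fun _ => LinearMap.id, fun _ _ _ => rfl, fun _ => rfl⟩

variable (C) in
/-- The map `H_n(X ⊗ N) → H_n(X ⊗ N')` induced by a bimodule homomorphism `N → N'`. -/
def homologyMap {N' : Type w₃} [AddCommGroup N'] [Module k N'] [Module (Env k A) N']
    [IsScalarTower k (Env k A) N'] (g : N →ₗ[Env k A] N') (n : ℤ) :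
    Homology C N n →ₗ[k] Homology C N' n :=
  Homol.map (EnvTensor.map LinearMap.id g)
    (fun z hz => by
      rw [show (LinearMap.id : C.cx.X n →ₗ[Env k A] C.cx.X n) =
        (AugComplex.Hom.id C).toFun n from rfl, bd_map, hz, map_zero])
    (fun z => ⟨EnvTensor.map LinearMap.id g z, bd_map (AugComplex.Hom.id C) g (n + 1) n z⟩)

end Groups

/-! ## Complete tensor products and diagonal approximations -/

/-- The component of degree `n` of the complete tensor product `X ⊗̂_A X`:
`∏_{p + q = n} X_p ⊗_A X_q`. If `X` vanishes in negative degrees, only finitely many factors are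
non-zero, and this is the component of degree `n` of the ordinary tensor product `X ⊗_A X`. -/
abbrev CTensor (C : AugComplex.{u, v, w} k A) (n : ℤ) :=
  ∀ pq : {pq : ℤ × ℤ // pq.1 + pq.2 = n}, BTensor k A (C.cx.X pq.1.1) (C.cx.X pq.1.2)

/-- The differential of the (complete) tensor product, `d(x ⊗ y) = dx ⊗ y + (-1)^{|x|} x ⊗ dy`;
its component in `X_p ⊗_A X_q` receives contributions from `X_{p+1} ⊗_A X_q` and
`X_p ⊗_A X_{q+1}`. -/
def CTensor.d (C : AugComplex.{u, v, w} k A) (n m : ℤ) (h : m + 1 = n) (x : CTensor C n) :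
    CTensor C m := fun pq =>
  BTensor.map (C.cx.d (pq.1.1 + 1) pq.1.1).hom LinearMap.id
      (x ⟨(pq.1.1 + 1, pq.1.2), by have := pq.2; dsimp only; omega⟩) +
    (pq.1.1.negOnePow : ℤ) • BTensor.map LinearMap.id (C.cx.d (pq.1.2 + 1) pq.1.2).hom
      (x ⟨(pq.1.1, pq.1.2 + 1), by have := pq.2; dsimp only; omega⟩)

/-- A diagonal approximation: a chain map `Δ : X → X ⊗̂_A X` with `(ε ⊗̂ ε) Δ = ε`. If `X` is a
projective resolution, this is a diagonal approximation `X → X ⊗_A X` in the ordinary sense. -/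
structure DiagonalApproximation (C : AugComplex.{u, v, w} k A) where
  toFun : ∀ n, C.cx.X n →ₗ[Env k A] CTensor C n
  comm : ∀ n m (h : m + 1 = n) x,
    CTensor.d C n m h (toFun n x) = toFun m ((C.cx.d n m).hom x)
  aug : ∀ x, BTensor.mulA k (BTensor.map C.ε C.ε (toFun 0 x ⟨(0, 0), add_zero 0⟩)) = C.ε x

end Complexes

/-! ## Cup and cap products -/

section Products

variable {k : Type u} {A : Type v} [Field k] [Ring A] [Algebra k A]

namespace EnvTensor

variable {X : Type w₁} {N : Type w₂} {Y : Type w₃} {M : Type w₄}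
  [AddCommGroup X] [Module k X] [Module (Env k A) X] [IsScalarTower k (Env k A) X]
  [AddCommGroup N] [Module k N] [Module (Env k A) N] [IsScalarTower k (Env k A) N]
  [AddCommGroup Y] [Module k Y] [Module (Env k A) Y] [IsScalarTower k (Env k A) Y]
  [AddCommGroup M] [Module k M] [Module (Env k A) M] [IsScalarTower k (Env k A) M]

theorem zero_tmul (n : N) : tmul k A (0 : X) n = 0 :=
  LinearMap.map_zero₂ mk n

theorem add_tmul (x x' : X) (n : N) : tmul k A (x + x') n = tmul k A x n + tmul k A x' n :=
  LinearMap.map_add₂ mk x x' n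

theorem tmul_add (x : X) (n n' : N) : tmul k A x (n + n') = tmul k A x n + tmul k A x n' :=
  LinearMap.map_add (mk x) n n'

theorem tmul_smul (c : k) (x : X) (n : N) : tmul k A x (c • n) = c • tmul k A x n :=
  LinearMap.map_smul (mk x) c n

theorem contract_add (u u' : Y →ₗ[Env k A] M) (t : BTensor k A X Y) (n : N) :
    contract (u + u') (tmul k A t n) = contract u (tmul k A t n) + contract u' (tmul k A t n) := by
  induction t using BTensor.induction with
  | h0 => rw [zero_tmul, LinearMap.map_zero, LinearMap.map_zero, LinearMap.map_zero, add_zero]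
  | ha x y hx hy =>
    rw [add_tmul, LinearMap.map_add, LinearMap.map_add, LinearMap.map_add, hx, hy]
    abel
  | ht x y =>
    rw [contract_tmul, contract_tmul, contract_tmul, LinearMap.add_apply, BTensor.add_tmul,
      tmul_add]

theorem contract_smul (c : k) (u : Y →ₗ[Env k A] M) (t : BTensor k A X Y) (n : N) :
    contract (c • u) (tmul k A t n) = c • contract u (tmul k A t n) := by
  induction t using BTensor.induction with
  | h0 => rw [zero_tmul, LinearMap.map_zero, LinearMap.map_zero, smul_zero]
  | ha x y hx hy => rw [add_tmul, LinearMap.map_add, LinearMap.map_add, hx, hy, smul_add]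
  | ht x y =>
    rw [contract_tmul, contract_tmul, LinearMap.smul_apply, BTensor.smul_tmul, tmul_smul]

/-- The map `u ↦ ((x ⊗ y) ⊗ n ↦ x ⊗ (u(y) ⊗ n))`. -/
def contractLin : (Y →ₗ[Env k A] M) →ₗ[k] EnvTensor k A (BTensor k A X Y) N →ₗ[k]
    EnvTensor k A X (BTensor k A M N) where
  toFun := contract
  map_add' u u' := ext (contract_add u u')
  map_smul' c u := ext (contract_smul c u)

theorem contractLin_apply (u : Y →ₗ[Env k A] M) (z : EnvTensor k A (BTensor k A X Y) N) :
    contractLin u z = contract u z := rfl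

theorem map_id_contract {X' : Type w} [AddCommGroup X'] [Module k X'] [Module (Env k A) X']
    [IsScalarTower k (Env k A) X'] (f : X →ₗ[Env k A] X') (u : Y →ₗ[Env k A] M)
    (z : EnvTensor k A (BTensor k A X Y) N) :
    map f LinearMap.id (contractLin u z) =
      contractLin u (map (BTensor.map f LinearMap.id) LinearMap.id z) := by
  have : map f LinearMap.id ∘ₗ contractLin u = contractLin u ∘ₗ
      map (N := N) (BTensor.map f (LinearMap.id (M := Y))) LinearMap.id := by
    refine ext fun t n => ?_
    induction t using BTensor.induction with
    | h0 => rw [zero_tmul, LinearMap.map_zero, LinearMap.map_zero]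
    | ha x y hx hy => rw [add_tmul, LinearMap.map_add, LinearMap.map_add, hx, hy]
    | ht x y => rfl
  exact LinearMap.congr_fun this z

theorem contractLin_comp {Y' : Type w} [AddCommGroup Y'] [Module k Y'] [Module (Env k A) Y']
    [IsScalarTower k (Env k A) Y'] (f : Y' →ₗ[Env k A] Y) (u : Y →ₗ[Env k A] M)
    (z : EnvTensor k A (BTensor k A X Y') N) :
    contractLin (u ∘ₗ f) z =
      contractLin u (map (BTensor.map LinearMap.id f) LinearMap.id z) := by
  have : contractLin (u ∘ₗ f) = contractLin u ∘ₗ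
      map (N := N) (BTensor.map (LinearMap.id (M := X)) f) LinearMap.id := by
    refine ext fun t n => ?_
    induction t using BTensor.induction with
    | h0 => rw [zero_tmul, LinearMap.map_zero, LinearMap.map_zero]
    | ha x y hx hy => rw [add_tmul, LinearMap.map_add, LinearMap.map_add, hx, hy]
    | ht x y => rfl
  exact LinearMap.congr_fun this z

end EnvTensor

namespace BTensor

variable {M : Type w₁} {N : Type w₂} {M' : Type w₃} {N' : Type w₄}
  [AddCommGroup M] [Module k M] [Module (Env k A) M] [IsScalarTower k (Env k A) M]
  [AddCommGroup N] [Module k N] [Module (Env k A) N] [IsScalarTower k (Env k A) N]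
  [AddCommGroup M'] [Module k M'] [Module (Env k A) M'] [IsScalarTower k (Env k A) M']
  [AddCommGroup N'] [Module k N'] [Module (Env k A) N'] [IsScalarTower k (Env k A) N']

theorem env_ext {Q : Type w} [AddCommGroup Q] [Module (Env k A) Q]
    {f g : BTensor k A M N →ₗ[Env k A] Q}
    (h : ∀ m n, f (tmul k A m n) = g (tmul k A m n)) : f = g := by
  refine LinearMap.ext fun t => ?_
  induction t using induction with
  | h0 => rw [map_zero, map_zero]
  | ht m n => exact h m n
  | ha x y hx hy => rw [map_add, map_add, hx, hy]

/-- `(u, v) ↦ u ⊗_A v` as a bilinear map. -/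
def mapBilin : (M →ₗ[Env k A] M') →ₗ[k] (N →ₗ[Env k A] N') →ₗ[k]
    (BTensor k A M N →ₗ[Env k A] BTensor k A M' N') :=
  LinearMap.mk₂ k map
    (fun _ _ _ => env_ext fun _ _ => add_tmul _ _ _)
    (fun _ _ _ => env_ext fun _ _ => smul_tmul _ _ _)
    (fun _ _ _ => env_ext fun _ _ => tmul_add _ _ _)
    (fun _ _ _ => env_ext fun _ _ => tmul_smul _ _ _)

theorem mapBilin_apply (f : M →ₗ[Env k A] M') (g : N →ₗ[Env k A] N') (t : BTensor k A M N) :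
    mapBilin f g t = map f g t := rfl

theorem map_zero_left (g : N →ₗ[Env k A] N') (t : BTensor k A M N) :
    map (0 : M →ₗ[Env k A] M') g t = 0 := by
  rw [← mapBilin_apply, map_zero]; rfl

theorem map_zero_right (f : M →ₗ[Env k A] M') (t : BTensor k A M N) :
    map f (0 : N →ₗ[Env k A] N') t = 0 := by
  rw [← mapBilin_apply, map_zero]; rfl

theorem map_map {M'' : Type*} {N'' : Type*}
    [AddCommGroup M''] [Module k M''] [Module (Env k A) M''] [IsScalarTower k (Env k A) M'']
    [AddCommGroup N''] [Module k N''] [Module (Env k A) N''] [IsScalarTower k (Env k A) N'']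
    (f' : M' →ₗ[Env k A] M'') (g' : N' →ₗ[Env k A] N'')
    (f : M →ₗ[Env k A] M') (g : N →ₗ[Env k A] N') (t : BTensor k A M N) :
    map f' g' (map f g t) = map (f' ∘ₗ f) (g' ∘ₗ g) t := by
  induction t using induction with
  | h0 => rw [map_zero, map_zero, map_zero]
  | ht m n => rfl
  | ha x y hx hy => rw [map_add, map_add, map_add, hx, hy]

end BTensor

namespace DiagonalApproximation

variable {C : AugComplex.{u, v, w} k A} (Δ : DiagonalApproximation C)
variable {M : Type w₁} [AddCommGroup M] [Module k M] [Module (Env k A) M]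
  [IsScalarTower k (Env k A) M]
variable {N : Type w₂} [AddCommGroup N] [Module k N] [Module (Env k A) N]
  [IsScalarTower k (Env k A) N]

/-- The component `X_n → X_p ⊗_A X_q` of `Δ`. -/
def comp (n p q : ℤ) (h : p + q = n) :
    C.cx.X n →ₗ[Env k A] BTensor k A (C.cx.X p) (C.cx.X q) :=
  LinearMap.proj (R := Env k A)
    (φ := fun pq : {pq : ℤ × ℤ // pq.1 + pq.2 = n} =>
      BTensor k A (C.cx.X pq.1.1) (C.cx.X pq.1.2)) ⟨(p, q), h⟩ ∘ₗ Δ.toFun n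

theorem comp_comm (n m p q p' q' : ℤ) (hm : m + 1 = n) (h : p + q = m) (hp : p + 1 = p')
    (hq : q + 1 = q') (x : C.cx.X n) :
    BTensor.map (C.cx.d p' p).hom LinearMap.id (Δ.comp n p' q (by omega) x) +
        (p.negOnePow : ℤ) •
          BTensor.map LinearMap.id (C.cx.d q' q).hom (Δ.comp n p q' (by omega) x) =
      Δ.comp m p q h ((C.cx.d n m).hom x) := by
  subst hp hq
  exact congrFun (Δ.comm n m hm x) ⟨(p, q), h⟩

/-- The cup product on cochains, `u ⌣ v = (u ⊗̂ v) Δ`, where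
`(u ⊗̂ v)(x ⊗ y) = (-1)^{|v||x|} u(x) ⊗ v(y)`. -/
def cupChain (r s n : ℤ) (h : r + s = n) :
    (C.cx.X r →ₗ[Env k A] M) →ₗ[k] (C.cx.X s →ₗ[Env k A] N) →ₗ[k]
      (C.cx.X n →ₗ[Env k A] BTensor k A M N) :=
  LinearMap.mk₂ k
    (fun u v => ((s * r).negOnePow : ℤ) • (BTensor.mapBilin u v ∘ₗ Δ.comp n r s h))
    (fun u u' v => by rw [LinearMap.map_add₂, LinearMap.add_comp, smul_add])
    (fun c u v => by rw [LinearMap.map_smul₂, LinearMap.smul_comp, smul_comm])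
    (fun u v v' => by rw [map_add, LinearMap.add_comp, smul_add])
    (fun c u v => by rw [map_smul, LinearMap.smul_comp, smul_comm])

theorem cupChain_apply (r s n : ℤ) (h : r + s = n) (u : C.cx.X r →ₗ[Env k A] M)
    (v : C.cx.X s →ₗ[Env k A] N) (x : C.cx.X n) :
    Δ.cupChain r s n h u v x =
      ((s * r).negOnePow : ℤ) • BTensor.map u v (Δ.comp n r s h x) := rfl

theorem map_comp_d (n m p q p' q' : ℤ) (hm : m + 1 = n) (h : p + q = m) (hp : p + 1 = p')
    (hq : q + 1 = q') (u : C.cx.X p →ₗ[Env k A] M) (v : C.cx.X q →ₗ[Env k A] N)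
    (x : C.cx.X n) :
    BTensor.map u v (Δ.comp m p q h ((C.cx.d n m).hom x)) =
      BTensor.map (cobd C M p p' u) v (Δ.comp n p' q (by omega) x) +
        (p.negOnePow : ℤ) • BTensor.map u (cobd C N q q' v) (Δ.comp n p q' (by omega) x) := by
  rw [← Δ.comp_comm n m p q p' q' hm h hp hq, map_add, map_zsmul, BTensor.map_map,
    BTensor.map_map]
  rfl

theorem negOnePow_smul_smul {V : Type*} [AddCommGroup V] (p : ℤ) (x : V) :
    (p.negOnePow : ℤ) • (p.negOnePow : ℤ) • x = x := by
  rw [smul_smul, ← Units.val_mul, Int.units_mul_self, Units.val_one, one_smul]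

/-- The cup product `Hʳ(X, M) ⊗ Hˢ(X, N) → Hʳ⁺ˢ(X, M ⊗_A N)`. -/
def cup (r s n : ℤ) (h : r + s = n) :
    Cohomology C M r →ₗ[k] Cohomology C N s →ₗ[k] Cohomology C (BTensor k A M N) n :=
  Homol.map₂ (Δ.cupChain r s n h)
    (fun u v hu hv => LinearMap.ext fun x => by
      change Δ.cupChain r s n h u v ((C.cx.d (n + 1) n).hom x) = 0
      rw [cupChain_apply, Δ.map_comp_d (n + 1) n r s (r + 1) (s + 1) rfl h rfl rfl, hu, hv,
        BTensor.map_zero_left, BTensor.map_zero_right, smul_zero, add_zero, smul_zero])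
    (fun u v hv => ⟨((s * r).negOnePow : ℤ) •
        (BTensor.mapBilin u v ∘ₗ Δ.comp (n - 1) (r - 1) s (by omega)),
      LinearMap.ext fun x => by
        change ((s * r).negOnePow : ℤ) • BTensor.map u v
          (Δ.comp (n - 1) (r - 1) s _ ((C.cx.d n (n - 1)).hom x)) = _
        rw [cupChain_apply, Δ.map_comp_d n (n - 1) (r - 1) s r (s + 1) (by omega) (by omega)
          (by omega) rfl, hv, BTensor.map_zero_right, smul_zero, add_zero]⟩)
    (fun u v hu => ⟨((s * r).negOnePow : ℤ) • (r.negOnePow : ℤ) •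
        (BTensor.mapBilin u v ∘ₗ Δ.comp (n - 1) r (s - 1) (by omega)),
      LinearMap.ext fun x => by
        change ((s * r).negOnePow : ℤ) • (r.negOnePow : ℤ) • BTensor.map u v
          (Δ.comp (n - 1) r (s - 1) _ ((C.cx.d n (n - 1)).hom x)) = _
        rw [cupChain_apply, Δ.map_comp_d n (n - 1) r (s - 1) (r + 1) s (by omega) (by omega)
          rfl (by omega), hu, BTensor.map_zero_left, zero_add, negOnePow_smul_smul]⟩)

/-- The cap product on chains: the composite of `z = x ⊗ n ↦ Δ(x) ⊗ n` and
`(x' ⊗ x'') ⊗ n ↦ (-1)^{|u||x'|} x' ⊗ (u(x'') ⊗ n)`. -/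
def capChain (r s p : ℤ) (h : p + r = s) :
    (C.cx.X r →ₗ[Env k A] M) →ₗ[k] EnvTensor k A (C.cx.X s) N →ₗ[k]
      EnvTensor k A (C.cx.X p) (BTensor k A M N) :=
  ((r * p).negOnePow : ℤ) •
    EnvTensor.contractLin.compl₂ (EnvTensor.map (Δ.comp s p r h) LinearMap.id)

theorem capChain_apply (r s p : ℤ) (h : p + r = s) (u : C.cx.X r →ₗ[Env k A] M)
    (z : EnvTensor k A (C.cx.X s) N) :
    Δ.capChain r s p h u z = ((r * p).negOnePow : ℤ) •
      EnvTensor.contractLin u (EnvTensor.map (Δ.comp s p r h) LinearMap.id z) := rfl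

theorem bd_contractLin (n m p q p' q' : ℤ) (hm : m + 1 = n) (h : p + q = m) (hp : p + 1 = p')
    (hq : q + 1 = q') (u : C.cx.X q →ₗ[Env k A] M) (z : EnvTensor k A (C.cx.X n) N) :
    bd C (BTensor k A M N) p' p
          (EnvTensor.contractLin u (EnvTensor.map (Δ.comp n p' q (by omega)) LinearMap.id z)) +
        (p.negOnePow : ℤ) • EnvTensor.contractLin (cobd C M q q' u)
          (EnvTensor.map (Δ.comp n p q' (by omega)) LinearMap.id z) =
      EnvTensor.contractLin u (EnvTensor.map (Δ.comp m p q h) LinearMap.id (bd C N n m z)) := by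
  have e2 := EnvTensor.contractLin_comp (C.cx.d q' q).hom u
    (EnvTensor.map (Δ.comp n p q' (by omega)) LinearMap.id z)
  rw [show cobd C M q q' u = u ∘ₗ (C.cx.d q' q).hom from rfl, e2, bd, EnvTensor.map_id_contract,
    ← map_zsmul, ← map_add]
  congr 1
  have key : EnvTensor.map (BTensor.map (C.cx.d p' p).hom LinearMap.id) LinearMap.id ∘ₗ
          EnvTensor.map (Δ.comp n p' q (by omega)) LinearMap.id +
        (p.negOnePow : ℤ) • (EnvTensor.map (BTensor.map LinearMap.id (C.cx.d q' q).hom)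
          LinearMap.id ∘ₗ EnvTensor.map (Δ.comp n p q' (by omega)) LinearMap.id) =
      EnvTensor.map (Δ.comp m p q h) LinearMap.id ∘ₗ bd C N n m := by
    refine EnvTensor.ext fun x y => ?_
    have e3 := congrArg (fun t : BTensor k A (C.cx.X p) (C.cx.X q) => EnvTensor.mk (k := k) (A := A) t y) (Δ.comp_comm n m p q p' q' hm h hp hq x)
    simp only [map_add, map_zsmul, LinearMap.add_apply, LinearMap.smul_apply] at e3
    exact e3
  exact LinearMap.congr_fun key z

theorem bd_capChain (r s p : ℤ) (h : p + r = s) (u : C.cx.X r →ₗ[Env k A] M)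
    (z : EnvTensor k A (C.cx.X s) N) (hu : cobd C M r (r + 1) u = 0) (hz : bd C N s (s - 1) z = 0) :
    bd C (BTensor k A M N) p (p - 1) (Δ.capChain r s p h u z) = 0 := by
  have := Δ.bd_contractLin s (s - 1) (p - 1) r p (r + 1) (by omega) (by omega) (by omega)
    rfl u z
  rw [hu, hz, map_zero, map_zero, map_zero, LinearMap.zero_apply, smul_zero, add_zero] at this
  rw [capChain_apply, map_zsmul, this, smul_zero]

theorem capChain_cobd (r s p : ℤ) (h : p + r = s) (u : C.cx.X (r - 1) →ₗ[Env k A] M)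
    (z : EnvTensor k A (C.cx.X s) N) (hz : bd C N s (s - 1) z = 0) :
    ∃ y, bd C (BTensor k A M N) (p + 1) p y =
      Δ.capChain r s p h (cobd C M (r - 1) r u) z := by
  have := Δ.bd_contractLin s (s - 1) p (r - 1) (p + 1) r (by omega) (by omega) rfl
    (by omega) u z
  rw [hz, map_zero, map_zero] at this
  refine ⟨((r * p).negOnePow : ℤ) • (p.negOnePow : ℤ) • -(EnvTensor.contractLin u
    (EnvTensor.map (Δ.comp s (p + 1) (r - 1) (by omega)) LinearMap.id z)), ?_⟩
  rw [map_zsmul, map_zsmul, map_neg, eq_neg_of_add_eq_zero_left this, neg_neg,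
    negOnePow_smul_smul, capChain_apply]

theorem capChain_bd (r s p : ℤ) (h : p + r = s) (u : C.cx.X r →ₗ[Env k A] M)
    (z : EnvTensor k A (C.cx.X (s + 1)) N) (hu : cobd C M r (r + 1) u = 0) :
    ∃ y, bd C (BTensor k A M N) (p + 1) p y = Δ.capChain r s p h u (bd C N (s + 1) s z) := by
  have := Δ.bd_contractLin (s + 1) s p r (p + 1) (r + 1) rfl h rfl rfl u z
  rw [hu, map_zero, LinearMap.zero_apply, smul_zero, add_zero] at this
  refine ⟨((r * p).negOnePow : ℤ) • EnvTensor.contractLin u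
    (EnvTensor.map (Δ.comp (s + 1) (p + 1) r (by omega)) LinearMap.id z), ?_⟩
  rw [map_zsmul, this, capChain_apply]

/-- The cap product `Hʳ(X, M) ⊗ H_s(X, N) → H_{s-r}(X, M ⊗_A N)`. -/
def cap (r s p : ℤ) (h : p + r = s) :
    Cohomology C M r →ₗ[k] Homology C N s →ₗ[k] Homology C (BTensor k A M N) p :=
  Homol.map₂ (Δ.capChain r s p h)
    (fun u z hu hz => Δ.bd_capChain r s p h u z hu hz)
    (fun u z hz => Δ.capChain_cobd r s p h u z hz)
    (fun u z hu => Δ.capChain_bd r s p h u z hu)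

end DiagonalApproximation

end Products

/-! ## Frobenius algebras and the fundamental class -/

section Frobenius

variable {k : Type u} {A : Type v} [Field k] [Ring A] [Algebra k A] [FiniteDimensional k A]

/-- The element `t₂(c)(y) = ∑ᵢ y uᵢ ν(c) ⊗ vᵢᵒ` of `Aᵉ`, where `(uᵢ)` is a basis of `A` and `(vᵢ)`
is the dual basis, `⟨vᵢ, uⱼ⟩ = δᵢⱼ` (the sum does not depend on the basis). For a Frobenius algebra,
`c ↦ t₂(c)` is the isomorphism `₁A_{ν⁻¹} → Hom_{Aᵉ}(A, Aᵉ)` of bimodules. -/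
def dualIso (B : LinearMap.BilinForm k A) (hB : B.Nondegenerate) (ν : A ≃ₐ[k] A) (c y : A) :
    Env k A :=
  ∑ i, (y * Module.finBasis k A i * ν c) ⊗ₜ[k]
    op (B.dualBasis hB (Module.finBasis k A) i)

/-- `ω ∈ Ĥ_{-1}(A, ₁A_{ν⁻¹})` is the fundamental class: the element that corresponds to
`1 ∈ Ĥ⁰(A, A)` under the duality `Ĥ⁰(A, A) ≅ Ĥ_{-1}(A, ₁A_{ν⁻¹})`.

Explicitly, let `η : A → T_{-1}` be the inclusion with `d₀ = η ε`. Since `T_{-1}` is finitely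
generated projective, an element `w` of `T_{-1} ⊗_{Aᵉ} ₁A_{ν⁻¹}` is the same thing as the bimodule
map `f ↦ (f ⊗ id)(w)`, `Hom_{Aᵉ}(T_{-1}, Aᵉ) → ₁A_{ν⁻¹}`, and `f ↦ t₂⁻¹(f η)` is the augmentation
`Hom_{Aᵉ}(T_{-1}, Aᵉ) → Hom_{Aᵉ}(A, Aᵉ) ≅ ₁A_{ν⁻¹}` of the projective resolution dual to the negative
part of `T`. The class `ω` is represented by the cycle `w` with `(f ⊗ id)(w) = t₂⁻¹(f η)` for all
`f`. -/
def IsFundamentalClass (B : LinearMap.BilinForm k A) (hB : B.Nondegenerate) (ν : A ≃ₐ[k] A)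
    (T : AugComplex.{u, v, w} k A) (ω : Homology T (RightTwist ν.symm A) (-1)) : Prop :=
  ∃ w : LinearMap.ker (bd T (RightTwist ν.symm A) (-1) (-1 - 1)),
    Homol.cls _ _ w = ω ∧
    ∀ (f : T.cx.X (-1) →ₗ[Env k A] Env k A) (x : T.cx.X 0),
      f ((T.cx.d 0 (-1)).hom x) =
        dualIso B hB ν ((toTwist ν.symm A).symm (EnvTensor.eval f w)) (T.ε x)

variable {T : AugComplex.{u, v, w} k A} (Δ : DiagonalApproximation T) {ν : A ≃ₐ[k] A}
  (ω : Homology T (RightTwist ν.symm A) (-1))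

/-- The map `- ⌢ ω : Ĥⁿ(A, M) → Ĥ_{-n-1}(A, ₁M_{ν⁻¹})`, where `M ⊗_A ₁A_{ν⁻¹}` is identified with
`₁M_{ν⁻¹}`. -/
def capClass (M : Type w₁) [AddCommGroup M] [Module k M] [Module (Env k A) M]
    [IsScalarTower k (Env k A) M] (n p : ℤ) (h : p + n = -1) :
    Cohomology T M n →ₗ[k] Homology T (RightTwist ν.symm M) p :=
  homologyMap T (twistUnit ν.symm M) p ∘ₗ (Δ.cap n (-1) p h).flip ω

end Frobenius

variable {k : Type u} {A : Type v} [Field k] [Ring A] [Algebra k A] in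
/-- The cap product `Hʳ(X, M) ⊗ H_s(X, ₁N_β) → H_{s-r}(X, ₁(M ⊗_A N)_β)`, where `M ⊗_A ₁N_β` is
identified with `₁(M ⊗_A N)_β`. -/
def twistedCap {C : AugComplex.{u, v, w} k A} (Δ : DiagonalApproximation C) (β : A ≃ₐ[k] A)
    (M : Type w₁) [AddCommGroup M] [Module k M] [Module (Env k A) M] [IsScalarTower k (Env k A) M]
    (N : Type w₂) [AddCommGroup N] [Module k N] [Module (Env k A) N] [IsScalarTower k (Env k A) N]
    (r s p : ℤ) (h : p + r = s) :
    Cohomology C M r →ₗ[k] Homology C (RightTwist β N) s →ₗ[k]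
      Homology C (RightTwist β (BTensor k A M N)) p :=
  (Δ.cap r s p h).compr₂ (homologyMap C (twistAssoc β M N) p)

end TateHochschild

end

/-! Let the upper row send `u ⊗ z` to the Tate cap product of `ϑ^* u` with `z`. The theorem then
rests on four facts.

(a) On non-negative degrees `T` and `P` are both projective resolutions of `A`, so `ϑ` has a
homotopy inverse there (`AugComplex.Hom.exists_homotopy_inverse`). Hence `ϑ_*` is injective in
degrees `≥ 0`, and `ϑ^*` is surjective in degrees `≥ 0` and injective in degrees `≥ 1`. In degree
`0` the coboundaries coming from `T_{-1}` may spoil injectivity.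

(b) `ϑ_*(ϑ^* u ⌢ z) = u ⌢ ϑ_* z`, so the upper row is the restriction of the ordinary cap product
(`capCompatible`).

(c) `u ⌢ (y ⌢ ω) = (u ⌣ y) ⌢ ω` for `u` of degree `r ≥ 0` (`capAssociative`). Once `- ⌢ ω` is
invertible, this is the commutativity of the square.

(d) `- ⌢ ω` is bijective on cohomology of degree `≤ 0` (`dualityAt`).

Both (b) and (c) are proved by induction on `r`, shifting the dimension in the coefficients `M`
along `0 → M → Hom_k(A, M) → Cok → 0`. The coinduced bimodule is acyclic in positive degrees,
because a resolution of `A` splits as a complex of right modules. The sequence itself splits on the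
right, so it stays exact under `- ⊗_A N`. For `r = 0` a cocycle is `μ ε` with `μ : A → M`, and
multiplying by it amounts to applying `(1 ⊗ ε)Δ` or `(ε ⊗ 1)Δ` and tensoring with `μ(1)`. These
chain maps preserve the augmentation and are therefore homotopic to the identity in the degrees
concerned. Coassociativity of the diagonal is never needed.

For (d) the induction goes down from `n = 0` along `0 → K → Q → M → 0` with `Q` free. Both `Hom(T,
Q)` and `T ⊗ ₁Q_{ν⁻¹}` are exact, so the statement for `M` follows from that for `K` one degree
higher. Degree `0` is explicit: `c ↦ dualIso c` identifies `₁A_{ν⁻¹}` with `Hom(A, Aᵉ)`, every `f`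
on `T_{-1}` thereby has a value `c_f`, and the cycle `w` is the element with `(f ⊗ id)(w) = c_f`.
Since `T_{-1}` is finitely generated projective, such a `w` exists and is unique. -/

set_option linter.unusedSectionVars false

noncomputable section

namespace TateHochschild

/-! ### Tensor products over `Aᵉ`: evaluation maps and exactness. -/

section EnvTensorTools

variable {k : Type u} {A : Type v} [Field k] [Ring A] [Algebra k A]
variable {X : Type w₁} {N : Type w₂} {X' : Type w₃} {N' : Type w₄}
  [AddCommGroup X] [Module k X] [Module (Env k A) X] [IsScalarTower k (Env k A) X]
  [AddCommGroup N] [Module k N] [Module (Env k A) N] [IsScalarTower k (Env k A) N]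
  [AddCommGroup X'] [Module k X'] [Module (Env k A) X'] [IsScalarTower k (Env k A) X']
  [AddCommGroup N'] [Module k N'] [Module (Env k A) N'] [IsScalarTower k (Env k A) N']

theorem flip_flip (e : Env k A) : flip k A (flip k A e) = e := by
  induction e using env_induction with
  | ht a b => simp
  | ha x y hx hy => rw [map_add, map_add, hx, hy]

/-- A map into a projective module whose values lie in the image of `f` lifts along `f`. -/
theorem exists_lift_of_range {R : Type*} [Ring R] {P : Type*} {Y : Type*} {Z : Type*}
    [AddCommGroup P] [Module R P] [AddCommGroup Y] [Module R Y] [AddCommGroup Z] [Module R Z]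
    [Module.Projective R P] (f : Y →ₗ[R] Z) (g : P →ₗ[R] Z) (h : ∀ x, ∃ y, f y = g x) :
    ∃ l : P →ₗ[R] Y, ∀ x, f (l x) = g x := by
  obtain ⟨l, hl⟩ := Module.projective_lifting_property f.rangeRestrict
    (g.codRestrict (LinearMap.range f) fun x => h x) f.surjective_rangeRestrict
  exact ⟨l, fun x => congrArg Subtype.val (LinearMap.congr_fun hl x)⟩

theorem exists_dual_basis {R : Type*} [Ring R] (P : Type*) [AddCommGroup P] [Module R P]
    [Module.Finite R P] [Module.Projective R P] :
    ∃ (n : ℕ) (x : Fin n → P) (f : Fin n → P →ₗ[R] R), ∀ p, ∑ i, f i p • x i = p := by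
  obtain ⟨n, f, g, -, -, h⟩ := Module.Finite.exists_comp_eq_id_of_projective R P
  refine ⟨n, fun i => f (Pi.single i 1), fun i => LinearMap.proj i ∘ₗ g, fun p => ?_⟩
  conv_rhs => rw [← LinearMap.id_apply (R := R) p, ← h, LinearMap.comp_apply,
    ← Finset.univ_sum_single (g p), map_sum]
  refine Finset.sum_congr rfl fun i _ => ?_
  rw [← map_smul, LinearMap.comp_apply, LinearMap.proj_apply, ← Pi.single_smul, smul_eq_mul,
    mul_one]

namespace EnvTensor

@[elab_as_elim]
theorem induction {p : EnvTensor k A X N → Prop} (h0 : p 0) (ht : ∀ x n, p (tmul k A x n))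
    (ha : ∀ y z, p y → p z → p (y + z)) (z : EnvTensor k A X N) : p z := by
  obtain ⟨t, rfl⟩ : ∃ t, proj k A X N t = z := Submodule.mkQ_surjective _ z
  induction t using TensorProduct.induction_on with
  | zero => rw [map_zero]; exact h0
  | tmul x n => exact ht x n
  | add x y hx hy => rw [map_add]; exact ha _ _ hx hy

theorem map_comp_apply {X'' : Type*} {N'' : Type*}
    [AddCommGroup X''] [Module k X''] [Module (Env k A) X''] [IsScalarTower k (Env k A) X'']
    [AddCommGroup N''] [Module k N''] [Module (Env k A) N''] [IsScalarTower k (Env k A) N'']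
    (f' : X' →ₗ[Env k A] X'') (g' : N' →ₗ[Env k A] N'')
    (f : X →ₗ[Env k A] X') (g : N →ₗ[Env k A] N') (z : EnvTensor k A X N) :
    map f' g' (map f g z) = map (f' ∘ₗ f) (g' ∘ₗ g) z := by
  induction z using induction with
  | h0 => rw [map_zero, map_zero, map_zero]
  | ht x n => rfl
  | ha x y hx hy => rw [map_add, map_add, map_add, hx, hy]

theorem map_id_id (z : EnvTensor k A X N) :
    map (LinearMap.id : X →ₗ[Env k A] X) (LinearMap.id : N →ₗ[Env k A] N) z = z := by
  induction z using induction with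
  | h0 => rw [map_zero]
  | ht x n => rfl
  | ha x y hx hy => rw [map_add, hx, hy]

theorem map_add_left (f f' : X →ₗ[Env k A] X') (g : N →ₗ[Env k A] N') (z : EnvTensor k A X N) :
    map (f + f') g z = map f g z + map f' g z := by
  induction z using induction with
  | h0 => rw [map_zero, map_zero, map_zero, add_zero]
  | ht x n => rw [map_tmul, map_tmul, map_tmul, LinearMap.add_apply, add_tmul]
  | ha x y hx hy => rw [map_add, map_add, map_add, hx, hy]; abel

theorem map_sub_left (f f' : X →ₗ[Env k A] X') (g : N →ₗ[Env k A] N') (z : EnvTensor k A X N) :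
    map (f - f') g z = map f g z - map f' g z := by
  rw [eq_sub_iff_add_eq, ← map_add_left, sub_add_cancel]

theorem eval_map (f : X' →ₗ[Env k A] Env k A) (g : X →ₗ[Env k A] X') (φ : N →ₗ[Env k A] N')
    (z : EnvTensor k A X N) : eval f (map g φ z) = φ (eval (f ∘ₗ g) z) := by
  induction z using induction with
  | h0 => rw [map_zero, map_zero, map_zero, map_zero]
  | ht x n => rw [map_tmul, eval_tmul, eval_tmul, map_smul, LinearMap.comp_apply]
  | ha x y hx hy => rw [map_add, map_add, map_add, map_add, hx, hy]

theorem eval_add (f g : X →ₗ[Env k A] Env k A) (z : EnvTensor k A X N) :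
    eval (f + g) z = eval f z + eval g z := by
  induction z using induction with
  | h0 => rw [map_zero, map_zero, map_zero, add_zero]
  | ht x n => rw [eval_tmul, eval_tmul, eval_tmul, LinearMap.add_apply, map_add, add_smul]
  | ha x y hx hy => rw [map_add, map_add, map_add, hx, hy]; abel

theorem eval_sub (f g : X →ₗ[Env k A] Env k A) (z : EnvTensor k A X N) :
    eval (f - g) z = eval f z - eval g z := by
  rw [eq_sub_iff_add_eq, ← eval_add, sub_add_cancel]

/-- Right multiplication by `e` on `Aᵉ`, a homomorphism of left modules. -/
def rmul (e : Env k A) : Env k A →ₗ[Env k A] Env k A := LinearMap.toSpanSingleton _ _ e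

theorem rmul_apply (e x : Env k A) : rmul e x = x * e := rfl

theorem eval_rmul (e : Env k A) (f : X →ₗ[Env k A] Env k A) (z : EnvTensor k A X N) :
    eval (rmul e ∘ₗ f) z = flip k A e • eval f z := by
  induction z using induction with
  | h0 => rw [map_zero, map_zero, smul_zero]
  | ht x n => rw [eval_tmul, eval_tmul, LinearMap.comp_apply, rmul_apply, flip_mul, mul_smul]
  | ha x y hx hy => rw [map_add, map_add, hx, hy, smul_add]

/-- In the dual basis expansion of the first factor, the coefficients can be moved across the tensor
sign, where they become evaluations. So `z` is determined by finitely many elements of `N`. -/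
theorem sum_tmul_eval {n : ℕ} {x : Fin n → X} {f : Fin n → X →ₗ[Env k A] Env k A}
    (h : ∀ p, ∑ i, f i p • x i = p) (z : EnvTensor k A X N) :
    ∑ i, tmul k A (x i) (eval (f i) z) = z := by
  induction z using induction with
  | h0 =>
    refine Finset.sum_eq_zero fun i _ => ?_
    rw [map_zero, ← mk_apply, map_zero]
  | ha y z hy hz =>
    conv_rhs => rw [← hy, ← hz, ← Finset.sum_add_distrib]
    exact Finset.sum_congr rfl fun i _ => by rw [map_add, tmul_add]
  | ht y m =>
    conv_rhs => rw [← h y, ← mk_apply, map_sum, LinearMap.sum_apply]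
    refine Finset.sum_congr rfl fun i _ => ?_
    rw [eval_tmul, ← balanced, flip_flip, mk_apply]

section Projective

variable [Module.Finite (Env k A) X] [Module.Projective (Env k A) X]

/-- For a finitely generated projective `X`, the evaluation maps separate the elements of
`X ⊗_{Aᵉ} N`. -/
theorem ext_eval {z z' : EnvTensor k A X N}
    (h : ∀ f : X →ₗ[Env k A] Env k A, eval f z = eval f z') : z = z' := by
  obtain ⟨n, x, f, hx⟩ := exists_dual_basis (R := Env k A) X
  rw [← sum_tmul_eval hx z, ← sum_tmul_eval hx z']
  exact Finset.sum_congr rfl fun i _ => by rw [h]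

theorem map_id_injective (i : N →ₗ[Env k A] N') (hi : Function.Injective i)
    {z z' : EnvTensor k A X N}
    (h : map (LinearMap.id : X →ₗ[Env k A] X) i z = map LinearMap.id i z') : z = z' := by
  refine ext_eval fun f => hi ?_
  have := congrArg (eval f) h
  rwa [eval_map, eval_map] at this

/-- A finitely generated projective `X` is flat, made explicit: preimages are chosen for the
finitely many coordinates `eval (f j) z`. -/
theorem map_id_exact {N'' : Type*} [AddCommGroup N''] [Module k N''] [Module (Env k A) N'']
    [IsScalarTower k (Env k A) N''] (i : N →ₗ[Env k A] N') (p : N' →ₗ[Env k A] N'')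
    (hip : ∀ y, p y = 0 → ∃ x, i x = y) (z : EnvTensor k A X N')
    (h : map (LinearMap.id : X →ₗ[Env k A] X) p z = 0) :
    ∃ y, map (LinearMap.id : X →ₗ[Env k A] X) i y = z := by
  obtain ⟨n, x, f, hx⟩ := exists_dual_basis (R := Env k A) X
  have h1 : ∀ j, ∃ m, i m = eval (f j) z := fun j => hip _ (by
    have := congrArg (eval (f j)) h
    rwa [eval_map, map_zero] at this)
  choose m hm using h1
  refine ⟨∑ j, tmul k A (x j) (m j), ?_⟩
  rw [map_sum]
  conv_rhs => rw [← sum_tmul_eval hx z]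
  exact Finset.sum_congr rfl fun j _ => by rw [map_tmul, hm, LinearMap.id_apply]

end Projective

theorem map_id_surjective (p : N →ₗ[Env k A] N') (hp : Function.Surjective p)
    (z : EnvTensor k A X N') : ∃ y, map (LinearMap.id : X →ₗ[Env k A] X) p y = z := by
  induction z using induction with
  | h0 => exact ⟨0, map_zero _⟩
  | ht x n =>
    obtain ⟨m, rfl⟩ := hp n
    exact ⟨tmul k A x m, rfl⟩
  | ha y z hy hz =>
    obtain ⟨a, rfl⟩ := hy
    obtain ⟨b, rfl⟩ := hz
    exact ⟨a + b, map_add _ _ _⟩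

/-- The coordinate map `X ⊗_{Aᵉ} N → (ι →₀ X)` belonging to `s : N → (ι →₀ Aᵉ)`. -/
def coord {ι : Type*} (s : N →ₗ[Env k A] (ι →₀ Env k A)) : EnvTensor k A X N →ₗ[k] (ι →₀ X) :=
  lift (LinearMap.mk₂ k
      (fun x n => (s n).mapRange (fun e => flip k A e • x) (by rw [map_zero, zero_smul]))
      (fun x x' n => Finsupp.ext fun i => smul_add _ _ _)
      (fun c x n => Finsupp.ext fun i => smul_comm _ _ _)
      (fun x n n' => Finsupp.ext fun i => by simp [add_smul])
      (fun c x n => Finsupp.ext fun i => by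
        rw [Finsupp.mapRange_apply, Finsupp.smul_apply, Finsupp.mapRange_apply,
          ← algebraMap_smul (Env k A) c n, map_smul, Finsupp.smul_apply, algebraMap_smul,
          map_smul, smul_assoc]))
    (fun e x n => Finsupp.ext fun i => by
      simp [flip_mul, mul_smul])

theorem coord_tmul {ι : Type*} (s : N →ₗ[Env k A] (ι →₀ Env k A)) (x : X) (n : N) (i : ι) :
    coord s (tmul k A x n) i = flip k A (s n i) • x := rfl

theorem coord_map {ι : Type*} (s : N →ₗ[Env k A] (ι →₀ Env k A)) (f : X →ₗ[Env k A] X')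
    (z : EnvTensor k A X N) (i : ι) :
    coord s (map f LinearMap.id z) i = f (coord s z i) := by
  induction z using induction with
  | h0 => simp
  | ht x n => rw [map_tmul, coord_tmul, coord_tmul, map_smul, LinearMap.id_apply]
  | ha y z hy hz => rw [map_add, map_add, map_add, Finsupp.add_apply, Finsupp.add_apply, hy, hz,
      map_add]

theorem sum_coord {ι : Type*} (s : N →ₗ[Env k A] (ι →₀ Env k A)) (b : ι → N)
    (h : ∀ n, Finsupp.linearCombination (Env k A) b (s n) = n) (z : EnvTensor k A X N) :
    (coord s z).sum (fun i x => tmul k A x (b i)) = z := by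
  induction z using induction with
  | h0 => simp
  | ht x n =>
    conv_rhs => rw [← h n, Finsupp.linearCombination_apply, Finsupp.sum, ← mk_apply, map_sum]
    rw [Finsupp.sum_of_support_subset (s := (s n).support) (coord s (tmul k A x n))
      (Finsupp.support_mapRange (hf := by rw [map_zero, zero_smul]))
      (fun i x => tmul k A x (b i)) (fun i _ => zero_tmul _)]
    refine Finset.sum_congr rfl fun i _ => ?_
    rw [coord_tmul, balanced, mk_apply]
  | ha y z hy hz =>
    rw [map_add, Finsupp.sum_add_index' (h := fun i x => tmul k A x (b i))
      (fun i => zero_tmul _) (fun i x x' => add_tmul _ _ _), hy, hz]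

/-- Tensoring with a projective module preserves exactness. -/
theorem exact_of_projective [Module.Projective (Env k A) N] {X'' : Type*} [AddCommGroup X'']
    [Module k X''] [Module (Env k A) X''] [IsScalarTower k (Env k A) X'']
    (f : X →ₗ[Env k A] X') (g : X' →ₗ[Env k A] X'') (h : ∀ y, g y = 0 → ∃ x, f x = y)
    (z : EnvTensor k A X' N) (hz : map g (LinearMap.id : N →ₗ[Env k A] N) z = 0) :
    ∃ y, map f (LinearMap.id : N →ₗ[Env k A] N) y = z := by
  -- `s` splits the free cover of `N`, so `z` is the sum of its coordinates in `X'`. Each of them is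
  -- killed by `g` and can be lifted along `f` separately.
  obtain ⟨s, hs⟩ := Module.projective_def.1 ‹Module.Projective (Env k A) N›
  have h1 : ∀ i, ∃ x, f x = coord s z i := fun i => h _ (by
    rw [← coord_map, hz, map_zero, Finsupp.zero_apply])
  choose x hx using h1
  refine ⟨∑ i ∈ (coord s z).support, tmul k A (x i) i, ?_⟩
  rw [map_sum]
  conv_rhs => rw [← sum_coord s (fun n => n) hs z, Finsupp.sum]
  exact Finset.sum_congr rfl fun i _ => by rw [map_tmul, hx, LinearMap.id_apply]

end EnvTensor

end EnvTensorTools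

end TateHochschild

end

noncomputable section

namespace TateHochschild

/-! ### The bimodule `Hom_{Aᵉ}(A, Aᵉ)` of a Frobenius algebra. -/

section Frobenius

variable {k : Type u} {A : Type v} [Field k] [Ring A] [Algebra k A]

theorem lop_mul_lop (a b : A) : lop k a * lop k b = lop k (a * b) := by
  rw [lop, lop, lop, Algebra.TensorProduct.tmul_mul_tmul, one_mul]

theorem rop_mul_rop (a b : A) : rop k a * rop k b = rop k (b * a) := by
  rw [rop, rop, rop, Algebra.TensorProduct.tmul_mul_tmul, one_mul, op_mul]

theorem lop_one : lop k (1 : A) = 1 := rfl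

theorem flip_lop (a : A) : flip k A (lop k a) = rop k a := rfl

theorem flip_rop (a : A) : flip k A (rop k a) = lop k a := rfl

theorem twistEnv_lop (β : A ≃ₐ[k] A) (a : A) : twistEnv β (lop k a) = lop k a := by
  simp [twistEnv, lop]

theorem twistEnv_rop (β : A ≃ₐ[k] A) (a : A) : twistEnv β (rop k a) = rop k (β a) := by
  simp [twistEnv, rop]

theorem hom_regular_apply {M : Type w} [AddCommGroup M] [Module (Env k A) M]
    (g : A →ₗ[Env k A] M) (y : A) : g y = lop k y • g 1 := by
  rw [← map_smul, lop_regular, mul_one]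

theorem hom_regular_central {M : Type w} [AddCommGroup M] [Module (Env k A) M]
    (g : A →ₗ[Env k A] M) (a : A) : lop k a • g 1 = rop k a • g 1 := by
  rw [← map_smul, ← map_smul, lop_regular, rop_regular, mul_one, one_mul]

/-- The bimodule map `A → M`, `y ↦ y m`, for a central element `m` of the bimodule `M`. -/
def ofCentral {M : Type w} [AddCommGroup M] [Module k M] [Module (Env k A) M]
    [IsScalarTower k (Env k A) M] (m : M) (hm : ∀ a : A, lop k a • m = rop k a • m) :
    A →ₗ[Env k A] M :=
  BTensor.ofBimod
    { toFun := fun y => lop k y • m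
      map_add' := fun x y => by rw [lop, TensorProduct.add_tmul, add_smul]; rfl
      map_smul' := fun c y => by
        rw [lop, ← TensorProduct.smul_tmul', smul_assoc]; rfl }
    (fun a y => by
      change lop k (lop k a • y) • m = lop k a • lop k y • m
      rw [lop_regular, ← lop_mul_lop, mul_smul])
    (fun a y => by
      change lop k (rop k a • y) • m = rop k a • lop k y • m
      rw [rop_regular, ← lop_mul_lop, mul_smul, hm, ← lop_rop_comm])

theorem ofCentral_apply {M : Type w} [AddCommGroup M] [Module k M] [Module (Env k A) M]
    [IsScalarTower k (Env k A) M] (m : M) (hm : ∀ a : A, lop k a • m = rop k a • m) (y : A) :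
    ofCentral m hm y = lop k y • m := rfl

variable (B : LinearMap.BilinForm k A)

/-- The map `Aᵉ → A`, `x ⊗ yᵒ ↦ ⟨y, 1⟩ x`. -/
def frobTrace : Env k A →ₗ[k] A :=
  TensorProduct.lift (LinearMap.mk₂ k (fun (x : A) (y : Aᵐᵒᵖ) => B (unop y) 1 • x)
    (fun x x' y => smul_add _ _ _)
    (fun c x y => smul_comm _ _ _)
    (fun x y y' => by rw [unop_add, map_add, LinearMap.add_apply, add_smul])
    (fun c x y => by rw [unop_smul, map_smul, LinearMap.smul_apply, smul_assoc]))

theorem frobTrace_tmul (x : A) (y : Aᵐᵒᵖ) : frobTrace B (x ⊗ₜ[k] y) = B (unop y) 1 • x := rfl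

theorem frobTrace_lop_mul (a : A) (t : Env k A) :
    frobTrace B (lop k a * t) = a * frobTrace B t := by
  induction t using env_induction with
  | ht x y =>
    rw [lop, Algebra.TensorProduct.tmul_mul_tmul, frobTrace_tmul, frobTrace_tmul, one_mul,
      mul_smul_comm]
  | ha x y hx hy => rw [mul_add, map_add, map_add, hx, hy, mul_add]

variable [FiniteDimensional k A] (hB : B.Nondegenerate)

theorem sum_dualBasis_smul (a : A) :
    ∑ i, B (B.dualBasis hB (Module.finBasis k A) i) a • Module.finBasis k A i = a := by
  conv_rhs => rw [← (Module.finBasis k A).sum_repr a]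
  refine Finset.sum_congr rfl fun i _ => ?_
  congr 1
  conv_lhs => rw [← (Module.finBasis k A).sum_repr a, map_sum]
  simp [LinearMap.BilinForm.apply_dualBasis_left]

theorem sum_smul_dualBasis (a : A) :
    ∑ i, B a (Module.finBasis k A i) • B.dualBasis hB (Module.finBasis k A) i = a := by
  conv_rhs => rw [← (B.dualBasis hB (Module.finBasis k A)).sum_repr a]
  simp [LinearMap.BilinForm.dualBasis_repr_apply]

/-- For `t = x ⊗ yᵒ` the `j`-th trace is `⟨y, uⱼ⟩ x`, and `∑ ⟨y, uⱼ⟩ vⱼ = y`. -/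
theorem sum_frobTrace (hassoc : ∀ a b c, B (a * b) c = B a (b * c)) (t : Env k A) :
    ∑ j, frobTrace B (rop k (Module.finBasis k A j) * t) ⊗ₜ[k]
      op (B.dualBasis hB (Module.finBasis k A) j) = t := by
  induction t using env_induction with
  | ha x y hx hy =>
    conv_rhs => rw [← hx, ← hy, ← Finset.sum_add_distrib]
    exact Finset.sum_congr rfl fun j _ => by rw [mul_add, map_add, TensorProduct.add_tmul]
  | ht x y =>
    conv_rhs => rw [← op_unop y, ← sum_smul_dualBasis B hB (unop y), Finset.op_sum,
      TensorProduct.tmul_sum]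
    refine Finset.sum_congr rfl fun j _ => ?_
    rw [rop, Algebra.TensorProduct.tmul_mul_tmul, frobTrace_tmul, unop_mul, unop_op, hassoc,
      mul_one, one_mul, op_smul, TensorProduct.smul_tmul]

/-- For central `t` the factors `rop uⱼ` in `sum_frobTrace` may be replaced by `lop uⱼ`, which come
out of the trace. Identities between central elements of `Aᵉ` thus become identities in `A`. -/
theorem eq_of_central (hB : B.Nondegenerate) (hassoc : ∀ a b c, B (a * b) c = B a (b * c)) {t t' : Env k A}
    (ht : ∀ a : A, lop k a * t = rop k a * t) (ht' : ∀ a : A, lop k a * t' = rop k a * t')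
    (h : frobTrace B t = frobTrace B t') : t = t' := by
  rw [← sum_frobTrace B hB hassoc t, ← sum_frobTrace B hB hassoc t']
  refine Finset.sum_congr rfl fun j _ => ?_
  rw [← ht, ← ht', frobTrace_lop_mul, frobTrace_lop_mul, h]

variable (ν : A ≃ₐ[k] A)

theorem dualIso_eq (c y : A) : dualIso B hB ν c y = lop k y * dualIso B hB ν c 1 := by
  rw [dualIso, dualIso, Finset.mul_sum]
  refine Finset.sum_congr rfl fun i _ => ?_
  rw [lop, Algebra.TensorProduct.tmul_mul_tmul, one_mul, one_mul, mul_assoc]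

theorem frobTrace_dualIso (c y : A) : frobTrace B (dualIso B hB ν c y) = y * ν c := by
  rw [dualIso, map_sum]
  conv_rhs => rw [← one_mul (ν c), ← sum_dualBasis_smul B hB 1, Finset.sum_mul, Finset.mul_sum]
  refine Finset.sum_congr rfl fun i _ => ?_
  rw [frobTrace_tmul, unop_op, smul_mul_assoc, mul_smul_comm, mul_assoc]

/-- Expanded by `sum_frobTrace`, the right side has the coefficient `a uⱼ ν(c)` at `vⱼ`, which is
how the left side is defined. -/
theorem dualIso_central (hassoc : ∀ a b c, B (a * b) c = B a (b * c)) (c a : A) :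
    lop k a * dualIso B hB ν c 1 = rop k a * dualIso B hB ν c 1 := by
  rw [← sum_frobTrace B hB hassoc (rop k a * dualIso B hB ν c 1), ← dualIso_eq, dualIso]
  refine Finset.sum_congr rfl fun j _ => ?_
  congr 1
  rw [← mul_assoc, rop_mul_rop, dualIso, Finset.mul_sum, map_sum]
  conv_lhs => rw [← sum_dualBasis_smul B hB (a * Module.finBasis k A j), Finset.sum_mul]
  refine Finset.sum_congr rfl fun i _ => ?_
  rw [rop, Algebra.TensorProduct.tmul_mul_tmul, frobTrace_tmul, unop_mul, unop_op, unop_op,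
    hassoc, mul_one, one_mul, one_mul, smul_mul_assoc]

theorem dualIso_injective {c c' : A} (h : dualIso B hB ν c 1 = dualIso B hB ν c' 1) : c = c' := by
  have := congrArg (frobTrace B) h
  rw [frobTrace_dualIso, frobTrace_dualIso, one_mul, one_mul] at this
  exact ν.injective this

/-- Every central element of `Aᵉ` comes from `A`. -/
theorem dualIso_symm_frobTrace (hassoc : ∀ a b c, B (a * b) c = B a (b * c)) {t : Env k A}
    (ht : ∀ a : A, lop k a * t = rop k a * t) :
    dualIso B hB ν (ν.symm (frobTrace B t)) 1 = t := by
  refine eq_of_central B hB hassoc (dualIso_central B hB ν hassoc _) ht ?_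
  rw [frobTrace_dualIso, one_mul, AlgEquiv.apply_symm_apply]

/-- This is where the Nakayama automorphism enters. Both sides are central, so traces suffice. The
trace of the left side contains `⟨y, vᵢ⟩ = ⟨vᵢ, ν(y)⟩`, and summation turns `y` into `ν(y)`. Hence
`c ↦ dualIso c` is a bimodule map on `₁A_{ν⁻¹}` rather than on `A`. -/
theorem dualIso_mul (hassoc : ∀ a b c, B (a * b) c = B a (b * c))
    (hν : ∀ a b, B a b = B b (ν a)) (c x y : A) :
    dualIso B hB ν c 1 * (lop k x * rop k y) = dualIso B hB ν (y * c * ν.symm x) 1 := by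
  refine eq_of_central B hB hassoc (fun a => ?_) (dualIso_central B hB ν hassoc _) ?_
  · rw [← mul_assoc, ← mul_assoc (rop k a), dualIso_central B hB ν hassoc]
  · rw [frobTrace_dualIso, one_mul, map_mul ν, map_mul ν, AlgEquiv.apply_symm_apply, dualIso,
      Finset.sum_mul, map_sum]
    conv_rhs => rw [← sum_dualBasis_smul B hB (ν y), Finset.sum_mul, Finset.sum_mul]
    refine Finset.sum_congr rfl fun i _ => ?_
    rw [lop, rop, Algebra.TensorProduct.tmul_mul_tmul, Algebra.TensorProduct.tmul_mul_tmul,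
      frobTrace_tmul, one_mul, one_mul, mul_one, unop_mul, unop_op, unop_op, hassoc, mul_one,
      hν y, smul_mul_assoc, smul_mul_assoc]

/-- The bimodule map `y ↦ dualIso c y`. -/
def dualHom (hassoc : ∀ a b c, B (a * b) c = B a (b * c)) (c : A) : A →ₗ[Env k A] Env k A :=
  ofCentral (dualIso B hB ν c 1) (dualIso_central B hB ν hassoc c)

theorem dualHom_apply (hassoc : ∀ a b c, B (a * b) c = B a (b * c)) (c y : A) :
    dualHom B hB ν hassoc c y = dualIso B hB ν c y := (dualIso_eq B hB ν c y).symm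

theorem exists_eq_dualIso (hassoc : ∀ a b c, B (a * b) c = B a (b * c))
    (g : A →ₗ[Env k A] Env k A) : ∃ c, ∀ y, g y = dualIso B hB ν c y := by
  refine ⟨ν.symm (frobTrace B (g 1)), fun y => ?_⟩
  rw [dualIso_eq, dualIso_symm_frobTrace B hB ν hassoc (hom_regular_central g), hom_regular_apply]
  rfl

/-- The image of `dualIso 1 1` under the flip and the twist. -/
def twistedCasimir : Env k A := twistEnv ν.symm (flip k A (dualIso B hB ν 1 1))

/-- By `dualIso_mul`, right multiplication of `dualIso 1` by `rop a` and by `lop (ν a)` both give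
`dualIso a`. The flip turns right into left multiplication, and the twist removes `ν`. -/
theorem twistedCasimir_central (hassoc : ∀ a b c, B (a * b) c = B a (b * c))
    (hν : ∀ a b, B a b = B b (ν a)) (a : A) :
    lop k a * twistedCasimir B hB ν = rop k a * twistedCasimir B hB ν := by
  have h1 := dualIso_mul B hB ν hassoc hν 1 1 a
  have h2 := dualIso_mul B hB ν hassoc hν 1 (ν a) 1
  rw [lop_one, one_mul, mul_one, map_one, mul_one] at h1
  rw [show rop k (1 : A) = 1 from rfl, mul_one, one_mul, one_mul, AlgEquiv.symm_apply_apply,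
    ← h1] at h2
  have h3 := congrArg (fun t => twistEnv ν.symm (flip k A t)) h2
  simp only [flip_mul, flip_lop, flip_rop, map_mul, twistEnv_lop, twistEnv_rop,
    AlgEquiv.symm_apply_apply] at h3
  exact h3.symm

theorem twistEnv_flip_dualIso (y : A) :
    twistEnv ν.symm (flip k A (dualIso B hB ν 1 y)) =
      twistedCasimir B hB ν * rop k (ν.symm y) := by
  rw [dualIso_eq, flip_mul, map_mul, flip_lop, twistEnv_rop, twistedCasimir]

end Frobenius

/-! ### Functoriality of the twist. -/

section TwistMaps

variable {k : Type u} {A : Type v} [Field k] [Ring A] [Algebra k A] (β : A ≃ₐ[k] A)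
variable {M : Type w₁} {M' : Type w₂} {N : Type w₃} {N' : Type w₄}
  [AddCommGroup M] [Module k M] [Module (Env k A) M] [IsScalarTower k (Env k A) M]
  [AddCommGroup N] [Module k N] [Module (Env k A) N] [IsScalarTower k (Env k A) N]
  [AddCommGroup M'] [Module k M'] [Module (Env k A) M'] [IsScalarTower k (Env k A) M']
  [AddCommGroup N'] [Module k N'] [Module (Env k A) N'] [IsScalarTower k (Env k A) N']

/-- The bimodule map `₁M_β → ₁M'_β` given by `f : M → M'`. -/
def twistMap (f : M →ₗ[Env k A] M') : RightTwist β M →ₗ[Env k A] RightTwist β M' where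
  toFun m := toTwist β M' (f ((toTwist β M).symm m))
  map_add' m n := by rw [map_add, map_add, map_add]
  map_smul' e m := by
    obtain ⟨m, rfl⟩ := (toTwist β M).surjective m
    rw [toTwist_smul, LinearEquiv.symm_apply_apply, LinearEquiv.symm_apply_apply, map_smul f]
    rfl

@[simp] theorem twistMap_toTwist (f : M →ₗ[Env k A] M') (m : M) :
    twistMap β f (toTwist β M m) = toTwist β M' (f m) := rfl

theorem twistMap_injective {f : M →ₗ[Env k A] M'} (hf : Function.Injective f) :
    Function.Injective (twistMap β f) := hf

theorem twistMap_surjective {f : M →ₗ[Env k A] M'} (hf : Function.Surjective f) :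
    Function.Surjective (twistMap β f) := hf

theorem twistMap_exact {M'' : Type*} [AddCommGroup M''] [Module k M''] [Module (Env k A) M'']
    [IsScalarTower k (Env k A) M''] {f : M →ₗ[Env k A] M'} {g : M' →ₗ[Env k A] M''}
    (h : ∀ y, g y = 0 → ∃ x, f x = y) :
    ∀ y, twistMap β g y = 0 → ∃ x, twistMap β f x = y := h

theorem twistUnit_comp (f : M →ₗ[Env k A] M') :
    twistUnit β M' ∘ₗ BTensor.map f LinearMap.id = twistMap β f ∘ₗ twistUnit β M := by
  refine BTensor.env_ext fun m a => ?_
  obtain ⟨a, rfl⟩ := (toTwist β A).surjective a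
  rw [LinearMap.comp_apply, LinearMap.comp_apply, BTensor.map_tmul, LinearMap.id_apply,
    twistUnit_tmul, twistUnit_tmul, twistMap_toTwist, map_smul f]

theorem twistAssoc_comp (f : M →ₗ[Env k A] M') :
    twistAssoc β M' N ∘ₗ BTensor.map f LinearMap.id =
      twistMap β (BTensor.map f LinearMap.id) ∘ₗ twistAssoc β M N := by
  refine BTensor.env_ext fun m a => ?_
  obtain ⟨a, rfl⟩ := (toTwist β N).surjective a
  rfl

theorem twistEnv_symm_twistEnv (e : Env k A) : twistEnv β.symm (twistEnv β e) = e := by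
  induction e using env_induction with
  | ht a b => simp [twistEnv]
  | ha x y hx hy => rw [map_add, map_add, hx, hy]

theorem twistEnv_twistEnv_symm (e : Env k A) : twistEnv β (twistEnv β.symm e) = e := by
  simpa using twistEnv_symm_twistEnv β.symm e

/-- The twist is restriction of scalars along the automorphism `twistEnv β`. A splitting of the free
cover of `M` becomes one for the twist after applying the inverse automorphism to the coordinates.
-/
theorem projective_twist [Module.Projective (Env k A) M] :
    Module.Projective (Env k A) (RightTwist β M) := by
  obtain ⟨s, hs⟩ := ‹Module.Projective (Env k A) M›
  let i : RightTwist β M →ₗ[Env k A] (M →₀ Env k A) :=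
    { toFun := fun m => (s ((toTwist β M).symm m)).mapRange (twistEnv β.symm) (map_zero _)
      map_add' := fun m n => by
        rw [map_add, map_add]
        exact Finsupp.mapRange_add (map_add _) _ _
      map_smul' := fun e m => by
        obtain ⟨m, rfl⟩ := (toTwist β M).surjective m
        refine Finsupp.ext fun i => ?_
        rw [toTwist_smul, LinearEquiv.symm_apply_apply, LinearEquiv.symm_apply_apply, map_smul s,
          Finsupp.mapRange_apply, Finsupp.smul_apply, smul_eq_mul, map_mul, twistEnv_symm_twistEnv]
        rfl }
  refine Module.Projective.of_split i
    (Finsupp.linearCombination (Env k A) (fun m => toTwist β M m)) (LinearMap.ext fun m => ?_)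
  obtain ⟨m, rfl⟩ := (toTwist β M).surjective m
  conv_rhs => rw [LinearMap.id_apply, ← hs m]
  rw [LinearMap.comp_apply, Finsupp.linearCombination_apply, Finsupp.linearCombination_apply,
    show i (toTwist β M m) = (s m).mapRange (twistEnv β.symm) (map_zero _) from rfl,
    Finsupp.sum_mapRange_index (h := fun m e => e • toTwist β M m) (fun i => zero_smul _ _),
    Finsupp.sum, Finsupp.sum, map_sum]
  refine Finset.sum_congr rfl fun i _ => ?_
  rw [toTwist_smul, twistEnv_twistEnv_symm]
  rfl

end TwistMaps

end TateHochschild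

end

noncomputable section

namespace TateHochschild

open CategoryTheory

/-! ### Homotopies on resolutions and complete resolutions. -/

section Complexes

variable {k : Type u} {A : Type v} [Field k] [Ring A] [Algebra k A]

instance (C : AugComplex.{u, v, w} k A) (i : ℤ) : Module.Finite (Env k A) (C.cx.X i) := C.finite i

instance (C : AugComplex.{u, v, w} k A) (i : ℤ) : Module.Projective (Env k A) (C.cx.X i) :=
  C.projective i

/-- The non-negative part of the complex is, with the augmentation, a resolution of `A`. -/
structure AugComplex.IsResolution (C : AugComplex.{u, v, w} k A) : Prop where
  exact : ∀ i, 1 ≤ i → Function.Exact (C.cx.d (i + 1) i).hom (C.cx.d i (i - 1)).hom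
  exact_zero : Function.Exact (C.cx.d 1 0).hom C.ε
  surjective : Function.Surjective C.ε

theorem AugComplex.IsProjectiveResolution.isResolution {C : AugComplex.{u, v, w} k A}
    (h : C.IsProjectiveResolution) : C.IsResolution := ⟨h.exact, h.exact_zero, h.surjective⟩

theorem AugComplex.IsCompleteResolution.isResolution {C : AugComplex.{u, v, w} k A}
    (h : C.IsCompleteResolution) : C.IsResolution :=
  ⟨fun i _ => h.exact i, h.exact_zero, h.surjective⟩

variable {C : AugComplex.{u, v, w} k A}

theorem AugComplex.IsResolution.exists_d (h : C.IsResolution) {i j l : ℤ} (hi : j + 1 = i)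
    (hl : l + 1 = j) (hj : 1 ≤ j) (x : C.cx.X j) (hx : (C.cx.d j l).hom x = 0) :
    ∃ y, (C.cx.d i j).hom y = x := by
  subst hi
  obtain rfl : l = j - 1 := by omega
  exact (h.exact j hj x).1 hx

theorem AugComplex.IsCompleteResolution.exists_d (h : C.IsCompleteResolution) {i j l : ℤ}
    (hi : j + 1 = i) (hl : l + 1 = j) (x : C.cx.X j) (hx : (C.cx.d j l).hom x = 0) :
    ∃ y, (C.cx.d i j).hom y = x := by
  subst hi
  obtain rfl : l = j - 1 := by omega
  exact (h.exact j x).1 hx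

/-- Dual exactness of a complete resolution with values in a projective module. -/
theorem AugComplex.IsCompleteResolution.exists_extension (h : C.IsCompleteResolution) {i j l : ℤ}
    (hi : j + 1 = i) (hl : l + 1 = j) {Q : Type w₁} [AddCommGroup Q] [Module (Env k A) Q]
    [Module.Projective (Env k A) Q] (f : C.cx.X j →ₗ[Env k A] Q)
    (hf : ∀ x, f ((C.cx.d i j).hom x) = 0) :
    ∃ g : C.cx.X l →ₗ[Env k A] Q, ∀ x, g ((C.cx.d j l).hom x) = f x := by
  classical
  subst hi
  obtain rfl : l = j - 1 := by omega
  obtain ⟨s, hs⟩ := ‹Module.Projective (Env k A) Q›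
  have h1 : ∀ q : Q, ∃ g : C.cx.X (j - 1) →ₗ[Env k A] Env k A,
      ∀ x, s (f x) q = g ((C.cx.d j (j - 1)).hom x) := fun q => by
    obtain ⟨g, hg⟩ := h.dual_exact j (Finsupp.lapply q ∘ₗ s ∘ₗ f) (LinearMap.ext fun x => by
      simp [hf])
    exact ⟨g, fun x => LinearMap.congr_fun hg x⟩
  choose g hg using h1
  -- `Q` need not be finitely generated. But `X_j` is, so only finitely many coordinates of `s ∘ f`
  -- are non-zero, and the extensions of the single coordinates can be summed.
  obtain ⟨t, ht⟩ := Module.Finite.fg_top (R := Env k A) (M := C.cx.X j)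
  have hsupp : ∀ x, ∀ q ∉ t.biUnion (fun x => (s (f x)).support), s (f x) q = 0 := by
    intro x q hq
    have : LinearMap.ker (Finsupp.lapply q ∘ₗ s ∘ₗ f) = ⊤ := by
      rw [eq_top_iff, ← ht, Submodule.span_le]
      intro y hy
      by_contra hne
      exact hq (Finset.mem_biUnion.2 ⟨y, hy, Finsupp.mem_support_iff.2 hne⟩)
    exact LinearMap.mem_ker.1 (this ▸ Submodule.mem_top : x ∈ _)
  refine ⟨∑ q ∈ t.biUnion (fun x => (s (f x)).support), LinearMap.toSpanSingleton _ _ q ∘ₗ g q,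
    fun x => ?_⟩
  conv_rhs => rw [← hs (f x), Finsupp.linearCombination_apply,
    Finsupp.sum_of_support_subset (s := t.biUnion (fun x => (s (f x)).support)) (s (f x))
      (fun q hq => by_contra fun hne => Finsupp.mem_support_iff.1 hq (hsupp x q hne))
      (fun q e => e • id q) (fun q _ => zero_smul _ _)]
  rw [LinearMap.sum_apply]
  exact Finset.sum_congr rfl fun q _ => by
    rw [LinearMap.comp_apply, LinearMap.toSpanSingleton_apply, ← hg, id]

/-- If `g` is null-homotopic in degree `m`, it is null-homotopic in degree `m + 1`. -/
theorem AugComplex.IsResolution.homotopy_succ (h : C.IsResolution) {l m n o : ℤ}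
    (hn : m + 1 = n) (ho : n + 1 = o) (h0 : 1 ≤ n) {g : C.cx.X m →ₗ[Env k A] C.cx.X m}
    {g' : C.cx.X n →ₗ[Env k A] C.cx.X n}
    (hg : ∀ x, (C.cx.d n m).hom (g' x) = g ((C.cx.d n m).hom x))
    {a : C.cx.X m →ₗ[Env k A] C.cx.X n} {b : C.cx.X l →ₗ[Env k A] C.cx.X m}
    (hab : ∀ x, g x = (C.cx.d n m).hom (a x) + b ((C.cx.d m l).hom x)) :
    ∃ c : C.cx.X n →ₗ[Env k A] C.cx.X o,
      ∀ x, g' x = (C.cx.d o n).hom (c x) + a ((C.cx.d n m).hom x) := by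
  obtain ⟨c, hc⟩ := exists_lift_of_range (C.cx.d o n).hom (g' - a ∘ₗ (C.cx.d n m).hom)
    (fun x => h.exists_d ho hn h0 _ (by
      rw [LinearMap.sub_apply, map_sub, hg, hab, d_d, map_zero, add_zero, LinearMap.comp_apply,
        sub_self]))
  refine ⟨c, fun x => ?_⟩
  rw [hc, LinearMap.sub_apply, LinearMap.comp_apply, sub_add_cancel]

theorem AugComplex.IsResolution.homotopy_zero (h : C.IsResolution)
    {g : C.cx.X 0 →ₗ[Env k A] C.cx.X 0} (hg : ∀ x, C.ε (g x) = 0) :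
    ∃ c : C.cx.X 0 →ₗ[Env k A] C.cx.X 1, ∀ x, g x = (C.cx.d 1 0).hom (c x) := by
  obtain ⟨c, hc⟩ := exists_lift_of_range (C.cx.d 1 0).hom g (fun x => (h.exact_zero _).1 (hg x))
  exact ⟨c, fun x => (hc x).symm⟩

/-- An endomorphism of a resolution that vanishes on `A` is null-homotopic in degrees `≥ 0`. -/
theorem AugComplex.IsResolution.homotopy (h : C.IsResolution)
    (g : ∀ i, C.cx.X i →ₗ[Env k A] C.cx.X i)
    (hg : ∀ i j x, j + 1 = i → (C.cx.d i j).hom (g i x) = g j ((C.cx.d i j).hom x))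
    (hg0 : ∀ x, C.ε (g 0 x) = 0) {n : ℤ} (hn : 0 ≤ n) :
    ∀ m l, n + 1 = m → l + 1 = n → ∃ (a : C.cx.X n →ₗ[Env k A] C.cx.X m)
      (b : C.cx.X l →ₗ[Env k A] C.cx.X n),
      ∀ x, g n x = (C.cx.d m n).hom (a x) + b ((C.cx.d n l).hom x) := by
  induction n, hn using Int.leInduction with
  | base =>
    rintro m l rfl hl
    obtain ⟨c, hc⟩ := h.homotopy_zero hg0
    -- The component `X_{-1} → X_0` of the homotopy is zero. This makes the argument independent of
    -- the negative part of the complex.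
    exact ⟨c, 0, fun x => by rw [hc, LinearMap.zero_apply, add_zero]; rfl⟩
  | succ n hn ih =>
    intro m l hm hl
    obtain rfl : l = n := by omega
    obtain ⟨a, b, hab⟩ := ih (l + 1) (l - 1) rfl (by omega)
    obtain ⟨c, hc⟩ := h.homotopy_succ rfl hm (by omega)
      (fun x => hg _ _ x rfl) hab
    exact ⟨c, a, hc⟩

/-- An endomorphism of a complete resolution that vanishes on `A` is null-homotopic in negative
degrees. -/
theorem AugComplex.IsCompleteResolution.homotopy (h : C.IsCompleteResolution)
    (g : ∀ i, C.cx.X i →ₗ[Env k A] C.cx.X i)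
    (hg : ∀ i j x, j + 1 = i → (C.cx.d i j).hom (g i x) = g j ((C.cx.d i j).hom x))
    (hg0 : ∀ x, C.ε (g 0 x) = 0) {n : ℤ} (hn : n ≤ -1) :
    ∀ m l, n + 1 = m → l + 1 = n → ∃ (a : C.cx.X n →ₗ[Env k A] C.cx.X m)
      (b : C.cx.X l →ₗ[Env k A] C.cx.X n),
      ∀ x, g n x = (C.cx.d m n).hom (a x) + b ((C.cx.d n l).hom x) := by
  induction n, hn using Int.leInductionDown with
  | base =>
    intro m l hm hl
    obtain rfl : m = 0 := by omega
    obtain ⟨c, hc⟩ := h.isResolution.homotopy_zero hg0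
    -- `g_{-1} d₀ = d₀ g₀ = d₀ d₁ c = 0`, so `g_{-1}` extends over the next differential. Below
    -- degree `0` the homotopy is built from dual exactness, with values in the projective modules
    -- of the complex.
    obtain ⟨b, hb⟩ := h.exists_extension (i := 0) (by omega) hl (g (-1)) (fun x => by
      rw [← hg _ _ _ (by omega), hc, d_d])
    exact ⟨0, b, fun x => by rw [hb, LinearMap.zero_apply, map_zero, zero_add]⟩
  | pred n hn ih =>
    intro m l hm hl
    obtain rfl : m = n := by omega
    obtain ⟨a, b, hab⟩ := ih (m + 1) (m - 1) rfl (by omega)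
    obtain ⟨c, hc⟩ := h.exists_extension (i := m) (by omega) hl
      (g (m - 1) - (C.cx.d m (m - 1)).hom ∘ₗ b) (fun x => by
      rw [LinearMap.sub_apply, ← hg _ _ _ (by omega), hab, map_add, d_d, zero_add,
        LinearMap.comp_apply, sub_self])
    exact ⟨b, c, fun x => by rw [hc, LinearMap.sub_apply, LinearMap.comp_apply, add_sub_cancel]⟩

/-! ### Consequences for homology and cohomology -/

section

variable {N : Type w₁} [AddCommGroup N] [Module k N] [Module (Env k A) N]
  [IsScalarTower k (Env k A) N]

theorem bd_tmul (i j : ℤ) (x : C.cx.X i) (n : N) :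
    bd C N i j (EnvTensor.tmul k A x n) = EnvTensor.tmul k A ((C.cx.d i j).hom x) n := rfl

theorem bd_bd (i j l : ℤ) (z : EnvTensor k A (C.cx.X i) N) :
    bd C N j l (bd C N i j z) = 0 := by
  induction z using EnvTensor.induction with
  | h0 => rw [map_zero, map_zero]
  | ht x n => rw [bd_tmul, bd_tmul, d_d, EnvTensor.zero_tmul]
  | ha x y hx hy => rw [map_add, map_add, hx, hy, add_zero]

theorem cobd_apply (i j : ℤ) (u : C.cx.X i →ₗ[Env k A] N) (x : C.cx.X j) :
    cobd C N i j u x = u ((C.cx.d j i).hom x) := rfl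

theorem bd_map_right {N' : Type w₂} [AddCommGroup N'] [Module k N'] [Module (Env k A) N']
    [IsScalarTower k (Env k A) N'] (f : N →ₗ[Env k A] N') (i j : ℤ)
    (z : EnvTensor k A (C.cx.X i) N) :
    bd C N' i j (EnvTensor.map LinearMap.id f z) = EnvTensor.map LinearMap.id f (bd C N i j z) :=
  bd_map (AugComplex.Hom.id C) f i j z

theorem exists_bd_of_homotopy {l m n : ℤ}
    {g : C.cx.X m →ₗ[Env k A] C.cx.X m}
    {a : C.cx.X m →ₗ[Env k A] C.cx.X n} {b : C.cx.X l →ₗ[Env k A] C.cx.X m}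
    (hab : ∀ x, g x = (C.cx.d n m).hom (a x) + b ((C.cx.d m l).hom x))
    (z : EnvTensor k A (C.cx.X m) N) (hz : bd C N m l z = 0) :
    ∃ y, bd C N n m y = EnvTensor.map g LinearMap.id z := by
  refine ⟨EnvTensor.map a LinearMap.id z, ?_⟩
  rw [show g = (C.cx.d n m).hom ∘ₗ a + b ∘ₗ (C.cx.d m l).hom from LinearMap.ext hab,
    EnvTensor.map_add_left, ← LinearMap.comp_id (LinearMap.id : N →ₗ[Env k A] N),
    ← EnvTensor.map_comp_apply, ← EnvTensor.map_comp_apply, LinearMap.comp_id]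
  rw [show EnvTensor.map (C.cx.d m l).hom LinearMap.id z = bd C N m l z from rfl, hz, map_zero,
    add_zero]
  rfl

end

end Complexes

end TateHochschild

end

noncomputable section

namespace TateHochschild

open CategoryTheory

/-! ### Comparison of the complete and the projective resolution. -/

section Comparison

variable {k : Type u} {A : Type v} [Field k] [Ring A] [Algebra k A]
variable {C : AugComplex.{u, v, w} k A} {C' : AugComplex.{u, v, w'} k A}

/-- In each degree `n ≥ 0`, a chain map between two resolutions of `A` has a homotopy inverse. -/
theorem AugComplex.Hom.exists_homotopy_inverse (ϑ : C.Hom C') (h : C.IsResolution)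
    (h' : C'.IsResolution) {n : ℤ} (hn : 0 ≤ n) :
    ∀ m l o, n + 1 = m → l + 1 = n → m + 1 = o →
      ∃ (τ : C'.cx.X n →ₗ[Env k A] C.cx.X n) (τ' : C'.cx.X m →ₗ[Env k A] C.cx.X m)
        (a : C.cx.X n →ₗ[Env k A] C.cx.X m) (b : C.cx.X l →ₗ[Env k A] C.cx.X n)
        (a' : C'.cx.X m →ₗ[Env k A] C'.cx.X o) (b' : C'.cx.X n →ₗ[Env k A] C'.cx.X m),
        (∀ x, (C.cx.d m n).hom (τ' x) = τ ((C'.cx.d m n).hom x)) ∧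
        (∀ x, τ (ϑ.toFun n x) - x = (C.cx.d m n).hom (a x) + b ((C.cx.d n l).hom x)) ∧
        (∀ x, ϑ.toFun m (τ' x) - x = (C'.cx.d o m).hom (a' x) + b' ((C'.cx.d m n).hom x)) := by
  -- Two consecutive components of the inverse are carried along. The homotopy for `τ ϑ` in degree
  -- `n` serves injectivity on homology and surjectivity on cohomology. The homotopy for `ϑ τ'` in
  -- degree `n + 1` serves injectivity on cohomology.
  induction n, hn using Int.leInduction with
  | base =>
    intro m l o hm hl ho
    obtain rfl : m = 1 := by omega
    obtain ⟨τ, hτ⟩ := exists_lift_of_range C.ε C'.ε (fun x => h.surjective _)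
    obtain ⟨τ', hτ'⟩ := exists_lift_of_range (C.cx.d 1 0).hom (τ ∘ₗ (C'.cx.d 1 0).hom)
      (fun x => (h.exact_zero _).1 (by rw [LinearMap.comp_apply, hτ, C'.ε_d]))
    obtain ⟨a, ha⟩ := h.homotopy_zero (g := τ ∘ₗ ϑ.toFun 0 - LinearMap.id) (fun x => by
      rw [LinearMap.sub_apply, map_sub, LinearMap.comp_apply, hτ, ϑ.aug, LinearMap.id_apply,
        sub_self])
    obtain ⟨b', hb'⟩ := h'.homotopy_zero (g := ϑ.toFun 0 ∘ₗ τ - LinearMap.id) (fun x => by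
      rw [LinearMap.sub_apply, map_sub, LinearMap.comp_apply, ϑ.aug, hτ, LinearMap.id_apply,
        sub_self])
    obtain ⟨a', ha'⟩ := h'.homotopy_succ (l := -1)
      (g := ϑ.toFun 0 ∘ₗ τ - LinearMap.id) (g' := ϑ.toFun 1 ∘ₗ τ' - LinearMap.id) (a := b') (b := 0)
      (zero_add 1) ho le_rfl (fun x => by
        rw [LinearMap.sub_apply, LinearMap.sub_apply, map_sub, LinearMap.comp_apply, ← ϑ.comm, hτ']
        rfl)
      (fun x => by rw [hb', LinearMap.zero_apply, add_zero])
    exact ⟨τ, τ', a, 0, a', b', hτ', fun x => by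
      rw [LinearMap.zero_apply, add_zero, ← ha]; rfl, fun x => ha' x⟩
  | succ n hn ih =>
    intro m l o hm hl ho
    obtain rfl : l = n := by omega
    obtain ⟨τ, τ', a, b, a', b', hτ, ha, ha'⟩ := ih (l + 1) (l - 1) m rfl (by omega) hm
    obtain ⟨τ'', hτ''⟩ := exists_lift_of_range (C.cx.d m (l + 1)).hom
      (τ' ∘ₗ (C'.cx.d m (l + 1)).hom)
      (fun x => h.exists_d hm rfl (by omega) _ (by
        rw [LinearMap.comp_apply, hτ, d_d, map_zero]))
    obtain ⟨c, hc⟩ := h.homotopy_succ (g := τ ∘ₗ ϑ.toFun l - LinearMap.id)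
      (g' := τ' ∘ₗ ϑ.toFun (l + 1) - LinearMap.id) rfl hm (by omega) (fun x => by
        rw [LinearMap.sub_apply, LinearMap.sub_apply, map_sub, LinearMap.comp_apply, hτ, ← ϑ.comm]
        rfl) ha
    obtain ⟨c', hc'⟩ := h'.homotopy_succ (g := ϑ.toFun (l + 1) ∘ₗ τ' - LinearMap.id)
      (g' := ϑ.toFun m ∘ₗ τ'' - LinearMap.id) hm ho (by omega) (fun x => by
        rw [LinearMap.sub_apply, LinearMap.sub_apply, map_sub, LinearMap.comp_apply, ← ϑ.comm,
          hτ'']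
        rfl) ha'
    exact ⟨τ', τ'', c, a, c', a', hτ'', hc, hc'⟩

/-- The comparison map from Tate-Hochschild to Hochschild homology is injective in degrees `≥ 0`. -/
theorem comparisonHomology_injective (ϑ : C.Hom C') (h : C.IsResolution) (h' : C'.IsResolution)
    {N : Type w₁} [AddCommGroup N] [Module k N] [Module (Env k A) N] [IsScalarTower k (Env k A) N]
    {n : ℤ} (hn : 0 ≤ n) : Function.Injective (comparisonHomology N ϑ n) := by
  obtain ⟨τ, τ', a, b, -, -, hτ, ha, -⟩ :=
    ϑ.exists_homotopy_inverse h h' hn (n + 1) (n - 1) (n + 1 + 1) rfl (by omega) rfl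
  refine (injective_iff_map_eq_zero _).2 fun z hz => ?_
  obtain ⟨⟨z, hz0⟩, rfl⟩ := Homol.cls_surjective _ _ z
  obtain ⟨y, hy⟩ := Homol.cls_eq_zero.1 hz
  obtain ⟨x, hx⟩ := exists_bd_of_homotopy (g := τ ∘ₗ ϑ.toFun n - LinearMap.id) ha z hz0
  -- If `ϑ z = d y`, then `d (τ' y) = τ ϑ z`, and `x` bounds `τ ϑ z - z`.
  refine Homol.cls_eq_zero.2 ⟨EnvTensor.map τ' LinearMap.id y - x, ?_⟩
  rw [map_sub, hx, EnvTensor.map_sub_left, EnvTensor.map_id_id, sub_eq_iff_eq_add,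
    add_sub_cancel]
  have h1 : EnvTensor.map (ϑ.toFun n) LinearMap.id z = bd C' N (n + 1) n y := hy.symm
  rw [← LinearMap.comp_id (LinearMap.id : N →ₗ[Env k A] N), ← EnvTensor.map_comp_apply, h1, bd, bd,
    EnvTensor.map_comp_apply, EnvTensor.map_comp_apply, ← LinearMap.comp_assoc]
  congr 2
  exact LinearMap.ext hτ

theorem comparisonCohomology_surjective (ϑ : C.Hom C') (h : C.IsResolution) (h' : C'.IsResolution)
    {M : Type w₁} [AddCommGroup M] [Module k M] [Module (Env k A) M] [IsScalarTower k (Env k A) M]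
    {n : ℤ} (hn : 0 ≤ n) : Function.Surjective (comparisonCohomology M ϑ n) := by
  obtain ⟨τ, τ', a, b, -, -, hτ, ha, -⟩ :=
    ϑ.exists_homotopy_inverse h h' hn (n + 1) (n - 1) (n + 1 + 1) rfl (by omega) rfl
  intro u
  obtain ⟨⟨u, hu⟩, rfl⟩ := Homol.cls_surjective _ _ u
  have hu' : ∀ x, u ((C.cx.d (n + 1) n).hom x) = 0 := fun x => LinearMap.congr_fun hu x
  refine ⟨Homol.cls _ _ ⟨u ∘ₗ τ, LinearMap.ext fun x => ?_⟩, ?_⟩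
  · rw [cobd_apply, LinearMap.comp_apply, ← hτ, hu', LinearMap.zero_apply]
  · rw [← sub_eq_zero, comparisonCohomology, Homol.map_cls, ← map_sub]
    refine Homol.cls_eq_zero.2 ⟨u ∘ₗ b, LinearMap.ext fun x => ?_⟩
    change u (b _) = u (τ (ϑ.toFun n x)) - u x
    rw [← map_sub, ha, map_add, hu', zero_add]

/-- A cochain of degree `n - 1` that bounds `u ϑ` has to be carried back by the homotopy inverse in
degree `n - 1`, which is available only for `n ≥ 1`. -/
theorem comparisonCohomology_injective (ϑ : C.Hom C') (h : C.IsResolution) (h' : C'.IsResolution)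
    {M : Type w₁} [AddCommGroup M] [Module k M] [Module (Env k A) M] [IsScalarTower k (Env k A) M]
    {n : ℤ} (hn : 1 ≤ n) : Function.Injective (comparisonCohomology M ϑ n) := by
  obtain ⟨τ, τ', -, -, a', b', hτ, -, ha⟩ :=
    ϑ.exists_homotopy_inverse h h' (n := n - 1) (by omega) n (n - 2) (n + 1) (by omega) (by omega)
      rfl
  refine (injective_iff_map_eq_zero _).2 fun u hz => ?_
  obtain ⟨⟨u, hu⟩, rfl⟩ := Homol.cls_surjective _ _ u
  obtain ⟨y, hy⟩ := Homol.cls_eq_zero.1 hz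
  have hu' : ∀ x, u ((C'.cx.d (n + 1) n).hom x) = 0 := fun x => LinearMap.congr_fun hu x
  have hy' : ∀ x, y ((C.cx.d n (n - 1)).hom x) = u (ϑ.toFun n x) :=
    fun x => LinearMap.congr_fun hy x
  -- Applying the cocycle `u` to `ϑ τ' - 1 = d a' + b' d` gives `u = y d τ' - u b' d`, and `d τ' = τ
  -- d`.
  refine Homol.cls_eq_zero.2 ⟨y ∘ₗ τ - u ∘ₗ b', LinearMap.ext fun x => ?_⟩
  change y (τ _) - u (b' _) = u x
  have h1 := congrArg u (ha x)
  rw [map_sub, map_add, hu', zero_add] at h1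
  rw [← hτ, hy', ← h1, sub_sub_cancel]

end Comparison

end TateHochschild

end

noncomputable section

namespace TateHochschild

open CategoryTheory

/-! ### Unit isomorphisms, counits of a diagonal approximation, and products in degree `0`. -/

section Units

variable {k : Type u} {A : Type v} [Field k] [Ring A] [Algebra k A]
variable {M : Type w₁} [AddCommGroup M] [Module k M] [Module (Env k A) M]
  [IsScalarTower k (Env k A) M]
variable {N : Type w₂} [AddCommGroup N] [Module k N] [Module (Env k A) N]
  [IsScalarTower k (Env k A) N]

theorem rop_mul (a b : A) (m : M) : rop k (a * b) • m = rop k b • rop k a • m :=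
  (rop_rop k b a m).symm

theorem lop_mul (a b : A) (m : M) : lop k (a * b) • m = lop k a • lop k b • m := by
  rw [← lop_mul_lop, mul_smul]

namespace BTensor

variable (k A M) in
/-- The isomorphism `A ⊗_A M → M`, `a ⊗ m ↦ a m`. -/
def leftUnit : BTensor k A A M →ₗ[Env k A] M :=
  ofBimod
    (lift (LinearMap.mk₂ k (fun (a : A) (m : M) => lop k a • m)
        (fun a b m => by rw [lop, TensorProduct.add_tmul, add_smul]; rfl)
        (fun c a m => by rw [lop, ← TensorProduct.smul_tmul', smul_assoc]; rfl)
        (fun a m n => smul_add _ _ _)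
        (fun c a m => smul_comm _ _ _))
      (fun a b m => by
        rw [LinearMap.mk₂_apply, LinearMap.mk₂_apply, rop_regular, lop_mul]))
    (fun a t => by
      induction t using induction with
      | h0 => rw [smul_zero, map_zero, smul_zero]
      | ha x y hx hy => rw [smul_add, map_add, hx, hy, map_add, smul_add]
      | ht b m => rw [lop_smul_tmul, lift_tmul, lift_tmul, LinearMap.mk₂_apply,
          LinearMap.mk₂_apply, lop_regular, lop_mul])
    (fun a t => by
      induction t using induction with
      | h0 => rw [smul_zero, map_zero, smul_zero]
      | ha x y hx hy => rw [smul_add, map_add, hx, hy, map_add, smul_add]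
      | ht b m => rw [rop_smul_tmul, lift_tmul, lift_tmul, LinearMap.mk₂_apply,
          LinearMap.mk₂_apply, lop_rop_comm])

theorem leftUnit_tmul (a : A) (m : M) : leftUnit k A M (tmul k A a m) = lop k a • m := rfl

variable (k A M) in
/-- The isomorphism `M ⊗_A A → M`, `m ⊗ a ↦ m a`. -/
def rightUnit : BTensor k A M A →ₗ[Env k A] M :=
  ofBimod
    (lift (LinearMap.mk₂ k (fun (m : M) (a : A) => rop k a • m)
        (fun a m n => smul_add _ _ _)
        (fun c a m => smul_comm _ _ _)
        (fun m a b => by rw [rop, MulOpposite.op_add, TensorProduct.tmul_add, add_smul]; rfl)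
        (fun c m a => by rw [rop, MulOpposite.op_smul, TensorProduct.tmul_smul, smul_assoc]; rfl))
      (fun a m b => by
        rw [LinearMap.mk₂_apply, LinearMap.mk₂_apply, lop_regular, rop_mul]))
    (fun a t => by
      induction t using induction with
      | h0 => rw [smul_zero, map_zero, smul_zero]
      | ha x y hx hy => rw [smul_add, map_add, hx, hy, map_add, smul_add]
      | ht m b => rw [lop_smul_tmul, lift_tmul, lift_tmul, LinearMap.mk₂_apply,
          LinearMap.mk₂_apply, lop_rop_comm])
    (fun a t => by
      induction t using induction with
      | h0 => rw [smul_zero, map_zero, smul_zero]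
      | ha x y hx hy => rw [smul_add, map_add, hx, hy, map_add, smul_add]
      | ht m b => rw [rop_smul_tmul, lift_tmul, lift_tmul, LinearMap.mk₂_apply,
          LinearMap.mk₂_apply, rop_regular, rop_mul])

theorem rightUnit_tmul (a : A) (m : M) : rightUnit k A M (tmul k A m a) = rop k a • m := rfl

variable (N) in
/-- The map `N → M ⊗_A N`, `n ↦ μ(1) ⊗ n`, for a bimodule map `μ : A → M`. -/
def tensorLeft (μ : A →ₗ[Env k A] M) : N →ₗ[Env k A] BTensor k A M N :=
  ofBimod (mk (μ 1))
    (fun a n => by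
      rw [mk_apply, mk_apply, ← balanced, ← hom_regular_central, lop_smul_tmul])
    (fun a n => by rw [mk_apply, mk_apply, rop_smul_tmul])

theorem tensorLeft_apply (μ : A →ₗ[Env k A] M) (n : N) :
    tensorLeft N μ n = tmul k A (μ 1) n := rfl

end BTensor

variable {C : AugComplex.{u, v, w} k A} (Δ : DiagonalApproximation C)

namespace DiagonalApproximation

/-- The chain map `(ε ⊗ 1) Δ`. -/
def leftCounit (n : ℤ) : C.cx.X n →ₗ[Env k A] C.cx.X n :=
  BTensor.leftUnit k A (C.cx.X n) ∘ₗ BTensor.map C.ε LinearMap.id ∘ₗ Δ.comp n 0 n (zero_add n)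

/-- The chain map `(1 ⊗ ε) Δ`. -/
def rightCounit (n : ℤ) : C.cx.X n →ₗ[Env k A] C.cx.X n :=
  BTensor.rightUnit k A (C.cx.X n) ∘ₗ BTensor.map LinearMap.id C.ε ∘ₗ Δ.comp n n 0 (add_zero n)

theorem leftUnit_map {X Y : Type*} [AddCommGroup X] [Module k X] [Module (Env k A) X]
    [IsScalarTower k (Env k A) X] [AddCommGroup Y] [Module k Y] [Module (Env k A) Y]
    [IsScalarTower k (Env k A) Y] (f : X →ₗ[Env k A] Y) (t : BTensor k A A X) :
    BTensor.leftUnit k A Y (BTensor.map LinearMap.id f t) = f (BTensor.leftUnit k A X t) := by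
  induction t using BTensor.induction with
  | h0 => rw [map_zero, map_zero, map_zero, map_zero]
  | ha x y hx hy => rw [map_add, map_add, map_add, map_add, hx, hy]
  | ht a x => rw [BTensor.map_tmul, BTensor.leftUnit_tmul, BTensor.leftUnit_tmul, map_smul,
      LinearMap.id_apply]

theorem rightUnit_map {X Y : Type*} [AddCommGroup X] [Module k X] [Module (Env k A) X]
    [IsScalarTower k (Env k A) X] [AddCommGroup Y] [Module k Y] [Module (Env k A) Y]
    [IsScalarTower k (Env k A) Y] (f : X →ₗ[Env k A] Y) (t : BTensor k A X A) :
    BTensor.rightUnit k A Y (BTensor.map f LinearMap.id t) = f (BTensor.rightUnit k A X t) := by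
  induction t using BTensor.induction with
  | h0 => rw [map_zero, map_zero, map_zero, map_zero]
  | ha x y hx hy => rw [map_add, map_add, map_add, map_add, hx, hy]
  | ht a x => rw [BTensor.map_tmul, BTensor.rightUnit_tmul, BTensor.rightUnit_tmul, map_smul,
      LinearMap.id_apply]

/-- In the component of `Δ d` in `X_0 ⊗_A X_j`, the term coming from `X_1 ⊗_A X_j` dies under `ε`.
-/
theorem d_leftCounit (i j : ℤ) (x : C.cx.X i) (h : j + 1 = i) :
    (C.cx.d i j).hom (Δ.leftCounit i x) = Δ.leftCounit j ((C.cx.d i j).hom x) := by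
  simp only [leftCounit, LinearMap.comp_apply]
  rw [← Δ.comp_comm i j 0 j 1 i h (zero_add j) (zero_add 1) h x, map_add, map_zsmul,
    BTensor.map_map, BTensor.map_map, LinearMap.id_comp, ← leftUnit_map, BTensor.map_map,
    show C.ε ∘ₗ (C.cx.d 1 0).hom = 0 from LinearMap.ext C.ε_d, BTensor.map_zero_left, zero_add,
    Int.negOnePow_zero, Units.val_one, one_smul, LinearMap.comp_id, LinearMap.comp_id,
    LinearMap.id_comp, LinearMap.id_comp]

theorem d_rightCounit (i j : ℤ) (x : C.cx.X i) (h : j + 1 = i) :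
    (C.cx.d i j).hom (Δ.rightCounit i x) = Δ.rightCounit j ((C.cx.d i j).hom x) := by
  simp only [rightCounit, LinearMap.comp_apply]
  rw [← Δ.comp_comm i j j 0 i 1 h (add_zero j) h (zero_add 1) x, map_add, map_zsmul,
    BTensor.map_map, BTensor.map_map, LinearMap.id_comp, ← rightUnit_map, BTensor.map_map,
    show C.ε ∘ₗ (C.cx.d 1 0).hom = 0 from LinearMap.ext C.ε_d, BTensor.map_zero_right, smul_zero,
    add_zero, LinearMap.comp_id, LinearMap.comp_id, LinearMap.id_comp]

theorem ε_leftUnit (t : BTensor k A (C.cx.X 0) (C.cx.X 0)) :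
    C.ε (BTensor.leftUnit k A _ (BTensor.map C.ε LinearMap.id t)) =
      BTensor.mulA k (BTensor.map C.ε C.ε t) := by
  induction t using BTensor.induction with
  | h0 => simp only [map_zero]
  | ha x y hx hy => simp only [map_add, hx, hy]
  | ht x y =>
    rw [BTensor.map_tmul, BTensor.map_tmul, BTensor.leftUnit_tmul, map_smul, LinearMap.id_apply,
      lop_regular]
    rfl

theorem ε_rightUnit (t : BTensor k A (C.cx.X 0) (C.cx.X 0)) :
    C.ε (BTensor.rightUnit k A _ (BTensor.map LinearMap.id C.ε t)) =
      BTensor.mulA k (BTensor.map C.ε C.ε t) := by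
  induction t using BTensor.induction with
  | h0 => simp only [map_zero]
  | ha x y hx hy => simp only [map_add, hx, hy]
  | ht x y =>
    rw [BTensor.map_tmul, BTensor.map_tmul, BTensor.rightUnit_tmul, map_smul, LinearMap.id_apply,
      rop_regular]
    rfl

theorem ε_leftCounit (x : C.cx.X 0) : C.ε (Δ.leftCounit 0 x) = C.ε x :=
  (ε_leftUnit _).trans (Δ.aug x)

theorem ε_rightCounit (x : C.cx.X 0) : C.ε (Δ.rightCounit 0 x) = C.ε x :=
  (ε_rightUnit _).trans (Δ.aug x)

/-- The chain map `g` is null-homotopic in degree `n`. -/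
def NullHomotopicAt (g : ∀ i, C.cx.X i →ₗ[Env k A] C.cx.X i) (n : ℤ) : Prop :=
  ∀ m l, n + 1 = m → l + 1 = n → ∃ (a : C.cx.X n →ₗ[Env k A] C.cx.X m)
    (b : C.cx.X l →ₗ[Env k A] C.cx.X n),
    ∀ x, g n x = (C.cx.d m n).hom (a x) + b ((C.cx.d n l).hom x)

theorem leftCounit_homotopic (hC : C.IsCompleteResolution) {n : ℤ} (hn : n ≤ -1) :
    NullHomotopicAt (fun n => Δ.leftCounit n - LinearMap.id) n :=
  fun m l hm hl => hC.homotopy (fun n => Δ.leftCounit n - LinearMap.id) (fun i j x h => by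
      rw [LinearMap.sub_apply, LinearMap.sub_apply, map_sub, Δ.d_leftCounit i j x h]; rfl)
    (fun x => by rw [LinearMap.sub_apply, map_sub, ε_leftCounit]; exact sub_self _) hn m l hm hl

theorem rightCounit_homotopic_of_neg (hC : C.IsCompleteResolution) {n : ℤ} (hn : n ≤ -1) :
    NullHomotopicAt (fun n => Δ.rightCounit n - LinearMap.id) n :=
  fun m l hm hl => hC.homotopy (fun n => Δ.rightCounit n - LinearMap.id) (fun i j x h => by
      rw [LinearMap.sub_apply, LinearMap.sub_apply, map_sub, Δ.d_rightCounit i j x h]; rfl)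
    (fun x => by rw [LinearMap.sub_apply, map_sub, ε_rightCounit]; exact sub_self _) hn m l hm hl

theorem rightCounit_homotopic (hC : C.IsResolution) {n : ℤ} (hn : 0 ≤ n) :
    NullHomotopicAt (fun n => Δ.rightCounit n - LinearMap.id) n :=
  fun m l hm hl => hC.homotopy (fun n => Δ.rightCounit n - LinearMap.id) (fun i j x h => by
      rw [LinearMap.sub_apply, LinearMap.sub_apply, map_sub, Δ.d_rightCounit i j x h]; rfl)
    (fun x => by rw [LinearMap.sub_apply, map_sub, ε_rightCounit]; exact sub_self _) hn m l hm hl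

/-- In `x ⊗ (μ(a) ⊗ n)` one has `μ(a) = a μ(1)`, and `a` can be moved to the right of `x`. -/
theorem contract_comp_regular {X : Type*} [AddCommGroup X] [Module k X] [Module (Env k A) X]
    [IsScalarTower k (Env k A) X] (μ : A →ₗ[Env k A] M)
    (z : EnvTensor k A (BTensor k A X A) N) :
    EnvTensor.contractLin μ z =
      EnvTensor.map (BTensor.rightUnit k A X) (BTensor.tensorLeft N μ) z := by
  induction z using EnvTensor.induction with
  | h0 => rw [map_zero, map_zero]
  | ha x y hx hy => rw [map_add, map_add, hx, hy]
  | ht t n =>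
    induction t using BTensor.induction with
    | h0 => rw [EnvTensor.zero_tmul, map_zero, map_zero]
    | ha x y hx hy => rw [EnvTensor.add_tmul, map_add, map_add, hx, hy]
    | ht x a =>
      rw [EnvTensor.contractLin_apply, EnvTensor.contract_tmul, EnvTensor.map_tmul,
        BTensor.rightUnit_tmul, BTensor.tensorLeft_apply, EnvTensor.balanced_rop,
        BTensor.lop_smul_tmul, hom_regular_apply]

theorem capChain_zero (s : ℤ) (h : s + 0 = s) (μ : A →ₗ[Env k A] M)
    (z : EnvTensor k A (C.cx.X s) N) :
    Δ.capChain 0 s s h (μ ∘ₗ C.ε) z =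
      EnvTensor.map (Δ.rightCounit s) (BTensor.tensorLeft N μ) z := by
  rw [capChain_apply, zero_mul, Int.negOnePow_zero, Units.val_one, one_smul,
    EnvTensor.contractLin_comp, EnvTensor.map_comp_apply, contract_comp_regular,
    EnvTensor.map_comp_apply, LinearMap.id_comp, LinearMap.comp_id]
  rfl

/-- The cap product with a class of degree `0`. -/
theorem capChain_zero_homologous {s m l : ℤ} (h : s + 0 = s) (hm : s + 1 = m) (hl : l + 1 = s)
    (hΔ : NullHomotopicAt (fun n => Δ.rightCounit n - LinearMap.id) s) (μ : A →ₗ[Env k A] M)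
    (z : EnvTensor k A (C.cx.X s) N) (hz : bd C N s l z = 0) :
    ∃ e, bd C (BTensor k A M N) m s e = Δ.capChain 0 s s h (μ ∘ₗ C.ε) z -
      EnvTensor.map LinearMap.id (BTensor.tensorLeft N μ) z := by
  obtain ⟨a, b, hab⟩ := hΔ m l hm hl
  obtain ⟨e, he⟩ := exists_bd_of_homotopy hab z hz
  refine ⟨EnvTensor.map LinearMap.id (BTensor.tensorLeft N μ) e, ?_⟩
  rw [Δ.capChain_zero s h, bd_map_right, he, EnvTensor.map_comp_apply, LinearMap.comp_id,
    LinearMap.id_comp, EnvTensor.map_sub_left]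

theorem cupChain_zero (s : ℤ) (h : 0 + s = s) (μ : A →ₗ[Env k A] M)
    (y : C.cx.X s →ₗ[Env k A] N) :
    Δ.cupChain 0 s s h (μ ∘ₗ C.ε) y = BTensor.tensorLeft N μ ∘ₗ y ∘ₗ Δ.leftCounit s := by
  refine LinearMap.ext fun x => ?_
  rw [cupChain_apply, mul_zero, Int.negOnePow_zero, Units.val_one, one_smul]
  simp only [LinearMap.comp_apply, leftCounit]
  generalize Δ.comp s 0 s _ x = t
  induction t using BTensor.induction with
  | h0 => simp only [map_zero]
  | ha x y hx hy => simp only [map_add, hx, hy]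
  | ht x y =>
    rw [BTensor.map_tmul, BTensor.map_tmul, BTensor.leftUnit_tmul, LinearMap.comp_apply,
      BTensor.tensorLeft_apply, map_smul, ← BTensor.balanced, ← hom_regular_central,
      ← hom_regular_apply, LinearMap.id_apply]

/-- The cup product with a class of degree `0`. -/
theorem cupChain_zero_homologous (hC : C.IsCompleteResolution) {s m l : ℤ} (h : 0 + s = s)
    (hm : s + 1 = m) (hl : l + 1 = s) (hs : s ≤ -1) (μ : A →ₗ[Env k A] M)
    (y : C.cx.X s →ₗ[Env k A] N) (hy : cobd C N s m y = 0) :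
    ∃ e, cobd C (BTensor k A M N) l s e =
      Δ.cupChain 0 s s h (μ ∘ₗ C.ε) y - BTensor.tensorLeft N μ ∘ₗ y := by
  obtain ⟨a, b, hab⟩ := Δ.leftCounit_homotopic hC hs m l hm hl
  refine ⟨BTensor.tensorLeft N μ ∘ₗ y ∘ₗ b, LinearMap.ext fun x => ?_⟩
  have h1 := congrArg y (hab x)
  rw [map_add, ← cobd_apply, hy, LinearMap.zero_apply, zero_add] at h1
  rw [cupChain_zero, cobd_apply, LinearMap.comp_apply, LinearMap.comp_apply, ← h1,
    LinearMap.sub_apply, map_sub, map_sub]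
  rfl

/-! ### Naturality and compatibility with the differentials -/

theorem map_capChain {M' : Type*} [AddCommGroup M'] [Module k M'] [Module (Env k A) M']
    [IsScalarTower k (Env k A) M'] (r s p : ℤ) (h : p + r = s) (f : M →ₗ[Env k A] M')
    (u : C.cx.X r →ₗ[Env k A] M) (z : EnvTensor k A (C.cx.X s) N) :
    EnvTensor.map LinearMap.id (BTensor.map f LinearMap.id) (Δ.capChain r s p h u z) =
      Δ.capChain r s p h (f ∘ₗ u) z := by
  rw [capChain_apply, capChain_apply, map_zsmul]
  congr 1
  generalize EnvTensor.map (Δ.comp s p r h) LinearMap.id z = t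
  induction t using EnvTensor.induction with
  | h0 => rw [map_zero, map_zero, map_zero]
  | ha x y hx hy => rw [map_add, map_add, map_add, hx, hy]
  | ht t n =>
    induction t using BTensor.induction with
    | h0 => rw [EnvTensor.zero_tmul, map_zero, map_zero, map_zero]
    | ha x y hx hy => rw [EnvTensor.add_tmul, map_add, map_add, map_add, hx, hy]
    | ht x a => rfl

theorem map_cupChain {M' : Type*} [AddCommGroup M'] [Module k M'] [Module (Env k A) M']
    [IsScalarTower k (Env k A) M'] (r s n : ℤ) (h : r + s = n) (f : M →ₗ[Env k A] M')
    (u : C.cx.X r →ₗ[Env k A] M) (v : C.cx.X s →ₗ[Env k A] N) :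
    BTensor.map f LinearMap.id ∘ₗ Δ.cupChain r s n h u v = Δ.cupChain r s n h (f ∘ₗ u) v := by
  refine LinearMap.ext fun x => ?_
  rw [LinearMap.comp_apply, cupChain_apply, cupChain_apply, map_zsmul, BTensor.map_map,
    LinearMap.id_comp]

/-- The Leibniz rule for a cycle `z`. It says that the cap product with `z` commutes, up to a sign
depending on the degree, with the connecting homomorphisms in the coefficients. -/
theorem bd_capChain_eq {r s p r' p' l : ℤ} (h : p' + r = s) (h' : p + r' = s) (hp : p + 1 = p')
    (hr : r + 1 = r') (hl : l + 1 = s) (v : C.cx.X r →ₗ[Env k A] M)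
    (z : EnvTensor k A (C.cx.X s) N) (hz : bd C N s l z = 0) :
    bd C (BTensor k A M N) p' p (Δ.capChain r s p' h v z) =
      (r'.negOnePow : ℤ) • Δ.capChain r' s p h' (cobd C M r r' v) z := by
  have h1 := Δ.bd_contractLin s l p r p' r' hl (by omega) hp hr v z
  rw [hz, map_zero, map_zero] at h1
  rw [capChain_apply, capChain_apply, map_zsmul, eq_neg_of_add_eq_zero_left h1, ← neg_smul,
    smul_smul, smul_smul]
  congr 1
  subst hp hr
  rw [← Units.val_neg, ← Units.val_mul, ← Units.val_mul]
  congr 1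
  have h2 : -p.negOnePow = (p + 1).negOnePow := (Int.negOnePow_succ p).symm
  rw [h2, ← Int.negOnePow_add, ← Int.negOnePow_add, Int.negOnePow_eq_iff]
  -- The exponents `r (p + 1) + (p + 1)` and `(r + 1) + (r + 1) p` coincide, so half their
  -- difference is `0`.
  exact ⟨0 - 0, by ring⟩

theorem cobd_cupChain_eq {r q n r' n' q' : ℤ} (h : r + q = n) (h' : r' + q = n') (hr : r + 1 = r')
    (hq : q + 1 = q') (v : C.cx.X r →ₗ[Env k A] M) (y : C.cx.X q →ₗ[Env k A] N)
    (hy : cobd C N q q' y = 0) :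
    cobd C (BTensor k A M N) n n' (Δ.cupChain r q n h v y) =
      (q.negOnePow : ℤ) • Δ.cupChain r' q n' h' (cobd C M r r' v) y := by
  refine LinearMap.ext fun x => ?_
  rw [cobd_apply, LinearMap.smul_apply, cupChain_apply, cupChain_apply,
    Δ.map_comp_d n' n r q r' q' (by omega) h hr hq, hy, BTensor.map_zero_right, smul_zero,
    add_zero, smul_smul]
  congr 1
  subst hr
  rw [← Units.val_mul, ← Int.negOnePow_add]
  congr 1
  rw [Int.negOnePow_eq_iff]
  -- Here the exponents `q r` and `q + q (r + 1)` differ by `-2q`.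
  exact ⟨0 - q, by ring⟩

end DiagonalApproximation

end Units

end TateHochschild

end

noncomputable section

namespace TateHochschild

open CategoryTheory

/-! ### Coinduced bimodules and dimension shifting. -/

section Coinduced

variable (k : Type u) (A : Type v) [Field k] [Ring A] [Algebra k A]
variable (M : Type w₁) [AddCommGroup M] [Module k M] [Module (Env k A) M]
  [IsScalarTower k (Env k A) M]

/-- The bimodule `Hom_k(A, M)` with `(a f b)(x) = f(x a) b`. -/
def Coind : Type (max v w₁) := A →ₗ[k] M

instance : AddCommGroup (Coind k A M) := inferInstanceAs (AddCommGroup (A →ₗ[k] M))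

instance : Module k (Coind k A M) := inferInstanceAs (Module k (A →ₗ[k] M))

instance : FunLike (Coind k A M) A M := inferInstanceAs (FunLike (A →ₗ[k] M) A M)

namespace Coind

/-- The left action on `Hom_k(A, M)`. -/
def rhoL : A →ₐ[k] Module.End k (A →ₗ[k] M) :=
  AlgHom.ofLinearMap
    { toFun := fun a =>
        { toFun := fun f => f ∘ₗ LinearMap.mulRight k a
          map_add' := fun f g => rfl
          map_smul' := fun c f => rfl }
      map_add' := fun a b => LinearMap.ext fun f => LinearMap.ext fun x => by
        change f (x * (a + b)) = f (x * a) + f (x * b)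
        rw [mul_add, map_add]
      map_smul' := fun c a => LinearMap.ext fun f => LinearMap.ext fun x => by
        change f (x * (c • a)) = c • f (x * a)
        rw [mul_smul_comm, map_smul] }
    (LinearMap.ext fun f => LinearMap.ext fun x => by
      change f (x * 1) = f x
      rw [mul_one])
    (fun a b => LinearMap.ext fun f => LinearMap.ext fun x => by
      change f (x * (a * b)) = f (x * a * b)
      rw [mul_assoc])

/-- The right action on `Hom_k(A, M)`. -/
def rhoR : Aᵐᵒᵖ →ₐ[k] Module.End k (A →ₗ[k] M) :=
  AlgHom.ofLinearMap
    { toFun := fun b =>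
        { toFun := fun f => BTensor.act (rop k (unop b)) ∘ₗ f
          map_add' := fun f g => LinearMap.comp_add _ _ _
          map_smul' := fun c f => LinearMap.comp_smul _ _ _ }
      map_add' := fun a b => LinearMap.ext fun f => LinearMap.ext fun x => by
        change rop k (unop (a + b)) • f x = rop k (unop a) • f x + rop k (unop b) • f x
        rw [rop, rop, rop, ← add_smul, ← TensorProduct.tmul_add]
        rfl
      map_smul' := fun c a => LinearMap.ext fun f => LinearMap.ext fun x => by
        change rop k (unop (c • a)) • f x = c • rop k (unop a) • f x
        rw [rop, rop, ← smul_assoc, ← TensorProduct.tmul_smul]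
        rfl }
    (LinearMap.ext fun f => LinearMap.ext fun x => by
      change rop k (1 : A) • f x = f x
      exact one_smul (Env k A) _)
    (fun a b => LinearMap.ext fun f => LinearMap.ext fun x => by
      change rop k (unop (a * b)) • f x = rop k (unop a) • rop k (unop b) • f x
      rw [rop_rop, unop_mul])

/-- The action of `Aᵉ` on `Hom_k(A, M)`. -/
def rho : Env k A →ₐ[k] Module.End k (A →ₗ[k] M) :=
  Algebra.TensorProduct.lift (rhoL k A M) (rhoR k A M) (fun _ _ => LinearMap.ext fun _ => rfl)

theorem rho_tmul (a : A) (b : Aᵐᵒᵖ) : rho k A M (a ⊗ₜ[k] b) = rhoL k A M a * rhoR k A M b :=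
  Algebra.TensorProduct.lift_tmul _ _ _ _ _

instance : Module (Env k A) (Coind k A M) :=
  Module.compHom (A →ₗ[k] M) (rho k A M).toRingHom

instance : IsScalarTower k (Env k A) (Coind k A M) where
  smul_assoc c e f := LinearMap.congr_fun (map_smul (rho k A M) c e) f

variable {k A M}

theorem ext {f g : Coind k A M} (h : ∀ x, f x = g x) : f = g := LinearMap.ext h

theorem lop_smul_apply (a : A) (f : Coind k A M) (x : A) :
    (lop k a • f) x = f (x * a) := by
  change (rho k A M (a ⊗ₜ[k] 1) f) x = _
  rw [rho_tmul, map_one, mul_one]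
  rfl

theorem rop_smul_apply (a : A) (f : Coind k A M) (x : A) :
    (rop k a • f) x = rop k a • f x := by
  change (rho k A M (1 ⊗ₜ[k] op a) f) x = _
  rw [rho_tmul, map_one, one_mul]
  rfl

variable {X : Type w₂} [AddCommGroup X] [Module k X] [Module (Env k A) X]
  [IsScalarTower k (Env k A) X]

/-- A homomorphism `f : X → M` of right modules corresponds to the homomorphism
`x ↦ (a ↦ f(a x))` of bimodules from `X` to `Hom_k(A, M)`. -/
def ofRight (f : X →ₗ[k] M) (hf : ∀ (a : A) x, f (rop k a • x) = rop k a • f x) :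
    X →ₗ[Env k A] Coind k A M :=
  BTensor.ofBimod
    { toFun := fun x => f ∘ₗ
        { toFun := fun a : A => lop k a • x
          map_add' := fun a b => by rw [lop, TensorProduct.add_tmul, add_smul]; rfl
          map_smul' := fun c a => by rw [lop, ← TensorProduct.smul_tmul', smul_assoc]; rfl }
      map_add' := fun x y => ext fun a => by
        change f (lop k a • (x + y)) = f (lop k a • x) + f (lop k a • y)
        rw [smul_add, map_add]
      map_smul' := fun c x => ext fun a => by
        change f (lop k a • (c • x)) = c • f (lop k a • x)
        rw [smul_comm, map_smul] }
    (fun a x => ext fun b => by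
      rw [lop_smul_apply]
      change f (lop k b • lop k a • x) = f (lop k (b * a) • x)
      rw [lop_mul])
    (fun a x => ext fun b => by
      rw [rop_smul_apply]
      change f (lop k b • rop k a • x) = rop k a • f (lop k b • x)
      rw [lop_rop_comm, hf])

theorem ofRight_apply (f : X →ₗ[k] M) (hf : ∀ (a : A) x, f (rop k a • x) = rop k a • f x) (x : X)
    (a : A) : ofRight f hf x a = f (lop k a • x) := rfl

variable (k A M) in
/-- Evaluation at `1`, a homomorphism of right modules. -/
def evalOne : Coind k A M →ₗ[k] M := LinearMap.applyₗ (R := k) (1 : A)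

theorem evalOne_apply (f : Coind k A M) : evalOne k A M f = f 1 := rfl

theorem evalOne_rop (a : A) (f : Coind k A M) :
    evalOne k A M (rop k a • f) = rop k a • evalOne k A M f := rop_smul_apply a f 1

theorem apply_eq_evalOne (f : Coind k A M) (a : A) :
    f a = evalOne k A M (lop k a • f) := by
  rw [evalOne_apply, lop_smul_apply, one_mul]

variable (k A M) in
/-- The embedding `M → Hom_k(A, M)`, `m ↦ (a ↦ a m)`. -/
def incl : M →ₗ[Env k A] Coind k A M := ofRight LinearMap.id (fun _ _ => rfl)

theorem evalOne_incl (m : M) : evalOne k A M (incl k A M m) = m := one_smul (Env k A) m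

variable (k A M) in
/-- The cokernel of `M → Hom_k(A, M)`. -/
abbrev Cok : Type (max v w₁) := Coind k A M ⧸ LinearMap.range (incl k A M)

variable (k A M) in
/-- The right linear section of `Hom_k(A, M) → Cok M` whose image is the kernel of the evaluation
at `1`. -/
def sect : Cok k A M →ₗ[k] Coind k A M :=
  Submodule.liftQ ((LinearMap.range (incl k A M)).restrictScalars k)
    (LinearMap.id - (incl k A M).restrictScalars k ∘ₗ evalOne k A M) (by
      rintro _ ⟨m, rfl⟩
      change incl k A M m - incl k A M (evalOne k A M (incl k A M m)) = 0
      rw [evalOne_incl, sub_self]) ∘ₗ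
    (Submodule.Quotient.restrictScalarsEquiv k (LinearMap.range (incl k A M))).symm.toLinearMap

theorem sect_mk (f : Coind k A M) :
    sect k A M (Submodule.mkQ _ f) = f - incl k A M (evalOne k A M f) := rfl

theorem sect_rop (a : A) (c : Cok k A M) :
    sect k A M (rop k a • c) = rop k a • sect k A M c := by
  obtain ⟨f, rfl⟩ := Submodule.mkQ_surjective _ c
  rw [← map_smul, sect_mk, sect_mk, evalOne_rop, map_smul, smul_sub]

section Tensor

variable (N : Type w₃) [AddCommGroup N] [Module k N] [Module (Env k A) N]
  [IsScalarTower k (Env k A) N]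

/-- `f ⊗ N` for a homomorphism `f` of right modules. -/
def mapRight {M₁ : Type w₁} {M₂ : Type w₂} [AddCommGroup M₁] [Module k M₁] [Module (Env k A) M₁]
    [AddCommGroup M₂] [Module k M₂] [Module (Env k A) M₂]
    (f : M₁ →ₗ[k] M₂) (hf : ∀ (a : A) x, f (rop k a • x) = rop k a • f x) :
    BTensor k A M₁ N →ₗ[k] BTensor k A M₂ N :=
  BTensor.lift (BTensor.mk ∘ₗ f) (fun a m n => by
    rw [LinearMap.comp_apply, LinearMap.comp_apply, hf]
    exact BTensor.balanced k A a (f m) n)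

/-- Evaluation at `1` is a left inverse of `incl` that is only right linear, but `- ⊗_A N` uses only
the right structure of its first factor. -/
theorem map_incl_injective :
    Function.Injective (BTensor.map (incl k A M) (LinearMap.id : N →ₗ[Env k A] N)) := by
  refine Function.LeftInverse.injective (g := mapRight N (evalOne k A M) evalOne_rop) fun t => ?_
  induction t using BTensor.induction with
  | h0 => rw [map_zero, map_zero]
  | ha x y hx hy => rw [map_add, map_add, hx, hy]
  | ht m n =>
    change BTensor.tmul k A (evalOne k A M (incl k A M m)) n = _
    rw [evalOne_incl]

theorem map_mkQ_surjective :
    Function.Surjective (BTensor.map (LinearMap.range (incl k A M)).mkQ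
      (LinearMap.id : N →ₗ[Env k A] N)) := by
  intro t
  induction t using BTensor.induction with
  | h0 => exact ⟨0, map_zero _⟩
  | ha x y hx hy =>
    obtain ⟨a, rfl⟩ := hx
    obtain ⟨b, rfl⟩ := hy
    exact ⟨a + b, map_add _ _ _⟩
  | ht c n =>
    obtain ⟨f, rfl⟩ := Submodule.mkQ_surjective _ c
    exact ⟨BTensor.tmul k A f n, rfl⟩

/-- The identity `incl ∘ evalOne + sect ∘ mkQ = id` consists of right linear maps, so it survives
tensoring with `N`. -/
theorem map_mkQ_exact (t : BTensor k A (Coind k A M) N)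
    (ht : BTensor.map (LinearMap.range (incl k A M)).mkQ (LinearMap.id : N →ₗ[Env k A] N) t = 0) :
    ∃ s, BTensor.map (incl k A M) (LinearMap.id : N →ₗ[Env k A] N) s = t := by
  have key : ∀ t, BTensor.map (incl k A M) (LinearMap.id : N →ₗ[Env k A] N)
      (mapRight N (evalOne k A M) evalOne_rop t) +
      mapRight N (sect k A M) sect_rop (BTensor.map (LinearMap.range (incl k A M)).mkQ
        (LinearMap.id : N →ₗ[Env k A] N) t) = t := by
    intro t
    induction t using BTensor.induction with
    | h0 => simp only [map_zero, add_zero]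
    | ha x y hx hy =>
      simp only [map_add]
      conv_rhs => rw [← hx, ← hy]
      abel
    | ht f n =>
      change BTensor.tmul k A (incl k A M (evalOne k A M f)) n +
        BTensor.tmul k A (f - incl k A M (evalOne k A M f)) n = _
      rw [← BTensor.add_tmul, add_sub_cancel]
  refine ⟨mapRight N (evalOne k A M) evalOne_rop t, ?_⟩
  have := key t
  rwa [ht, map_zero, add_zero] at this

end Tensor

/-- Lifting of right linear maps on projective bimodules. -/
theorem exists_right_lift [Module.Projective (Env k A) X] {Y : Type w₃} {Z : Type w₄}
    [AddCommGroup Y] [Module k Y] [Module (Env k A) Y] [IsScalarTower k (Env k A) Y]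
    [AddCommGroup Z] [Module k Z] [Module (Env k A) Z] [IsScalarTower k (Env k A) Z]
    (d : Y →ₗ[Env k A] Z) (g : X →ₗ[k] Z) (hg : ∀ (a : A) x, g (rop k a • x) = rop k a • g x)
    (h : ∀ x, ∃ y, d y = g x) :
    ∃ l : X →ₗ[k] Y, (∀ (a : A) x, l (rop k a • x) = rop k a • l x) ∧ ∀ x, d (l x) = g x := by
  -- Right linear maps into `Y` are bimodule maps into `Hom_k(A, Y)`. Since `k` is a field, `d` has
  -- a `k`-linear section on its image. Hence every map `A → Z` with values in that image lifts to
  -- `Y`, and projectivity of `X` as a bimodule applies.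
  obtain ⟨s, hs⟩ := (d.restrictScalars k).rangeRestrict.exists_rightInverse_of_surjective
    (LinearMap.range_eq_top.2 (d.restrictScalars k).surjective_rangeRestrict)
  have hs' : ∀ z : LinearMap.range (d.restrictScalars k), d (s z) = z := fun z =>
    congrArg Subtype.val (LinearMap.congr_fun hs z)
  obtain ⟨l, hl⟩ := exists_lift_of_range (R := Env k A)
    (ofRight (d.restrictScalars k ∘ₗ evalOne k A Y) (fun a f => by
      rw [LinearMap.comp_apply, evalOne_rop]; exact map_smul d _ _))
    (ofRight g hg) (fun x => by
      let f : Coind k A Y := s ∘ₗ LinearMap.codRestrict (LinearMap.range (d.restrictScalars k))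
        (ofRight g hg x) (fun a => h _)
      refine ⟨f, ext fun a => ?_⟩
      change d (evalOne k A Y (lop k a • f)) = _
      rw [← apply_eq_evalOne]
      exact hs' _)
  refine ⟨evalOne k A Y ∘ₗ l.restrictScalars k, fun a x => ?_, fun x => ?_⟩
  · change evalOne k A Y (l (rop k a • x)) = _
    rw [map_smul, evalOne_rop]
    rfl
  · have h1 := DFunLike.congr_fun (hl x) (1 : A)
    rw [ofRight_apply, ofRight_apply, lop_one, one_smul, one_smul] at h1
    exact h1

end Coind

variable {k A} {C : AugComplex.{u, v, w} k A}

/-- A resolution of `A` splits as a complex of right modules. -/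
theorem AugComplex.IsResolution.exists_right_splitting (h : C.IsResolution) {n : ℤ} (hn : 0 ≤ n) :
    ∀ m, n + 1 = m → ∃ s : C.cx.X n →ₗ[k] C.cx.X m,
      (∀ (a : A) x, s (rop k a • x) = rop k a • s x) ∧
      ∀ x, (C.cx.d m n).hom (s ((C.cx.d m n).hom x)) = (C.cx.d m n).hom x := by
  induction n, hn using Int.leInduction with
  | base =>
    rintro m hm
    obtain rfl : m = 1 := by omega
    obtain ⟨x₀, hx₀⟩ := h.surjective 1
    -- `a ↦ x₀ a` is a right linear section of `ε`. Subtracting its composite with `ε` from the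
    -- identity gives a right linear projection onto `Ker ε`, the image of `d₁`.
    let g : C.cx.X 0 →ₗ[k] C.cx.X 0 := LinearMap.id -
      (LinearMap.mk₂ k (fun (a : A) (x : C.cx.X 0) => rop k a • x)
        (fun a b m => by rw [rop, MulOpposite.op_add, TensorProduct.tmul_add, add_smul]; rfl)
        (fun c a m => by rw [rop, MulOpposite.op_smul, TensorProduct.tmul_smul, smul_assoc]; rfl)
        (fun a m n => smul_add _ _ _)
        (fun c a m => smul_comm _ _ _)).flip x₀ ∘ₗ C.ε.restrictScalars k
    have hg : ∀ x, g x = x - rop k (C.ε x) • x₀ := fun _ => rfl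
    obtain ⟨s, hs, hds⟩ := Coind.exists_right_lift (C.cx.d 1 0).hom g
      (fun a x => by rw [hg, hg, map_smul, rop_regular, rop_mul, smul_sub])
      (fun x => (h.exact_zero _).1 (by
        rw [hg, map_sub, map_smul, hx₀, rop_regular, one_mul, sub_self]))
    exact ⟨s, hs, fun x => by
      rw [hds, hg, C.ε_d, show rop k (0 : A) = 0 by rw [rop, op_zero, TensorProduct.tmul_zero],
        zero_smul, sub_zero]⟩
  | succ n hn ih =>
    intro m hm
    obtain ⟨s, hs, hds⟩ := ih (n + 1) rfl
    -- As `d s d = d`, the map `1 - s d` has values in the cycles, that is, in the boundaries, and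
    -- it is the identity on them.
    obtain ⟨s', hs', hds'⟩ := Coind.exists_right_lift (C.cx.d m (n + 1)).hom
      (LinearMap.id - s ∘ₗ (C.cx.d (n + 1) n).hom.restrictScalars k)
      (fun a x => by
        change rop k a • x - s ((C.cx.d (n + 1) n).hom (rop k a • x)) =
          rop k a • (x - s ((C.cx.d (n + 1) n).hom x))
        rw [map_smul, hs, smul_sub])
      (fun x => h.exists_d hm rfl (by omega) _ (by
        change (C.cx.d (n + 1) n).hom (x - s ((C.cx.d (n + 1) n).hom x)) = 0
        rw [map_sub, hds, sub_self]))
    refine ⟨s', hs', fun x => ?_⟩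
    rw [hds']
    change (C.cx.d m (n + 1)).hom x - s ((C.cx.d (n + 1) n).hom _) = _
    rw [d_d, map_zero, sub_zero]

variable {M}

/-- The cohomology of a resolution with coefficients in a coinduced bimodule vanishes in positive
degrees. -/
theorem AugComplex.IsResolution.exists_cobd_coind (h : C.IsResolution) {l m n : ℤ} (hl : l + 1 = m)
    (hm : m + 1 = n) (hl0 : 0 ≤ l) (u : C.cx.X m →ₗ[Env k A] Coind k A M)
    (hu : ∀ x, u ((C.cx.d n m).hom x) = 0) :
    ∃ v : C.cx.X l →ₗ[Env k A] Coind k A M, ∀ x, v ((C.cx.d m l).hom x) = u x := by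
  obtain ⟨s, hs, hds⟩ := h.exists_right_splitting hl0 m hl
  refine ⟨Coind.ofRight (Coind.evalOne k A M ∘ₗ u.restrictScalars k ∘ₗ s) (fun a x => ?_),
    fun x => Coind.ext fun a => ?_⟩
  · change Coind.evalOne k A M (u (s _)) = rop k a • Coind.evalOne k A M (u (s x))
    rw [hs, map_smul, Coind.evalOne_rop]
  · rw [Coind.ofRight_apply, Coind.apply_eq_evalOne]
    change Coind.evalOne k A M (u (s _)) = _
    rw [← map_smul, ← map_smul]
    congr 1
    -- `a x` and `s d (a x)` differ by a cycle. In the positive degree `m` it is a boundary, and the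
    -- cocycle `u` kills it.
    obtain ⟨y, hy⟩ := h.exists_d hm hl (by omega)
      (lop k a • x - s ((C.cx.d m l).hom (lop k a • x))) (by
        rw [map_sub, hds, sub_self])
    have h1 := hu y
    rw [hy, map_sub, sub_eq_zero] at h1
    exact h1.symm

/-- Dimension shifting: a cocycle of positive degree with values in `M` comes, through the
connecting homomorphism, from a cocycle with values in the cokernel of `M → Hom_k(A, M)`. -/
theorem AugComplex.IsResolution.exists_shift (h : C.IsResolution) {l m n : ℤ} (hl : l + 1 = m)
    (hm : m + 1 = n) (hl0 : 0 ≤ l) (u : C.cx.X m →ₗ[Env k A] M) (hu : cobd C M m n u = 0) :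
    ∃ v : C.cx.X l →ₗ[Env k A] Coind k A M,
      cobd C (Coind k A M) l m v = Coind.incl k A M ∘ₗ u ∧
      cobd C (Coind.Cok k A M) l m ((LinearMap.range (Coind.incl k A M)).mkQ ∘ₗ v) = 0 := by
  obtain ⟨v, hv⟩ := h.exists_cobd_coind hl hm hl0 (Coind.incl k A M ∘ₗ u) (fun x => by
    rw [LinearMap.comp_apply, ← cobd_apply, hu, LinearMap.zero_apply, map_zero])
  refine ⟨v, LinearMap.ext hv, LinearMap.ext fun x => ?_⟩
  rw [cobd_apply, LinearMap.comp_apply, hv]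
  exact (Submodule.Quotient.mk_eq_zero _).2 ⟨u x, rfl⟩

/-- Two chains with the same connecting data are homologous. -/
theorem exists_bd_of_connecting {K : Type w₁} {K' : Type w₂} {K'' : Type w₃}
    [AddCommGroup K] [Module k K] [Module (Env k A) K] [IsScalarTower k (Env k A) K]
    [AddCommGroup K'] [Module k K'] [Module (Env k A) K'] [IsScalarTower k (Env k A) K']
    [AddCommGroup K''] [Module k K''] [Module (Env k A) K''] [IsScalarTower k (Env k A) K'']
    {i : K →ₗ[Env k A] K'} {p : K' →ₗ[Env k A] K''} (hi : Function.Injective i)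
    (hp : Function.Surjective p) (hip : ∀ y, p y = 0 → ∃ x, i x = y) {l m n : ℤ}
    (c : EnvTensor k A (C.cx.X l) K) (b : EnvTensor k A (C.cx.X m) K')
    (e : EnvTensor k A (C.cx.X n) K'') (hb : bd C K' m l b = EnvTensor.map LinearMap.id i c)
    (he : bd C K'' n m e = EnvTensor.map LinearMap.id p b) :
    ∃ c', bd C K m l c' = c := by
  -- Lift `e` to `K'` and subtract its boundary from `b`. The result comes from `K` and has the same
  -- boundary as `b`.
  obtain ⟨e', rfl⟩ := EnvTensor.map_id_surjective p hp e
  obtain ⟨c', hc'⟩ := EnvTensor.map_id_exact i p hip (b - bd C K' n m e') (by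
    rw [map_sub, ← bd_map_right, he, sub_self])
  refine ⟨c', EnvTensor.map_id_injective i hi ?_⟩
  rw [← bd_map_right, hc', map_sub, bd_bd, sub_zero, hb]

end Coinduced

end TateHochschild

end

noncomputable section

namespace TateHochschild

open CategoryTheory

/-! ### Compatibility of the comparison map with the cap products. -/

section CapComparison

variable {k : Type u} {A : Type v} [Field k] [Ring A] [Algebra k A]
variable {C : AugComplex.{u, v, w} k A} {C' : AugComplex.{u, v, w'} k A}
variable {N : Type w₂} [AddCommGroup N] [Module k N] [Module (Env k A) N]
  [IsScalarTower k (Env k A) N]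

/-- A cocycle of degree `0` of a resolution factors through the augmentation. -/
theorem AugComplex.IsResolution.exists_factor (h : C.IsResolution) {M : Type w₁} [AddCommGroup M]
    [Module k M] [Module (Env k A) M] [IsScalarTower k (Env k A) M] (u : C.cx.X 0 →ₗ[Env k A] M)
    (hu : ∀ x, u ((C.cx.d 1 0).hom x) = 0) : ∃ μ : A →ₗ[Env k A] M, u = μ ∘ₗ C.ε := by
  obtain ⟨x₀, hx₀⟩ := h.surjective 1
  have hε : ∀ x, C.ε x = 0 → u x = 0 := fun x hx => by
    obtain ⟨y, rfl⟩ := (h.exact_zero x).1 hx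
    exact hu y
  refine ⟨ofCentral (u x₀) (fun a => ?_), LinearMap.ext fun x => ?_⟩
  · rw [← map_smul, ← map_smul, ← sub_eq_zero, ← map_sub]
    exact hε _ (by rw [map_sub, map_smul, map_smul, hx₀, lop_regular, rop_regular, mul_one,
      one_mul, sub_self])
  · rw [LinearMap.comp_apply, ofCentral_apply, ← map_smul, ← sub_eq_zero, ← map_sub]
    exact hε _ (by rw [map_sub, map_smul, hx₀, lop_regular, mul_one, sub_self])

/-- The comparison map respects the cap product with `u`, up to boundaries. -/
def CapCompatible (ϑ : C.Hom C') (Δ : DiagonalApproximation C) (Δ' : DiagonalApproximation C')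
    {M : Type w₁} [AddCommGroup M] [Module k M] [Module (Env k A) M] [IsScalarTower k (Env k A) M]
    (r s p : ℤ) (h : p + r = s) (z : EnvTensor k A (C.cx.X s) N)
    (u : C'.cx.X r →ₗ[Env k A] M) : Prop :=
  ∃ e, bd C' (BTensor k A M N) (p + 1) p e =
    EnvTensor.map (ϑ.toFun p) LinearMap.id (Δ.capChain r s p h (u ∘ₗ ϑ.toFun r) z) -
      Δ'.capChain r s p h u (EnvTensor.map (ϑ.toFun s) LinearMap.id z)

variable (ϑ : C.Hom C') (Δ : DiagonalApproximation C) (Δ' : DiagonalApproximation C')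

/-- Since `ϑ` preserves the augmentation, `u = μ ε` pulls back to `μ ε`. Up to boundaries both cap
products then tensor the coefficients with `μ(1)`, which commutes with `ϑ`. -/
theorem capCompatible_zero (hC : C.IsResolution) (hC' : C'.IsResolution) {M : Type w₁}
    [AddCommGroup M] [Module k M] [Module (Env k A) M] [IsScalarTower k (Env k A) M]
    {s p : ℤ} (hs : 0 ≤ s) (h : p + 0 = s) (z : EnvTensor k A (C.cx.X s) N)
    (hz : bd C N s (s - 1) z = 0) (u : C'.cx.X 0 →ₗ[Env k A] M)
    (hu : ∀ x, u ((C'.cx.d 1 0).hom x) = 0) : CapCompatible ϑ Δ Δ' 0 s p h z u := by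
  obtain rfl : p = s := by omega
  obtain ⟨μ, rfl⟩ := hC'.exists_factor u hu
  have hε : (μ ∘ₗ C'.ε) ∘ₗ ϑ.toFun 0 = μ ∘ₗ C.ε := LinearMap.ext fun x =>
    congrArg μ (ϑ.aug x)
  obtain ⟨e, he⟩ := Δ.capChain_zero_homologous h rfl (sub_add_cancel p 1)
    (Δ.rightCounit_homotopic hC hs) μ z hz
  obtain ⟨e', he'⟩ := Δ'.capChain_zero_homologous h rfl (sub_add_cancel p 1)
    (Δ'.rightCounit_homotopic hC' hs) μ (EnvTensor.map (ϑ.toFun p) LinearMap.id z)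
    (by rw [bd_map, hz, map_zero])
  refine ⟨EnvTensor.map (ϑ.toFun (p + 1)) LinearMap.id e - e', ?_⟩
  rw [map_sub, bd_map, he, he', hε, map_sub, EnvTensor.map_comp_apply, EnvTensor.map_comp_apply,
    LinearMap.comp_id, LinearMap.comp_id, LinearMap.id_comp, LinearMap.id_comp]
  abel

/-- The cochain `v` with values in `Hom_k(A, M)` exhibits `u` as a connecting image of a cocycle
with values in `Cok`. By the Leibniz rule the defect for `u` is, up to sign, the connecting image of
the defect for that cocycle, which bounds by induction. -/
theorem capCompatible_succ (hC' : C'.IsResolution) {M : Type w₁}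
    [AddCommGroup M] [Module k M] [Module (Env k A) M] [IsScalarTower k (Env k A) M]
    {r s p r' p' : ℤ} (hr : 0 ≤ r) (hr' : r + 1 = r') (hp : p + 1 = p') (h : p' + r = s)
    (h' : p + r' = s) (z : EnvTensor k A (C.cx.X s) N) (hz : bd C N s (s - 1) z = 0)
    (ih : ∀ v : C'.cx.X r →ₗ[Env k A] Coind.Cok k A M, cobd C' _ r r' v = 0 →
      CapCompatible ϑ Δ Δ' r s p' h z v)
    (u : C'.cx.X r' →ₗ[Env k A] M) (hu : cobd C' M r' (r' + 1) u = 0) :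
    CapCompatible ϑ Δ Δ' r' s p h' z u := by
  obtain ⟨v, hv, hv'⟩ := hC'.exists_shift hr' rfl hr u hu
  obtain ⟨e, he⟩ := ih _ hv'
  subst hp
  have hϑ : cobd C (Coind k A M) r r' (v ∘ₗ ϑ.toFun r) =
      (Coind.incl k A M ∘ₗ u) ∘ₗ ϑ.toFun r' := by
    rw [← hv]
    refine LinearMap.ext fun x => ?_
    rw [cobd_apply, LinearMap.comp_apply, ϑ.comm, LinearMap.comp_apply, cobd_apply]
  refine exists_bd_of_connecting (Coind.map_incl_injective N) (Coind.map_mkQ_surjective N)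
    (Coind.map_mkQ_exact N) _ ((r'.negOnePow : ℤ) •
      (EnvTensor.map (ϑ.toFun (p + 1)) LinearMap.id
          (Δ.capChain r s (p + 1) h (v ∘ₗ ϑ.toFun r) z) -
        Δ'.capChain r s (p + 1) h v (EnvTensor.map (ϑ.toFun s) LinearMap.id z)))
    ((r'.negOnePow : ℤ) • e) ?_ ?_
  · rw [map_zsmul, map_sub, bd_map,
      Δ.bd_capChain_eq h h' rfl hr' (sub_add_cancel s 1) _ z hz,
      Δ'.bd_capChain_eq h h' rfl hr' (sub_add_cancel s 1) _ _ (by rw [bd_map, hz, map_zero]),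
      hϑ, hv, map_zsmul, ← smul_sub, DiagonalApproximation.negOnePow_smul_smul, map_sub,
      Δ'.map_capChain]
    congr 1
    rw [EnvTensor.map_comp_apply, LinearMap.comp_assoc, ← Δ.map_capChain, EnvTensor.map_comp_apply,
      LinearMap.comp_id, LinearMap.id_comp, LinearMap.comp_id, LinearMap.id_comp]
  · rw [map_zsmul, he, map_zsmul, map_sub, Δ'.map_capChain]
    congr 2
    rw [EnvTensor.map_comp_apply, LinearMap.comp_assoc, ← Δ.map_capChain, EnvTensor.map_comp_apply,
      LinearMap.comp_id, LinearMap.id_comp, LinearMap.comp_id, LinearMap.id_comp]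

/-- The induction changes the coefficients to `Cok`, which lives in the universe `max v w₁`. It is
run over all bimodules of that universe, which is closed under this operation; for `M` in `w₁` one
further shift leads there. -/
theorem capCompatible_max (hC : C.IsResolution) (hC' : C'.IsResolution)
    {s : ℤ} (hs : 0 ≤ s) (z : EnvTensor k A (C.cx.X s) N) (hz : bd C N s (s - 1) z = 0)
    {r : ℤ} (hr : 0 ≤ r) :
    ∀ (M : Type (max v w₁)) [AddCommGroup M] [Module k M] [Module (Env k A) M]
      [IsScalarTower k (Env k A) M] (p : ℤ) (h : p + r = s) (u : C'.cx.X r →ₗ[Env k A] M),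
      cobd C' M r (r + 1) u = 0 → CapCompatible ϑ Δ Δ' r s p h z u := by
  induction r, hr using Int.leInduction with
  | base =>
    intro M _ _ _ _ p h u hu
    exact capCompatible_zero ϑ Δ Δ' hC hC' hs h z hz u fun x => LinearMap.congr_fun hu x
  | succ r hr ih =>
    intro M _ _ _ _ p h u hu
    exact capCompatible_succ ϑ Δ Δ' hC' hr rfl rfl (by omega) h z hz
      (fun v hv => ih _ _ _ v hv) u hu

theorem capCompatible (hC : C.IsResolution) (hC' : C'.IsResolution) {M : Type w₁}
    [AddCommGroup M] [Module k M] [Module (Env k A) M] [IsScalarTower k (Env k A) M]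
    {s : ℤ} (hs : 0 ≤ s) (z : EnvTensor k A (C.cx.X s) N) (hz : bd C N s (s - 1) z = 0)
    {r : ℤ} (hr : 0 ≤ r) (p : ℤ) (h : p + r = s) (u : C'.cx.X r →ₗ[Env k A] M)
    (hu : cobd C' M r (r + 1) u = 0) : CapCompatible ϑ Δ Δ' r s p h z u := by
  obtain rfl | hr' := hr.eq_or_lt
  · exact capCompatible_zero ϑ Δ Δ' hC hC' hs h z hz u fun x => LinearMap.congr_fun hu x
  · exact capCompatible_succ ϑ Δ Δ' hC' (r := r - 1) (by omega) (sub_add_cancel r 1) rfl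
      (by omega) h z hz (fun v hv => capCompatible_max.{u, v, w, w', w₁, w₂} ϑ Δ Δ' hC hC' hs z hz
        (by omega) _ _ _ v (by rwa [sub_add_cancel])) u hu

end CapComparison

/-! ### Associativity of cup and cap products with a chain of degree `-1`. -/

section Associativity

variable {k : Type u} {A : Type v} [Field k] [Ring A] [Algebra k A]
variable {C : AugComplex.{u, v, w} k A} (Δ : DiagonalApproximation C) {β : A ≃ₐ[k] A}
variable {N : Type w₂} [AddCommGroup N] [Module k N] [Module (Env k A) N]
  [IsScalarTower k (Env k A) N]

namespace DiagonalApproximation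

/-- The cap product with a chain `w ∈ X_{-1} ⊗ ₁A_β`, where `M ⊗_A ₁A_β` is identified with
`₁M_β`. -/
def capTwist (w : EnvTensor k A (C.cx.X (-1)) (RightTwist β A)) (M : Type w₁) [AddCommGroup M]
    [Module k M] [Module (Env k A) M] [IsScalarTower k (Env k A) M] (n p : ℤ) (h : p + n = -1) :
    (C.cx.X n →ₗ[Env k A] M) →ₗ[k] EnvTensor k A (C.cx.X p) (RightTwist β M) :=
  EnvTensor.map LinearMap.id (twistUnit β M) ∘ₗ (Δ.capChain n (-1) p h).flip w

variable (w : EnvTensor k A (C.cx.X (-1)) (RightTwist β A))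
variable {M : Type w₁} [AddCommGroup M] [Module k M] [Module (Env k A) M]
  [IsScalarTower k (Env k A) M]

theorem capTwist_apply (n p : ℤ) (h : p + n = -1) (u : C.cx.X n →ₗ[Env k A] M) :
    Δ.capTwist w M n p h u =
      EnvTensor.map LinearMap.id (twistUnit β M) (Δ.capChain n (-1) p h u w) := rfl

theorem map_capTwist {M' : Type*} [AddCommGroup M'] [Module k M'] [Module (Env k A) M']
    [IsScalarTower k (Env k A) M'] (n p : ℤ) (h : p + n = -1) (f : M →ₗ[Env k A] M')
    (u : C.cx.X n →ₗ[Env k A] M) :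
    EnvTensor.map LinearMap.id (twistMap β f) (Δ.capTwist w M n p h u) =
      Δ.capTwist w M' n p h (f ∘ₗ u) := by
  rw [capTwist_apply, capTwist_apply, ← Δ.map_capChain, EnvTensor.map_comp_apply,
    EnvTensor.map_comp_apply, twistUnit_comp]

variable {w}

theorem bd_capTwist (hw : bd C (RightTwist β A) (-1) (-1 - 1) w = 0) {n n' p p' : ℤ}
    (h : p' + n = -1) (h' : p + n' = -1) (hp : p + 1 = p') (hn : n + 1 = n')
    (v : C.cx.X n →ₗ[Env k A] M) :
    bd C (RightTwist β M) p' p (Δ.capTwist w M n p' h v) =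
      (n'.negOnePow : ℤ) • Δ.capTwist w M n' p h' (cobd C M n n' v) := by
  rw [capTwist_apply, capTwist_apply, bd_map_right,
    Δ.bd_capChain_eq h h' hp hn (sub_add_cancel (-1) 1) v w hw, map_zsmul]

/-- The defect `u ⌢ (y ⌢ w) - (u ⌣ y) ⌢ w` of the associativity of the products. -/
def assocDefect (w : EnvTensor k A (C.cx.X (-1)) (RightTwist β A)) {q p' : ℤ}
    (hq : p' + q = -1) (y : C.cx.X q →ₗ[Env k A] N) (r p n : ℤ) (h : p + r = p')
    (hn : r + q = n) (u : C.cx.X r →ₗ[Env k A] M) :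
    EnvTensor k A (C.cx.X p) (RightTwist β (BTensor k A M N)) :=
  EnvTensor.map LinearMap.id (twistAssoc β M N)
      (Δ.capChain r p' p h u (Δ.capTwist w N q p' hq y)) -
    Δ.capTwist w (BTensor k A M N) n p (by omega) (Δ.cupChain r q n hn u y)

variable {q p' : ℤ} (hq : p' + q = -1) (y : C.cx.X q →ₗ[Env k A] N)

theorem bd_capTwist_cocycle (hw : bd C (RightTwist β A) (-1) (-1 - 1) w = 0)
    (hy : cobd C N q (q + 1) y = 0) {l : ℤ} (hl : l + 1 = p') :
    bd C (RightTwist β N) p' l (Δ.capTwist w N q p' hq y) = 0 := by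
  rw [Δ.bd_capTwist hw hq (by omega) hl rfl, hy, map_zero, smul_zero]

theorem map_assocDefect {M' : Type*} [AddCommGroup M'] [Module k M'] [Module (Env k A) M']
    [IsScalarTower k (Env k A) M'] {r p n : ℤ} (h : p + r = p') (hn : r + q = n)
    (f : M →ₗ[Env k A] M') (u : C.cx.X r →ₗ[Env k A] M) :
    EnvTensor.map LinearMap.id (twistMap β (BTensor.map f LinearMap.id))
      (Δ.assocDefect w hq y r p n h hn u) = Δ.assocDefect w hq y r p n h hn (f ∘ₗ u) := by
  rw [assocDefect, map_sub, Δ.map_capTwist, Δ.map_cupChain, EnvTensor.map_comp_apply,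
    ← twistAssoc_comp, assocDefect, ← Δ.map_capChain, EnvTensor.map_comp_apply]

/-- The whole defect obeys the same Leibniz rule in `u` as a single cap product, so dimension
shifting applies to it directly. -/
theorem bd_assocDefect (hw : bd C (RightTwist β A) (-1) (-1 - 1) w = 0)
    (hy : cobd C N q (q + 1) y = 0) {r p n r' p₁ n' : ℤ} (hr' : r + 1 = r')
    (hp : p + 1 = p₁) (h : p₁ + r = p') (h' : p + r' = p') (hn : r + q = n) (hn' : r' + q = n')
    (v : C.cx.X r →ₗ[Env k A] M) :
    bd C _ p₁ p (Δ.assocDefect w hq y r p₁ n h hn v) =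
      (r'.negOnePow : ℤ) • Δ.assocDefect w hq y r' p n' h' hn' (cobd C M r r' v) := by
  rw [assocDefect, map_sub, bd_map_right,
    Δ.bd_capChain_eq h h' hp hr' (sub_add_cancel p' 1) _ _
      (Δ.bd_capTwist_cocycle hq y hw hy (sub_add_cancel p' 1)),
    Δ.bd_capTwist hw (n' := n') (p := p) (by omega) (by omega) hp (by omega),
    Δ.cobd_cupChain_eq hn hn' hr' rfl v y hy, map_zsmul, map_zsmul, smul_smul,
    ← Units.val_mul, ← Int.negOnePow_add,
    -- The cap with `w` contributes `(-1)^{n'}` and the cup product `(-1)^q`; since `n' = r' + q`,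
    -- together they give the sign `(-1)^{r'}` of the other term.
    show (n' + q).negOnePow = r'.negOnePow from (Int.negOnePow_eq_iff _ _).2 ⟨q, by omega⟩,
    ← smul_sub, assocDefect]

/-- For `u = μ ε` both iterated products are, up to boundaries, obtained from `y ⌢ w` by tensoring
the coefficients with `μ(1)`. The right counit is used in degree `p' ≥ 0` and the left counit in
degree `q ≤ -1`. -/
theorem capAssociative_zero (hC : C.IsCompleteResolution)
    (hw : bd C (RightTwist β A) (-1) (-1 - 1) w = 0) (hp : 0 ≤ p')
    (hy : cobd C N q (q + 1) y = 0) {p n : ℤ} (h : p + 0 = p')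
    (hn : 0 + q = n) (u : C.cx.X 0 →ₗ[Env k A] M) (hu : ∀ x, u ((C.cx.d 1 0).hom x) = 0) :
    ∃ e, bd C _ (p + 1) p e = Δ.assocDefect w hq y 0 p n h hn u := by
  obtain rfl : p = p' := by omega
  obtain rfl : n = q := by omega
  obtain ⟨μ, rfl⟩ := hC.isResolution.exists_factor u hu
  obtain ⟨e, he⟩ := Δ.capChain_zero_homologous h rfl (sub_add_cancel p 1)
    (Δ.rightCounit_homotopic hC.isResolution hp) μ (Δ.capTwist w N n p hq y)
    (Δ.bd_capTwist_cocycle hq y hw hy (sub_add_cancel p 1))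
  obtain ⟨f, hf⟩ := Δ.cupChain_zero_homologous hC hn rfl (sub_add_cancel n 1) (by omega) μ y hy
  refine ⟨EnvTensor.map LinearMap.id (twistAssoc β M N) e -
    (n.negOnePow : ℤ) • Δ.capTwist w (BTensor k A M N) (n - 1) (p + 1) (by omega) f, ?_⟩
  have h1 : twistAssoc β M N ∘ₗ BTensor.tensorLeft (RightTwist β N) μ =
      twistMap β (BTensor.tensorLeft N μ) := rfl
  rw [assocDefect, map_sub, bd_map_right, he, map_zsmul,
    Δ.bd_capTwist hw (n' := n) (p := p) (by omega) hq rfl (sub_add_cancel n 1), negOnePow_smul_smul,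
    hf, map_sub, map_sub, EnvTensor.map_comp_apply, LinearMap.id_comp, h1, Δ.map_capTwist]
  abel

theorem capAssociative_succ (hC : C.IsCompleteResolution)
    (hw : bd C (RightTwist β A) (-1) (-1 - 1) w = 0)
    (hy : cobd C N q (q + 1) y = 0) {r p n r' p₁ n' : ℤ} (hr : 0 ≤ r) (hr' : r + 1 = r')
    (hp : p + 1 = p₁) (h : p₁ + r = p') (h' : p + r' = p') (hn : r + q = n) (hn' : r' + q = n')
    (ih : ∀ v : C.cx.X r →ₗ[Env k A] Coind.Cok k A M, cobd C _ r r' v = 0 →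
      ∃ e, bd C _ (p₁ + 1) p₁ e = Δ.assocDefect w hq y r p₁ n h hn v)
    (u : C.cx.X r' →ₗ[Env k A] M) (hu : cobd C M r' (r' + 1) u = 0) :
    ∃ e, bd C _ (p + 1) p e = Δ.assocDefect w hq y r' p n' h' hn' u := by
  obtain ⟨v, hv, hv'⟩ := hC.isResolution.exists_shift hr' rfl hr u hu
  obtain ⟨e, he⟩ := ih _ hv'
  subst hp
  refine exists_bd_of_connecting (twistMap_injective β (Coind.map_incl_injective N))
    (twistMap_surjective β (Coind.map_mkQ_surjective N))
    (twistMap_exact β (Coind.map_mkQ_exact N)) _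
    ((r'.negOnePow : ℤ) • Δ.assocDefect w hq y r (p + 1) n h hn v)
    ((r'.negOnePow : ℤ) • e) ?_ ?_
  · rw [map_zsmul, Δ.bd_assocDefect hq y hw hy hr' rfl h h' hn hn', negOnePow_smul_smul, hv,
      Δ.map_assocDefect]
  · rw [map_zsmul, he, map_zsmul, Δ.map_assocDefect]

theorem capAssociative_max (hC : C.IsCompleteResolution)
    (hw : bd C (RightTwist β A) (-1) (-1 - 1) w = 0) (hp : 0 ≤ p')
    (hy : cobd C N q (q + 1) y = 0) {r : ℤ} (hr : 0 ≤ r) :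
    ∀ (M : Type (max v w₁)) [AddCommGroup M] [Module k M] [Module (Env k A) M]
      [IsScalarTower k (Env k A) M] (p n : ℤ) (h : p + r = p') (hn : r + q = n)
      (u : C.cx.X r →ₗ[Env k A] M),
      cobd C M r (r + 1) u = 0 → ∃ e, bd C _ (p + 1) p e = Δ.assocDefect w hq y r p n h hn u := by
  induction r, hr using Int.leInduction with
  | base =>
    intro M _ _ _ _ p n h hn u hu
    exact Δ.capAssociative_zero hq y hC hw hp hy h hn u fun x => LinearMap.congr_fun hu x
  | succ r hr ih =>
    intro M _ _ _ _ p n h hn u hu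
    exact Δ.capAssociative_succ hq y hC hw hy hr rfl rfl (by omega) h rfl hn
      (fun v hv => ih _ _ _ _ _ v hv) u hu

theorem capAssociative (hC : C.IsCompleteResolution)
    (hw : bd C (RightTwist β A) (-1) (-1 - 1) w = 0) (hp : 0 ≤ p')
    (hy : cobd C N q (q + 1) y = 0) {r : ℤ} (hr : 0 ≤ r) (p n : ℤ) (h : p + r = p')
    (hn : r + q = n) (u : C.cx.X r →ₗ[Env k A] M) (hu : cobd C M r (r + 1) u = 0) :
    ∃ e, bd C _ (p + 1) p e = Δ.assocDefect w hq y r p n h hn u := by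
  obtain rfl | hr' := hr.eq_or_lt
  · exact Δ.capAssociative_zero hq y hC hw hp hy h hn u fun x => LinearMap.congr_fun hu x
  · exact Δ.capAssociative_succ hq y hC hw hy (r := r - 1) (by omega) (sub_add_cancel r 1) rfl
      (by omega) h rfl hn (fun v hv => capAssociative_max.{u, v, w, w₁, w₂} Δ hq y hC hw hp hy
        (by omega) _ _ _ _ _ v (by rwa [sub_add_cancel])) u hu

end DiagonalApproximation

end Associativity

end TateHochschild

end

noncomputable section

namespace TateHochschild

open CategoryTheory

/-! ### The fundamental class and the duality it induces. -/

section FundamentalClass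

variable {k : Type u} {A : Type v} [Field k] [Ring A] [Algebra k A] [FiniteDimensional k A]
variable (B : LinearMap.BilinForm k A) (hB : B.Nondegenerate) (ν : A ≃ₐ[k] A)

theorem dualIso_add (c c' y : A) :
    dualIso B hB ν (c + c') y = dualIso B hB ν c y + dualIso B hB ν c' y := by
  rw [dualIso, dualIso, dualIso, ← Finset.sum_add_distrib]
  exact Finset.sum_congr rfl fun i _ => by rw [map_add, mul_add, TensorProduct.add_tmul]

/-- `dualIso` as an additive map of its first argument. -/
def dualIsoHom (y : A) : A →+ Env k A := 
  AddMonoidHom.mk' (fun c => dualIso B hB ν c y) (fun c c' => dualIso_add B hB ν c c' y)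

theorem dualIsoHom_apply (c y : A) : dualIsoHom B hB ν y c = dualIso B hB ν c y := rfl

theorem dualIso_zero (y : A) : dualIso B hB ν 0 y = 0 := map_zero (dualIsoHom B hB ν y)

theorem dualIso_mul_env (hassoc : ∀ a b c, B (a * b) c = B a (b * c))
    (hν : ∀ a b, B a b = B b (ν a)) (c y : A) (e : Env k A) :
    dualIso B hB ν c y * e =
      dualIso B hB ν ((toTwist ν.symm A).symm (flip k A e • toTwist ν.symm A c)) y := by
  induction e using env_induction with
  | ha e e' h h' => rw [mul_add, h, h', ← dualIso_add, map_add, add_smul, map_add]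
  | ht a b =>
    have h1 : (a ⊗ₜ[k] b : Env k A) = lop k a * rop k (unop b) := by
      rw [lop, rop, Algebra.TensorProduct.tmul_mul_tmul, mul_one, one_mul, op_unop]
    rw [dualIso_eq, mul_assoc, h1, dualIso_mul B hB ν hassoc hν, flip_mul, flip_lop, flip_rop,
      mul_smul, rop_toTwist, lop_toTwist, LinearEquiv.symm_apply_apply, ← dualIso_eq, rop_regular,
      lop_regular, mul_assoc]

variable {T : AugComplex.{u, v, w} k A}

/-- The values of `f ∘ d₀` are those of `c ↦ dualIso c`. -/
def HasDualValue (f : T.cx.X (-1) →ₗ[Env k A] Env k A) (c : A) : Prop :=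
  ∀ x, f ((T.cx.d 0 (-1)).hom x) = dualIso B hB ν c (T.ε x)

variable {B hB ν}

theorem HasDualValue.unique (hT : T.IsCompleteResolution)
    {f : T.cx.X (-1) →ₗ[Env k A] Env k A} {c c' : A} (h : HasDualValue B hB ν f c)
    (h' : HasDualValue B hB ν f c') : c = c' := by
  obtain ⟨x, hx⟩ := hT.surjective 1
  refine dualIso_injective B hB ν ?_
  rw [← hx, ← h, ← h']

/-- `f d₀` vanishes on the image of `d₁`, so it factors through `ε`; every bimodule map `A → Aᵉ` is
some `dualIso c`. -/
theorem exists_hasDualValue (hassoc : ∀ a b c, B (a * b) c = B a (b * c))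
    (hT : T.IsCompleteResolution) (f : T.cx.X (-1) →ₗ[Env k A] Env k A) :
    ∃ c, HasDualValue B hB ν f c := by
  obtain ⟨μ, hμ⟩ := hT.isResolution.exists_factor (f ∘ₗ (T.cx.d 0 (-1)).hom)
    (fun x => by rw [LinearMap.comp_apply, d_d, map_zero])
  obtain ⟨c, hc⟩ := exists_eq_dualIso B hB ν hassoc μ
  exact ⟨c, fun x => (LinearMap.congr_fun hμ x).trans (hc _)⟩

/-- `dualIso c` composed with `ε` is a cocycle on `T_0`, and dual exactness extends it over `d₀`. -/
theorem exists_of_dualValue (hassoc : ∀ a b c, B (a * b) c = B a (b * c))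
    (hT : T.IsCompleteResolution) (c : A) : ∃ f, HasDualValue (T := T) B hB ν f c := by
  obtain ⟨f, hf⟩ := hT.exists_extension (i := 1) (j := 0) (l := -1) (by omega) (by omega)
    (dualHom B hB ν hassoc c ∘ₗ T.ε) (fun x => by rw [LinearMap.comp_apply, T.ε_d, map_zero])
  exact ⟨f, fun x => by rw [hf, LinearMap.comp_apply, dualHom_apply]⟩

theorem HasDualValue.rmul (hassoc : ∀ a b c, B (a * b) c = B a (b * c))
    (hν : ∀ a b, B a b = B b (ν a)) {f : T.cx.X (-1) →ₗ[Env k A] Env k A} {c : A}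
    (h : HasDualValue B hB ν f c) (e : Env k A) :
    HasDualValue B hB ν (EnvTensor.rmul e ∘ₗ f)
      ((toTwist ν.symm A).symm (flip k A e • toTwist ν.symm A c)) := fun x => by
  rw [LinearMap.comp_apply, EnvTensor.rmul_apply, h, dualIso_mul_env B hB ν hassoc hν]

theorem HasDualValue.sub_zero {f g : T.cx.X (-1) →ₗ[Env k A] Env k A} {c : A}
    (h : HasDualValue B hB ν f c) (h' : HasDualValue B hB ν g c) (x : T.cx.X 0) :
    (f - g) ((T.cx.d 0 (-1)).hom x) = 0 := by
  rw [LinearMap.sub_apply, h, h', sub_self]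

variable (B hB ν T) in
/-- The chain `w` represents the fundamental class. -/
def IsFundamentalCycle (w : EnvTensor k A (T.cx.X (-1)) (RightTwist ν.symm A)) : Prop :=
  ∀ f : T.cx.X (-1) →ₗ[Env k A] Env k A,
    HasDualValue B hB ν f ((toTwist ν.symm A).symm (EnvTensor.eval f w))

/-- `w = ∑ xᵢ ⊗ cᵢ`, with `cᵢ` the value of the `i`-th coordinate function of a dual basis of
`T_{-1}`. The property extends to all `f` because `f ↦ c_f` is linear for right multiplication on
`Aᵉ`. -/
theorem exists_isFundamentalCycle (hassoc : ∀ a b c, B (a * b) c = B a (b * c))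
    (hν : ∀ a b, B a b = B b (ν a)) (hT : T.IsCompleteResolution) :
    ∃ w, IsFundamentalCycle B hB ν T w := by
  obtain ⟨n, x, f, hx⟩ := exists_dual_basis (R := Env k A) (T.cx.X (-1))
  choose c hc using fun i => exists_hasDualValue (hB := hB) (ν := ν) hassoc hT (f i)
  refine ⟨∑ i, EnvTensor.tmul k A (x i) (toTwist ν.symm A (c i)), fun g y => ?_⟩
  rw [map_sum, map_sum, ← dualIsoHom_apply, map_sum]
  conv_lhs => rw [← hx ((T.cx.d 0 (-1)).hom y), map_sum]
  refine Finset.sum_congr rfl fun i _ => ?_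
  rw [map_smul, hc, smul_eq_mul, dualIso_mul_env B hB ν hassoc hν, EnvTensor.eval_tmul,
    dualIsoHom_apply]

/-- Evaluating the boundary at `f` gives the value belonging to `f d_{-1}`, which is `0` because
`d_{-1} d₀ = 0`. -/
theorem IsFundamentalCycle.bd_eq_zero (hT : T.IsCompleteResolution)
    {w : EnvTensor k A (T.cx.X (-1)) (RightTwist ν.symm A)} (hw : IsFundamentalCycle B hB ν T w)
    (l : ℤ) : bd T (RightTwist ν.symm A) (-1) l w = 0 := by
  refine EnvTensor.ext_eval fun f => ?_
  rw [bd, EnvTensor.eval_map, map_zero, LinearMap.id_apply]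
  refine (toTwist ν.symm A).symm.injective ?_
  rw [map_zero]
  refine (hw _).unique hT fun x => ?_
  rw [LinearMap.comp_apply, d_d, map_zero, dualIso_zero]

theorem IsFundamentalCycle.unique (hT : T.IsCompleteResolution)
    {w w' : EnvTensor k A (T.cx.X (-1)) (RightTwist ν.symm A)}
    (hw : IsFundamentalCycle B hB ν T w) (hw' : IsFundamentalCycle B hB ν T w') : w = w' :=
  EnvTensor.ext_eval fun f => (toTwist ν.symm A).symm.injective ((hw f).unique hT (hw' f))

theorem existsUnique_isFundamentalClass (hassoc : ∀ a b c, B (a * b) c = B a (b * c))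
    (hν : ∀ a b, B a b = B b (ν a)) (hT : T.IsCompleteResolution) :
    ∃! ω, IsFundamentalClass B hB ν T ω := by
  obtain ⟨w, hw⟩ := exists_isFundamentalCycle (hB := hB) hassoc hν hT
  refine ⟨Homol.cls _ _ ⟨w, hw.bd_eq_zero hT _⟩, ⟨_, rfl, hw⟩, ?_⟩
  rintro _ ⟨⟨w', hw'⟩, rfl, h⟩
  have : w' = w := IsFundamentalCycle.unique hT h hw
  subst this
  rfl

/-! ### Duality -/

/-- The duality `- ⌢ w` in degree `n` with coefficients in `M`, on the level of chains. -/
structure DualityAt (Δ : DiagonalApproximation T) {β : A ≃ₐ[k] A}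
    (w : EnvTensor k A (T.cx.X (-1)) (RightTwist β A)) (M : Type w₁) [AddCommGroup M]
    [Module k M] [Module (Env k A) M] [IsScalarTower k (Env k A) M] (n p : ℤ) (h : p + n = -1) :
    Prop where
  inj : ∀ (l m q : ℤ) (u : T.cx.X n →ₗ[Env k A] M), l + 1 = n → n + 1 = m → p + 1 = q →
    cobd T M n m u = 0 → (∃ e, bd T (RightTwist β M) q p e = Δ.capTwist w M n p h u) →
    ∃ v, cobd T M l n v = u
  surj : ∀ (m l q : ℤ) (z : EnvTensor k A (T.cx.X p) (RightTwist β M)), n + 1 = m → l + 1 = p →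
    p + 1 = q → bd T (RightTwist β M) p l z = 0 →
    ∃ u, cobd T M n m u = 0 ∧ ∃ e, bd T (RightTwist β M) q p e = Δ.capTwist w M n p h u - z

section Zero

variable (Δ : DiagonalApproximation T) {w : EnvTensor k A (T.cx.X (-1)) (RightTwist ν.symm A)}
variable {M : Type w₁} [AddCommGroup M] [Module k M] [Module (Env k A) M]
  [IsScalarTower k (Env k A) M]

theorem capTwist_zero_homologous (hT : T.IsCompleteResolution) (hw : IsFundamentalCycle B hB ν T w)
    {h : (-1 : ℤ) + 0 = -1} (μ : A →ₗ[Env k A] M) :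
    ∃ e, bd T (RightTwist ν.symm M) 0 (-1) e = Δ.capTwist w M 0 (-1) h (μ ∘ₗ T.ε) -
      EnvTensor.map LinearMap.id (twistMap ν.symm μ) w := by
  obtain ⟨e, he⟩ := Δ.capChain_zero_homologous h (m := 0) (l := -2) (by omega) (by omega)
    (Δ.rightCounit_homotopic_of_neg hT le_rfl) μ w (hw.bd_eq_zero hT _)
  refine ⟨EnvTensor.map LinearMap.id (twistUnit ν.symm M) e, ?_⟩
  have h1 : twistUnit ν.symm M ∘ₗ BTensor.tensorLeft (RightTwist ν.symm A) μ =
      twistMap ν.symm μ := by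
    refine LinearMap.ext fun a => ?_
    obtain ⟨a, rfl⟩ := (toTwist ν.symm A).surjective a
    rw [LinearMap.comp_apply, BTensor.tensorLeft_apply, twistUnit_tmul, twistMap_toTwist,
      ← hom_regular_central, ← hom_regular_apply]
  rw [bd_map_right, he, map_sub, EnvTensor.map_comp_apply, LinearMap.id_comp, h1,
    DiagonalApproximation.capTwist_apply]

/-- A trace from `T₀ ⊗ ₁M_{ν⁻¹}` extends over `d₀`. -/
theorem exists_extension_of_eval (hassoc : ∀ a b c, B (a * b) c = B a (b * c))
    (hν : ∀ a b, B a b = B b (ν a)) (hT : T.IsCompleteResolution)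
    (y : EnvTensor k A (T.cx.X 0) (RightTwist ν.symm M)) :
    ∃ v : T.cx.X (-1) →ₗ[Env k A] M, ∀ x, v ((T.cx.d 0 (-1)).hom x) =
      lop k (T.ε x) • (toTwist ν.symm M).symm
        (EnvTensor.eval (dualHom B hB ν hassoc 1 ∘ₗ T.ε) y) := by
  induction y using EnvTensor.induction with
  | h0 => exact ⟨0, fun x => by rw [map_zero, map_zero, smul_zero, LinearMap.zero_apply]⟩
  | ha y y' hy hy' =>
    obtain ⟨v, hv⟩ := hy
    obtain ⟨v', hv'⟩ := hy'
    exact ⟨v + v', fun x => by rw [LinearMap.add_apply, hv, hv', map_add, map_add, smul_add]⟩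
  | ht x m =>
    obtain ⟨m, rfl⟩ := (toTwist ν.symm M).surjective m
    -- The twisted Casimir element is central, so it defines a bimodule map `A → Aᵉ`, whose
    -- composite with `ε` extends over `d₀`. Following the extension by the map `Aᵉ → M` with `1 ↦ m
    -- ν⁻¹(ε(x))` produces the trace of `x ⊗ m`.
    obtain ⟨g, hg⟩ := hT.exists_extension (i := 1) (j := 0) (l := -1) (by omega) (by omega)
      (ofCentral (twistedCasimir B hB ν) (twistedCasimir_central B hB ν hassoc hν) ∘ₗ T.ε)
      (fun x => by rw [LinearMap.comp_apply, T.ε_d, map_zero])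
    refine ⟨LinearMap.toSpanSingleton _ _ (rop k (ν.symm (T.ε x)) • m) ∘ₗ g, fun x' => ?_⟩
    rw [LinearMap.comp_apply, hg, EnvTensor.eval_tmul, LinearMap.comp_apply, LinearMap.comp_apply,
      dualHom_apply, toTwist_smul, twistEnv_flip_dualIso, LinearEquiv.symm_apply_apply,
      LinearMap.toSpanSingleton_apply, ofCentral_apply, smul_eq_mul, mul_smul, mul_smul]

/-- For `u = μ ε` the product `u ⌢ w` is homologous to the image of `w` under `μ`. If that is a
boundary, evaluation at an `f₁` of value `1` expresses `μ(1)` as a trace, which extends over `d₀`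
and makes `u` a coboundary. Conversely, a cycle `z` is the image of `w` under `y ↦ y m`, where `m`
is its evaluation at `f₁`. -/
theorem dualityAt_zero (hassoc : ∀ a b c, B (a * b) c = B a (b * c))
    (hν : ∀ a b, B a b = B b (ν a)) (hT : T.IsCompleteResolution)
    (hw : IsFundamentalCycle B hB ν T w) (p : ℤ) (h : p + 0 = -1) :
    DualityAt Δ w M 0 p h := by
  obtain rfl : p = -1 := by omega
  obtain ⟨f₁, hf₁⟩ := exists_of_dualValue (hB := hB) (ν := ν) hassoc hT 1
  have hw₁ : EnvTensor.eval f₁ w = toTwist ν.symm A 1 :=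
    (toTwist ν.symm A).symm.injective ((hw f₁).unique hT hf₁)
  constructor
  · rintro l m q u hl hm hq hu ⟨e, he⟩
    obtain rfl : m = 1 := by omega
    obtain rfl : q = 0 := by omega
    obtain rfl : l = -1 := by omega
    obtain ⟨μ, rfl⟩ := hT.isResolution.exists_factor u (fun x => LinearMap.congr_fun hu x)
    obtain ⟨e', he'⟩ := capTwist_zero_homologous Δ hT hw (h := h) μ
    rw [← he] at he'
    have h1 : bd T (RightTwist ν.symm M) 0 (-1) (e - e') =
        EnvTensor.map LinearMap.id (twistMap ν.symm μ) w := by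
      rw [map_sub, he', sub_sub_cancel]
    have h2 := congrArg (EnvTensor.eval f₁) h1
    rw [bd, EnvTensor.eval_map, EnvTensor.eval_map, LinearMap.comp_id, hw₁,
      show f₁ ∘ₗ (T.cx.d 0 (-1)).hom = dualHom B hB ν hassoc 1 ∘ₗ T.ε from LinearMap.ext fun x => by
        rw [LinearMap.comp_apply, LinearMap.comp_apply, dualHom_apply, hf₁], LinearMap.id_apply]
      at h2
    obtain ⟨v, hv⟩ := exists_extension_of_eval (hB := hB) hassoc hν hT (e - e')
    refine ⟨v, LinearMap.ext fun x => ?_⟩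
    rw [cobd_apply, hv, h2, twistMap_toTwist, LinearEquiv.symm_apply_apply, ← hom_regular_apply,
      LinearMap.comp_apply]
  · rintro m l q z hm hl hq hz
    obtain rfl : m = 1 := by omega
    obtain rfl : q = 0 := by omega
    -- Evaluation of a cycle depends only on the value `c_f`: if `f - g` vanishes on the image of
    -- `d₀`, it factors through `d_{-1}`.
    have hz0 : ∀ f g : T.cx.X (-1) →ₗ[Env k A] Env k A, ∀ c, HasDualValue B hB ν f c →
        HasDualValue B hB ν g c → EnvTensor.eval f z = EnvTensor.eval g z := by
      intro f g c hf hg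
      obtain ⟨r, hr⟩ := hT.exists_extension (i := 0) (by omega) hl (f - g) (hf.sub_zero hg)
      rw [← sub_eq_zero, ← EnvTensor.eval_sub,
        show f - g = r ∘ₗ (T.cx.d (-1) l).hom from LinearMap.ext fun x => (hr x).symm]
      have h1 := congrArg (EnvTensor.eval r) hz
      rwa [bd, EnvTensor.eval_map, map_zero, LinearMap.id_apply] at h1
    have hl1 : ∀ f c, HasDualValue B hB ν f c →
        EnvTensor.eval f z = lop k c • EnvTensor.eval f₁ z := by
      intro f c hf
      rw [← flip_rop, ← EnvTensor.eval_rmul]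
      refine hz0 _ _ c hf ?_
      have h1 := hf₁.rmul hassoc hν (rop k c)
      rwa [flip_rop, lop_toTwist, LinearEquiv.symm_apply_apply, lop_regular, mul_one] at h1
    -- On `₁A_{ν⁻¹}` the element `ν(c)` acts on the right as multiplication by `c`. Comparison with
    -- `hl1` will make `m` central.
    have hr1 : ∀ f c, HasDualValue B hB ν f c →
        EnvTensor.eval f z = rop k (ν c) • EnvTensor.eval f₁ z := by
      intro f c hf
      rw [← flip_lop, ← EnvTensor.eval_rmul]
      refine hz0 _ _ c hf ?_
      have h1 := hf₁.rmul hassoc hν (lop k (ν c))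
      rwa [flip_lop, rop_toTwist, LinearEquiv.symm_apply_apply, rop_regular, one_mul,
        AlgEquiv.symm_apply_apply] at h1
    obtain ⟨m, hm'⟩ := (toTwist ν.symm M).surjective (EnvTensor.eval f₁ z)
    have hmc : ∀ a : A, lop k a • m = rop k a • m := fun a => by
      obtain ⟨f, hf⟩ := exists_of_dualValue (hB := hB) (ν := ν) hassoc hT a
      have h1 := (hl1 f a hf).symm.trans (hr1 f a hf)
      rw [← hm', lop_toTwist, rop_toTwist, AlgEquiv.symm_apply_apply] at h1
      exact (toTwist ν.symm M).injective h1
    refine ⟨ofCentral m hmc ∘ₗ T.ε, LinearMap.ext fun x => ?_, ?_⟩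
    · rw [cobd_apply, LinearMap.comp_apply, T.ε_d, map_zero, LinearMap.zero_apply]
    · obtain ⟨e, he⟩ := capTwist_zero_homologous Δ hT hw (h := h) (ofCentral m hmc)
      refine ⟨e, he.trans ?_⟩
      congr 1
      refine EnvTensor.ext_eval fun f => ?_
      rw [EnvTensor.eval_map, LinearMap.comp_id, hl1 f _ (hw f), ← hm', lop_toTwist,
        ← ofCentral_apply m hmc]
      rfl

end Zero

section Shift

variable (Δ : DiagonalApproximation T) {β : A ≃ₐ[k] A}
  {w : EnvTensor k A (T.cx.X (-1)) (RightTwist β A)}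

/-- With coefficients in the projective `Q`, both the cochain complex and the twisted chain complex
of `T` are exact. The connecting homomorphisms thus identify degree `n'` for `M` with degree `n` for
`K`, and they commute with `- ⌢ w` up to sign. The proof chases this square on cochains and chains.
-/
theorem dualityAt_pred_of_exact (hT : T.IsCompleteResolution)
    (hw : bd T (RightTwist β A) (-1) (-1 - 1) w = 0)
    {K : Type w₁} {Q : Type w₂} {M : Type w₃} [AddCommGroup K] [Module k K] [Module (Env k A) K]
    [IsScalarTower k (Env k A) K] [AddCommGroup Q] [Module k Q] [Module (Env k A) Q]
    [IsScalarTower k (Env k A) Q] [AddCommGroup M] [Module k M] [Module (Env k A) M]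
    [IsScalarTower k (Env k A) M] [Module.Projective (Env k A) Q]
    (i : K →ₗ[Env k A] Q) (π : Q →ₗ[Env k A] M) (hi : Function.Injective i)
    (hπ : Function.Surjective π) (hiπ : ∀ x, π (i x) = 0) (hex : ∀ y, π y = 0 → ∃ x, i x = y)
    {n p n' p' : ℤ} (h : p + n = -1) (h' : p' + n' = -1) (hn : n' + 1 = n) (hp : p + 1 = p')
    (hK : DualityAt Δ w K n p h) : DualityAt Δ w M n' p' h' := by
  have hiπ' : π ∘ₗ i = 0 := LinearMap.ext hiπ
  have := projective_twist β (M := Q)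
  constructor
  · rintro l m q u hl hm hq hu ⟨e, he⟩
    obtain rfl : m = n := by omega
    obtain ⟨v, hv⟩ := Module.projective_lifting_property π u hπ
    obtain ⟨κ, hκ⟩ := exists_lift_of_range i (v ∘ₗ (T.cx.d m n').hom) (fun x => hex _ (by
      rw [LinearMap.comp_apply, ← LinearMap.comp_apply, hv, ← cobd_apply, hu,
        LinearMap.zero_apply]))
    have hκ' : cobd T Q n' m v = i ∘ₗ κ := LinearMap.ext fun x => (hκ x).symm
    obtain ⟨κ', hκ''⟩ := hK.inj n' (m + 1) p' κ hn rfl hp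
      (LinearMap.ext fun x => hi (by
        rw [cobd_apply, hκ, LinearMap.comp_apply, d_d, map_zero, LinearMap.zero_apply, map_zero]))
      (exists_bd_of_connecting (twistMap_injective β hi) (twistMap_surjective β hπ)
        (twistMap_exact β hex) _ ((m.negOnePow : ℤ) • Δ.capTwist w Q n' p' h' v)
        ((m.negOnePow : ℤ) • e)
        (by rw [map_zsmul, Δ.bd_capTwist hw h' h hp hn,
          DiagonalApproximation.negOnePow_smul_smul, hκ', Δ.map_capTwist])
        (by rw [map_zsmul, he, map_zsmul, Δ.map_capTwist, hv]))
    -- The lift `v` of `u`, corrected by `i κ'`, is a cocycle with values in `Q`, hence a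
    -- coboundary; the correction vanishes under `π`.
    obtain ⟨r, hr⟩ := hT.exists_extension (i := m) hn hl (v - i ∘ₗ κ') (fun x => by
      rw [LinearMap.sub_apply, LinearMap.comp_apply, ← cobd_apply, ← cobd_apply, hκ'', hκ',
        LinearMap.comp_apply, sub_self])
    refine ⟨π ∘ₗ r, LinearMap.ext fun x => ?_⟩
    rw [cobd_apply, LinearMap.comp_apply, hr, LinearMap.sub_apply, map_sub, LinearMap.comp_apply,
      hiπ, sub_zero, ← LinearMap.comp_apply, hv]
  · rintro m l q z hm hl hq hz
    obtain rfl : m = n := by omega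
    obtain rfl : l = p := by omega
    obtain ⟨y, rfl⟩ := EnvTensor.map_id_surjective (twistMap β π) (twistMap_surjective β hπ) z
    obtain ⟨c, hc⟩ := EnvTensor.map_id_exact (twistMap β i) (twistMap β π) (twistMap_exact β hex)
      (bd T (RightTwist β Q) p' l y) (by rw [← bd_map_right, hz])
    obtain ⟨κ, hκ, e, he⟩ := hK.surj (m + 1) (l - 1) p' c rfl (by omega) hp
      (EnvTensor.map_id_injective (twistMap β i) (twistMap_injective β hi) (by
        rw [← bd_map_right, hc, bd_bd, map_zero]))
    obtain ⟨v, hv⟩ := hT.exists_extension (i := m + 1) rfl hn (i ∘ₗ κ) (fun x => by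
      rw [LinearMap.comp_apply, ← cobd_apply, hκ, LinearMap.zero_apply, map_zero])
    have hv' : cobd T Q n' m v = i ∘ₗ κ := LinearMap.ext hv
    -- The sign on `v` cancels the one in the Leibniz rule. The difference is then a cycle in `T ⊗
    -- ₁Q_β`, so it bounds; its last term dies in `₁M_β`.
    obtain ⟨f, hf⟩ := EnvTensor.exact_of_projective (T.cx.d q p').hom (T.cx.d p' l).hom
      (fun x hx => hT.exists_d hq hp x hx)
      (Δ.capTwist w Q n' p' h' ((m.negOnePow : ℤ) • v) - y -
        EnvTensor.map LinearMap.id (twistMap β i) e) (by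
      change bd T (RightTwist β Q) p' l _ = 0
      rw [map_sub, map_sub, bd_map_right, he, map_zsmul, map_zsmul, Δ.bd_capTwist hw h' h hp hn,
        DiagonalApproximation.negOnePow_smul_smul, hv', map_sub, Δ.map_capTwist, ← hc]
      abel)
    refine ⟨π ∘ₗ ((m.negOnePow : ℤ) • v), LinearMap.ext fun x => ?_,
      EnvTensor.map LinearMap.id (twistMap β π) f, ?_⟩
    · rw [cobd_apply, LinearMap.comp_apply, LinearMap.smul_apply, map_zsmul, hv,
        LinearMap.comp_apply, hiπ, smul_zero, LinearMap.zero_apply]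
    · have hf' : bd T (RightTwist β Q) q p' f = _ := hf
      rw [bd_map_right, hf', map_sub, map_sub, Δ.map_capTwist, EnvTensor.map_comp_apply,
        show twistMap β π ∘ₗ twistMap β i = 0 from LinearMap.ext hiπ, sub_eq_self]
      generalize e = e
      induction e using EnvTensor.induction with
      | h0 => rw [map_zero]
      | ht x n => rw [EnvTensor.map_tmul, LinearMap.zero_apply, ← EnvTensor.mk_apply, map_zero]
      | ha x y hx hy => rw [map_add, hx, hy, add_zero]

theorem dualityAt_pred (hT : T.IsCompleteResolution)
    (hw : bd T (RightTwist β A) (-1) (-1 - 1) w = 0)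
    (M : Type w₁) [AddCommGroup M] [Module k M] [Module (Env k A) M]
    [IsScalarTower k (Env k A) M] {n p n' p' : ℤ} (h : p + n = -1) (h' : p' + n' = -1)
    (hn : n' + 1 = n) (hp : p + 1 = p')
    (hK : DualityAt Δ w
      (LinearMap.ker (Finsupp.linearCombination (Env k A) (id : M → M))) n p h) :
    DualityAt Δ w M n' p' h' :=
  dualityAt_pred_of_exact Δ hT hw (Submodule.subtype _)
    (Finsupp.linearCombination (Env k A) (id : M → M)) (Submodule.injective_subtype _)
    (Finsupp.linearCombination_id_surjective (Env k A) M) (fun x => x.2) (fun y hy => ⟨⟨y, hy⟩, rfl⟩)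
    h h' hn hp hK

end Shift

section Duality

variable (Δ : DiagonalApproximation T) {w : EnvTensor k A (T.cx.X (-1)) (RightTwist ν.symm A)}

/-- As for the cap products, the induction runs in the universe `max v w₁`, which contains the
kernels of the free covers. -/
theorem dualityAt_max (hassoc : ∀ a b c, B (a * b) c = B a (b * c))
    (hν : ∀ a b, B a b = B b (ν a)) (hT : T.IsCompleteResolution)
    (hw : IsFundamentalCycle B hB ν T w) {n : ℤ} (hn : n ≤ 0) :
    ∀ (M : Type (max v w₁)) [AddCommGroup M] [Module k M] [Module (Env k A) M]
      [IsScalarTower k (Env k A) M] (p : ℤ) (h : p + n = -1), DualityAt Δ w M n p h := by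
  induction n, hn using Int.leInductionDown with
  | base =>
    intro M _ _ _ _ p h
    exact dualityAt_zero Δ hassoc hν hT hw p h
  | pred n hn ih =>
    intro M _ _ _ _ p h
    exact dualityAt_pred Δ hT (hw.bd_eq_zero hT _) M (n := n) (p := p - 1) (by omega) h
      (sub_add_cancel n 1) (sub_add_cancel p 1) (ih _ _ _)

theorem dualityAt (hassoc : ∀ a b c, B (a * b) c = B a (b * c))
    (hν : ∀ a b, B a b = B b (ν a)) (hT : T.IsCompleteResolution)
    (hw : IsFundamentalCycle B hB ν T w) {n : ℤ} (hn : n ≤ 0)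
    (M : Type w₁) [AddCommGroup M] [Module k M] [Module (Env k A) M]
    [IsScalarTower k (Env k A) M] (p : ℤ) (h : p + n = -1) : DualityAt Δ w M n p h := by
  obtain rfl | hn' := hn.eq_or_lt
  · exact dualityAt_zero Δ hassoc hν hT hw p h
  · exact dualityAt_pred Δ hT (hw.bd_eq_zero hT _) M (n := n + 1) (p := p - 1) (by omega) h
      rfl (sub_add_cancel p 1)
      (dualityAt_max.{u, v, w, w₁} Δ hassoc hν hT hw (by omega) _ _ _)

/-- The cap product with the fundamental class is an isomorphism in degrees `≤ 0`. -/
theorem capClass_bijective (hassoc : ∀ a b c, B (a * b) c = B a (b * c))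
    (hν : ∀ a b, B a b = B b (ν a)) (hT : T.IsCompleteResolution)
    {ω : Homology T (RightTwist ν.symm A) (-1)} (hω : IsFundamentalClass B hB ν T ω)
    {n : ℤ} (hn : n ≤ 0) (M : Type w₁) [AddCommGroup M] [Module k M] [Module (Env k A) M]
    [IsScalarTower k (Env k A) M] (p : ℤ) (h : p + n = -1) :
    Function.Bijective (capClass Δ ω M n p h) := by
  obtain ⟨⟨w, hw0⟩, rfl, hw⟩ := hω
  have hD := dualityAt (w := w) Δ hassoc hν hT hw hn M p h
  constructor
  · refine (injective_iff_map_eq_zero _).2 fun u hu => ?_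
    obtain ⟨⟨u, hu0⟩, rfl⟩ := Homol.cls_surjective _ _ u
    exact Homol.cls_eq_zero.2 (hD.inj (n - 1) (n + 1) (p + 1) u (sub_add_cancel n 1) rfl rfl hu0
      (Homol.cls_eq_zero.1 hu))
  · intro z
    obtain ⟨⟨z, hz⟩, rfl⟩ := Homol.cls_surjective _ _ z
    obtain ⟨u, hu, he⟩ := hD.surj (n + 1) (p - 1) (p + 1) z rfl (sub_add_cancel p 1) rfl hz
    refine ⟨Homol.cls _ _ ⟨u, hu⟩, ?_⟩
    rw [← sub_eq_zero]
    exact Homol.cls_eq_zero.2 he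

end Duality

end FundamentalClass

end TateHochschild

end

noncomputable section

namespace TateHochschild

/-! ### The product formulas on homology classes. -/

section Classes

variable {k : Type u} {A : Type v} [Field k] [Ring A] [Algebra k A]
variable {M : Type w₁} [AddCommGroup M] [Module k M] [Module (Env k A) M]
  [IsScalarTower k (Env k A) M]
variable {N : Type w₂} [AddCommGroup N] [Module k N] [Module (Env k A) N]
  [IsScalarTower k (Env k A) N]

/-- The comparison map respects the cap product. -/
theorem comparisonHomology_twistedCap {C : AugComplex.{u, v, w} k A} {C' : AugComplex.{u, v, w'} k A}
    (ϑ : C.Hom C') (hC : C.IsResolution) (hC' : C'.IsResolution) (Δ : DiagonalApproximation C)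
    (Δ' : DiagonalApproximation C') (β : A ≃ₐ[k] A) {r s p : ℤ} (hr : 0 ≤ r) (hs : 0 ≤ s)
    (h : p + r = s) (u : Cohomology C' M r) (z : Homology C (RightTwist β N) s) :
    comparisonHomology _ ϑ p (twistedCap Δ β M N r s p h (comparisonCohomology M ϑ r u) z) =
      twistedCap Δ' β M N r s p h u (comparisonHomology _ ϑ s z) := by
  obtain ⟨⟨u, hu⟩, rfl⟩ := Homol.cls_surjective _ _ u
  obtain ⟨⟨z, hz⟩, rfl⟩ := Homol.cls_surjective _ _ z
  obtain ⟨e, he⟩ := capCompatible ϑ Δ Δ' hC hC' hs z hz hr p h u hu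
  rw [← sub_eq_zero]
  refine Homol.cls_eq_zero.2 ⟨EnvTensor.map LinearMap.id (twistAssoc β M N) e, ?_⟩
  rw [bd_map_right, he, map_sub, EnvTensor.map_comp_apply, LinearMap.id_comp, LinearMap.comp_id]
  change _ = EnvTensor.map _ _ (EnvTensor.map _ _ _) - EnvTensor.map _ _ _
  rw [EnvTensor.map_comp_apply, LinearMap.id_comp, LinearMap.comp_id]
  rfl

/-- `u ⌢ (y ⌢ ω) = (u ⌣ y) ⌢ ω`. -/
theorem twistedCap_capClass {C : AugComplex.{u, v, w} k A} (hC : C.IsCompleteResolution)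
    (Δ : DiagonalApproximation C) {ν : A ≃ₐ[k] A} (ω : Homology C (RightTwist ν.symm A) (-1))
    {r q s p n : ℤ} (hr : 0 ≤ r) (hs : 0 ≤ s) (h : p + r = s) (hq : s + q = -1) (hn : r + q = n)
    (hpn : p + n = -1) (u : Cohomology C M r) (y : Cohomology C N q) :
    twistedCap Δ ν.symm M N r s p h u (capClass Δ ω N q s hq y) =
      capClass Δ ω (BTensor k A M N) n p hpn (Δ.cup r q n hn u y) := by
  obtain ⟨⟨u, hu⟩, rfl⟩ := Homol.cls_surjective _ _ u
  obtain ⟨⟨y, hy⟩, rfl⟩ := Homol.cls_surjective _ _ y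
  obtain ⟨⟨w, hw⟩, rfl⟩ := Homol.cls_surjective _ _ ω
  rw [← sub_eq_zero]
  exact Homol.cls_eq_zero.2 (Δ.capAssociative hq y hC hw hs hy hr p n h hn u hu)

end Classes

end TateHochschild

end

/-! ### The commutative square. -/

theorem corollary4p6
    {k : Type u} {A : Type v} [Field k] [Ring A] [Algebra k A] [FiniteDimensional k A]
    (B : LinearMap.BilinForm k A) (hB : B.Nondegenerate)
    (hassoc : ∀ a b c, B (a * b) c = B a (b * c))
    (ν : A ≃ₐ[k] A) (hν : ∀ a b, B a b = B b (ν a))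
    (T : TateHochschild.AugComplex.{u, v, w} k A) (hT : T.IsCompleteResolution)
    (ΔT : TateHochschild.DiagonalApproximation T)
    (P : TateHochschild.AugComplex.{u, v, w'} k A) (hP : P.IsProjectiveResolution)
    (ΔP : TateHochschild.DiagonalApproximation P)
    (ϑ : T.Hom P)
    (M : Type w₁) [AddCommGroup M] [Module k M] [Module (TateHochschild.Env k A) M]
    [IsScalarTower k (TateHochschild.Env k A) M]
    (N : Type w₂) [AddCommGroup N] [Module k N] [Module (TateHochschild.Env k A) N]
    [IsScalarTower k (TateHochschild.Env k A) N]
    (r s : ℤ) (hr : 0 ≤ r) (hs : 1 ≤ s) (hrs : r - s ≤ -1) :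
    -- the fundamental class exists and is unique
    (∃! ω, TateHochschild.IsFundamentalClass B hB ν T ω) ∧
    -- Tate-Hochschild homology in degrees `s - 1` and `s - r - 1` embeds into Hochschild homology
    Function.Injective (TateHochschild.comparisonHomology
      (TateHochschild.RightTwist ν.symm N) ϑ (s - 1)) ∧
    Function.Injective (TateHochschild.comparisonHomology
      (TateHochschild.RightTwist ν.symm (TateHochschild.BTensor k A M N)) ϑ (s - r - 1)) ∧
    ∀ ω, TateHochschild.IsFundamentalClass B hB ν T ω →
      -- the duality isomorphisms `- ⌢ ω`
      ∃ (eN : TateHochschild.Cohomology T N (-s) ≃ₗ[k]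
          TateHochschild.Homology T (TateHochschild.RightTwist ν.symm N) (s - 1))
        (eMN : TateHochschild.Cohomology T (TateHochschild.BTensor k A M N) (r - s) ≃ₗ[k]
          TateHochschild.Homology T
            (TateHochschild.RightTwist ν.symm (TateHochschild.BTensor k A M N)) (s - r - 1))
        -- the cap product in the upper row
        (capMix : TateHochschild.Cohomology P M r ⊗[k]
            TateHochschild.Homology T (TateHochschild.RightTwist ν.symm N) (s - 1) →ₗ[k]
          TateHochschild.Homology T
            (TateHochschild.RightTwist ν.symm (TateHochschild.BTensor k A M N)) (s - r - 1)),
        (∀ y, eN y = TateHochschild.capClass ΔT ω N (-s) (s - 1) (by omega) y) ∧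
        (∀ y, eMN y = TateHochschild.capClass ΔT ω (TateHochschild.BTensor k A M N)
          (r - s) (s - r - 1) (by omega) y) ∧
        -- the upper row is the restriction of the ordinary cap product
        (∀ u z, TateHochschild.comparisonHomology _ ϑ (s - r - 1) (capMix (u ⊗ₜ[k] z)) =
          TateHochschild.twistedCap ΔP ν.symm M N r (s - 1) (s - r - 1) (by omega) u
            (TateHochschild.comparisonHomology _ ϑ (s - 1) z)) ∧
        -- the diagram commutes
        eMN.symm.toLinearMap ∘ₗ capMix =
          TensorProduct.lift (ΔT.cup r (-s) (r - s) (by omega)) ∘ₗ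
            TensorProduct.map (TateHochschild.comparisonCohomology M ϑ r)
              eN.symm.toLinearMap ∧
        -- the left vertical map is an epimorphism, and an isomorphism for `r ≠ 0`
        Function.Surjective (TensorProduct.map (TateHochschild.comparisonCohomology M ϑ r)
          eN.symm.toLinearMap) ∧
        (r ≠ 0 → Function.Bijective (TensorProduct.map
          (TateHochschild.comparisonCohomology M ϑ r) eN.symm.toLinearMap)) := by
  refine ⟨TateHochschild.existsUnique_isFundamentalClass hassoc hν hT,
    TateHochschild.comparisonHomology_injective ϑ hT.isResolution hP.isResolution (by omega),
    TateHochschild.comparisonHomology_injective ϑ hT.isResolution hP.isResolution (by omega),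
    fun ω hω => ?_⟩
  let eN := LinearEquiv.ofBijective _ (TateHochschild.capClass_bijective ΔT hassoc hν hT hω
    (n := -s) (by omega) N (s - 1) (by omega))
  let eMN := LinearEquiv.ofBijective _ (TateHochschild.capClass_bijective ΔT hassoc hν hT hω
    (n := r - s) (by omega) (TateHochschild.BTensor k A M N) (s - r - 1) (by omega))
  have hsurj := TateHochschild.comparisonCohomology_surjective ϑ hT.isResolution hP.isResolution
    (M := M) hr
  -- The upper row is the Tate cap product with `ϑ^* u`; its injective image under `ϑ_*` identifies
  -- it as the restriction of the ordinary one.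
  refine ⟨eN, eMN, TensorProduct.lift
    (TateHochschild.twistedCap ΔT ν.symm M N r (s - 1) (s - r - 1) (by omega) ∘ₗ
      TateHochschild.comparisonCohomology M ϑ r), fun y => rfl, fun y => rfl, fun u z => ?_, ?_,
    TensorProduct.map_surjective hsurj eN.symm.surjective, fun hr0 => ?_⟩
  · rw [TensorProduct.lift.tmul]
    exact TateHochschild.comparisonHomology_twistedCap ϑ hT.isResolution hP.isResolution ΔT ΔP
      ν.symm hr (by omega) (by omega) u z
  · refine TensorProduct.ext' fun u z => ?_
    -- Writing `z = y ⌢ ω` turns the commutativity of the square into `ϑ^* u ⌢ (y ⌢ ω) = (ϑ^* u ⌣ y)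
    -- ⌢ ω`.
    obtain ⟨y, rfl⟩ := eN.surjective z
    rw [LinearMap.comp_apply, LinearMap.comp_apply, TensorProduct.lift.tmul,
      TensorProduct.map_tmul, TensorProduct.lift.tmul, LinearEquiv.coe_coe, LinearEquiv.coe_coe,
      LinearEquiv.symm_apply_apply, LinearEquiv.symm_apply_eq]
    exact TateHochschild.twistedCap_capClass hT ΔT ω hr (by omega) (by omega) (by omega) (by omega)
      (by omega) _ y
  · exact TensorProduct.map_bijective
      ⟨TateHochschild.comparisonCohomology_injective ϑ hT.isResolution hP.isResolution (by omega),
        hsurj⟩ eN.symm.bijective
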